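/- **Setting.** Let $I=(t_0,t_f)$, $t_0<t_f$, $x_0\in\mathbb R^{n_x}$, $\mathbb R^{n_y}=\mathbb R^{n_x}\times\mathbb R^{n_u}\times\mathbb R^{n_p}\ni y=(x,u,p)$, and consider the optimal control problem of minimizing $$\varphi(\mathbf x(t_f),p)+\int_{t_0}^{t_f} l\big(t,\mathbf y(t),\mathbf g(t,\mathbf y(t))\big)\,dt,\quad \mathbf y(t)=(\mathbf x(t),\mathbf u(t),p),$$ subject to $\mathbf x'(t)=f(t,\mathbf y(t),\mathbf g(t,\mathbf y(t)))$ for a.a. $t\in I$ and $\mathbf x(t_0)=x_0$. Let $\mathcal G^3$ be the space of $\mathbf g:I\times\mathbb R^{n_y}\to\mathbb R^{n_g}$ (identified if equal for a.a. $t$ and all $y$) that are three times continuously differentiable in $y$ for a.a. $t$, measurable in $t$ for each $y$, with finite norm $\sum_{k=0}^3\operatorname{ess\,sup}_{t}\sup_y\|\partial_y^k \mathbf g(t,y)\|$. For $q\in\{2,\infty\}$ put $\mathcal Y^q=W^{1,q}(I)^{n_x}\times L^q(I)^{n_u}\times\mathbb R^{n_p}$ and $\mathcal Z^q=\mathcal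 Y^q\times W^{1,q}(I)^{n_x}$. For $\mathbf z=(\mathbf x,\mathbf u,p,\boldsymbol\lambda)\in\mathcal Z^\infty$ and $\mathbf g\in\mathcal G^3$ write $[t]$ for evaluation along the trajectory, at $(t,\mathbf y(t))$ or $(t,\mathbf y(t),\mathbf g(t,\mathbf y(t)))$, and $\varphi[t_f]$ for evaluation at $(\mathbf x(t_f),p)$. Put $A=f_x[\cdot]+f_g[\cdot]\mathbf g_x[\cdot]$, $B=f_u[\cdot]+f_g[\cdot]\mathbf g_u[\cdot]$, $C=f_p[\cdot]+f_g[\cdot]\mathbf g_p[\cdot]$. The optimality system $\psi(\mathbf z;\mathbf g)=0$ is $$\mathbf x'=f[\cdot],\qquad \mathbf x(t_0)=x_0,\qquad \boldsymbol\lambda'=-A^T\boldsymbol\lambda-(\nabla_x l[\cdot]+\mathbf g_x[\cdot]^T\nabla_g l[\cdot]),\qquad \boldsymbol\lambda(t_f)=\nabla_x\varphi[t_f],$$ $$B^T\boldsymbol\lambda+\nabla_u l[\cdot]+\mathbf g_u[\cdot]^T\nabla_g l[\cdot]=0,\qquad \nabla_p\varphi[t_f]+\int_I \big(C^T\boldsymbol\lambda+\nabla_p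 l[t]+\mathbf g_p[t]^T\nabla_g l[t]\big)\,dt=0,$$ with the equations in $t$ holding a.e. on $I$. Let $H(t,y,g)=l(t,y,g)+\boldsymbol\lambda(t)^Tf(t,y,g)$, $\mathbf d=\nabla_gH[\cdot]=\nabla_g l[\cdot]+f_g[\cdot]^T\boldsymbol\lambda$, and, for $a,b\in\{x,u,p\}$, $$H_{ab}=\nabla^2_{ab}H[\cdot]+\nabla^2_{ag}H[\cdot]\,\mathbf g_b[\cdot]+(\nabla^2_{bg}H[\cdot]\,\mathbf g_a[\cdot])^T+\mathbf g_a[\cdot]^T\nabla^2_{gg}H[\cdot]\,\mathbf g_b[\cdot]+\sum_k \mathbf d_k\nabla^2_{ab}\mathbf g_k[\cdot],$$ $$H_{ag}=\nabla^2_{ag}H[\cdot]+\mathbf g_a[\cdot]^T\nabla^2_{gg}H[\cdot].$$ So $(H_{ab})$ is the Hessian of $y\mapsto H(t,y,\mathbf g(t,y))$ at $\mathbf y(t)$. **Smoothness assumptions.** $\varphi$ is twice continuously differentiable. Each $h\in\{f,l\}$ is measurable in $t$ for every $(y,g)$ and twice continuously differentiable in $(y,g)$ for a.a. $t$. There is $K$,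 and for every $R>0$ there is $L(R)$, such that for $s\in\{0,1,2\}$ and a.a. $t$: $\|\partial^s_{(y,g)}h(t,0,0)\|\le K$, and $\partial^s_{(y,g)}h(t,\cdot)$ is Lipschitz with constant $L(R)$ on the ball of radius $R$ around $0$. **Second-order sufficient condition** at $(\bar{\mathbf z},\bar{\mathbf g})$: (i) the Hessian of $\varphi$ at $(\bar{\mathbf x}(t_f),\bar p)$ is positive semidefinite. (ii) There is $\epsilon>0$ such that $\int_I v(t)^T(H_{ab}[t])_{a,b\in\{x,u,p\}}v(t)\,dt\ge\epsilon(\|\delta\mathbf x\|_{L^2}^2+\|\delta\mathbf u\|_{L^2}^2+\|\delta p\|^2)$, $v=(\delta\mathbf x,\delta\mathbf u,\delta p)$, for all $v\in\mathcal Y^2$ with $\delta\mathbf x'=A\delta\mathbf x+B\delta\mathbf u+C\delta p$ a.e. and $\delta\mathbf x(t_0)=0$. (iii) There is $M>0$ such that for a.a. $t$ the matrix $H_{uu}[t]$ is invertible with $\|H_{uu}[t]^{-1}\|\le M$. **Theorem.** Let $\bar{\mathbf z}=(\bar{\mathbf x},\bar{\mathbf u},\bar p,\bar{\boldsymbol\lambda})\in\mathcal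 Z^\infty$ and $\bar{\mathbf g}\in\mathcal G^3$ satisfy $\psi(\bar{\mathbf z};\bar{\mathbf g})=0$, the smoothness assumptions and the second-order sufficient condition. Then there are an open neighborhood $\mathcal N(\bar{\mathbf g})\subset\mathcal G^3$, neighborhoods $\mathcal N(\bar{\mathbf x})\subset W^{1,\infty}(I)^{n_x}$, $\mathcal N(\bar{\mathbf u})\subset L^\infty(I)^{n_u}$, $\mathcal N(\bar p)\subset\mathbb R^{n_p}$, $\mathcal N(\bar{\boldsymbol\lambda})\subset W^{1,\infty}(I)^{n_x}$, and continuously Fréchet differentiable maps $\mathbf x,\mathbf u,p,\boldsymbol\lambda$ from $\mathcal N(\bar{\mathbf g})$ to these neighborhoods, with $(\mathbf x(\bar{\mathbf g}),\mathbf u(\bar{\mathbf g}),p(\bar{\mathbf g}),\boldsymbol\lambda(\bar{\mathbf g}))=\bar{\mathbf z}$, such that for each $\mathbf g\in\mathcal N(\bar{\mathbf g})$ the point $\mathbf z(\mathbf g)=(\mathbf x(\mathbf g),\mathbf u(\mathbf g),p(\mathbf g),\boldsymbol\lambda(\mathbf g))$ is the unique element of $\mathcal N(\bar{\mathbf x})\times\mathcal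 N(\bar{\mathbf u})\times\mathcal N(\bar p)\times\mathcal N(\bar{\boldsymbol\lambda})$ with $\psi(\mathbf z(\mathbf g);\mathbf g)=0$. For every $\delta\mathbf g\in\mathcal G^3$, the derivative $\delta\mathbf z=\mathbf z_{\mathbf g}(\bar{\mathbf g})\delta\mathbf g=(\delta\mathbf x,\delta\mathbf u,\delta p,\delta\boldsymbol\lambda)$ is the unique solution in $\mathcal Z^\infty$ of the sensitivity system (all coefficients at $(\bar{\mathbf z},\bar{\mathbf g})$, equations in $t$ a.e. on $I$) $$\delta\mathbf x'=A\delta\mathbf x+B\delta\mathbf u+C\delta p+f_g[\cdot]\delta\mathbf g[\cdot],\qquad \delta\mathbf x(t_0)=0,$$ $$\delta\boldsymbol\lambda'=-A^T\delta\boldsymbol\lambda-H_{xx}\delta\mathbf x-H_{xu}\delta\mathbf u-H_{xp}\delta p-\mathbf c_x,\qquad \delta\boldsymbol\lambda(t_f)=\nabla^2_{xx}\varphi[t_f]\delta\mathbf x(t_f)+\nabla^2_{xp}\varphi[t_f]\delta p,$$ $$H_{ux}\delta\mathbf x+H_{uu}\delta\mathbf u+H_{up}\delta p+B^T\delta\boldsymbol\lambda=-\mathbf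 c_u,$$ $$\nabla^2_{px}\varphi[t_f]\delta\mathbf x(t_f)+\nabla^2_{pp}\varphi[t_f]\delta p+\int_I\big(H_{px}\delta\mathbf x+H_{pu}\delta\mathbf u+H_{pp}\delta p+C^T\delta\boldsymbol\lambda\big)dt=-\gamma,$$ where $\mathbf c_a=H_{ag}\delta\mathbf g[\cdot]+\delta\mathbf g_a[\cdot]^T\mathbf d$ for $a\in\{x,u,p\}$ and $\gamma=\int_I\mathbf c_p\,dt$. Moreover, for each $q\in\{2,\infty\}$, an element $v=(\delta\mathbf x,\delta\mathbf u,\delta p)\in\mathcal Y^q$ satisfies this system with some $\delta\boldsymbol\lambda\in W^{1,q}(I)^{n_x}$ if and only if it minimizes over $\mathcal Y^q$ $$\int_I(\mathbf c_x^T\delta\mathbf x+\mathbf c_u^T\delta\mathbf u)\,dt+\tfrac12\int_I v^T(H_{ab})v\,dt+\gamma^T\delta p+\tfrac12\begin{pmatrix}\delta\mathbf x(t_f)\\\delta p\end{pmatrix}^T\nabla^2\varphi[t_f]\begin{pmatrix}\delta\mathbf x(t_f)\\\delta p\end{pmatrix}$$ subject to $\delta\mathbf x'=A\delta\mathbf x+B\delta\mathbf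 u+C\delta p+f_g[\cdot]\delta\mathbf g[\cdot]$ a.e. on $I$ and $\delta\mathbf x(t_0)=0$. -/

import Mathlib

open MeasureTheory Set Filter Topology
open scoped ENNReal

noncomputable section

/-- The Euclidean space `ℝⁿ`. -/
abbrev Vec (n : ℕ) : Type := EuclideanSpace ℝ (Fin n)

/-- Lebesgue measure on the time interval `I = (t₀, t_f)`. -/
abbrev timeMeasure (t₀ tf : ℝ) : Measure ℝ := volume.restrict (Ioo t₀ tf)

/-! ### The Sobolev spaces `W^{1,q}(I; ℝⁿ)` -/

/-- `w` is the weak derivative of `x` on `(t₀, t_f)`. -/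
def IsWeakDeriv {n : ℕ} (t₀ tf : ℝ) (x w : ℝ → Vec n) : Prop :=
  ∀ θ : ℝ → ℝ, ContDiff ℝ ((⊤ : ℕ∞) : WithTop ℕ∞) θ → HasCompactSupport θ →
    tsupport θ ⊆ Ioo t₀ tf →
    ∫ t, deriv θ t • x t ∂(timeMeasure t₀ tf) = -∫ t, θ t • w t ∂(timeMeasure t₀ tf)

lemma integrable_test_smul_cont {n : ℕ} {t₀ tf : ℝ} (h : t₀ ≤ tf) {θ : ℝ → ℝ}
    (hθ : Continuous θ) (x : C(Icc t₀ tf, Vec n)) :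
    Integrable (fun t => θ t • IccExtend h x t) (timeMeasure t₀ tf) := by
  have hc : Continuous (fun t => θ t • IccExtend h x t) :=
    hθ.smul x.continuous.Icc_extend'
  exact (hc.continuousOn.integrableOn_Icc (a := t₀) (b := tf)).mono_set Ioo_subset_Icc_self

lemma integrable_test_smul_Lp {n : ℕ} {t₀ tf : ℝ} {q : ℝ≥0∞} (hq : 1 ≤ q) {θ : ℝ → ℝ}
    (hθ : Continuous θ) (hs : HasCompactSupport θ) (w : Lp (Vec n) q (timeMeasure t₀ tf)) :
    Integrable (fun t => θ t • w t) (timeMeasure t₀ tf) := by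
  obtain ⟨C, hC⟩ := hθ.bounded_above_of_compact_support hs
  exact ((Lp.memLp w).integrable hq).bdd_smul C hθ.aestronglyMeasurable
    (Eventually.of_forall hC)

/-- `W^{1,q}((t₀, t_f); ℝⁿ)`. A class in `W^{1,q}` of a bounded interval has exactly one continuous
representative on the closed interval; an element is recorded as the pair formed by that
representative and its weak derivative in `L^q`. The norm is the maximum of the sup norm of the
function and the `L^q` norm of the weak derivative, which is a complete norm equivalent to the
usual one. -/
def W1 {t₀ tf : ℝ} (h : t₀ ≤ tf) (q : ℝ≥0∞) [hq : Fact (1 ≤ q)] (n : ℕ) :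
    Submodule ℝ (C(Icc t₀ tf, Vec n) × Lp (Vec n) q (timeMeasure t₀ tf)) where
  carrier := {v | IsWeakDeriv t₀ tf (IccExtend h v.1) v.2}
  zero_mem' := by
    intro θ _ _ _
    have h1 : (fun t => θ t • ((0 : Lp (Vec n) q (timeMeasure t₀ tf)) : ℝ → Vec n) t)
        =ᵐ[timeMeasure t₀ tf] fun _ => (0 : Vec n) := by
      filter_upwards [Lp.coeFn_zero (Vec n) q (timeMeasure t₀ tf)] with t ht
      rw [ht, Pi.zero_apply, smul_zero]
    simp only [Prod.fst_zero, Prod.snd_zero]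
    rw [integral_congr_ae h1]
    simp [IccExtend]
  add_mem' := by
    intro a b ha hb θ h1 h2 h3
    have hd : Continuous (deriv θ) := h1.continuous_deriv (by simp)
    have e2 : (fun t => θ t • ((a.2 + b.2 : Lp (Vec n) q (timeMeasure t₀ tf)) : ℝ → Vec n) t)
        =ᵐ[timeMeasure t₀ tf] fun t => θ t • a.2 t + θ t • b.2 t := by
      filter_upwards [Lp.coeFn_add a.2 b.2] with t ht
      rw [ht, Pi.add_apply, smul_add]
    have e1 : (fun t => deriv θ t • IccExtend h (a.1 + b.1 : C(Icc t₀ tf, Vec n)) t)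
        = fun t => deriv θ t • IccExtend h a.1 t + deriv θ t • IccExtend h b.1 t := by
      funext t; simp [IccExtend]
    simp only [Prod.fst_add, Prod.snd_add]
    rw [integral_congr_ae e2, e1,
      integral_add (integrable_test_smul_cont h hd a.1) (integrable_test_smul_cont h hd b.1),
      integral_add (integrable_test_smul_Lp hq.out h1.continuous h2 a.2)
        (integrable_test_smul_Lp hq.out h1.continuous h2 b.2), ha θ h1 h2 h3, hb θ h1 h2 h3]
    abel
  smul_mem' := by
    intro c a ha θ h1 h2 h3
    have e2 : (fun t => θ t • ((c • a.2 : Lp (Vec n) q (timeMeasure t₀ tf)) : ℝ → Vec n) t)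
        =ᵐ[timeMeasure t₀ tf] fun t => c • (θ t • a.2 t) := by
      filter_upwards [Lp.coeFn_smul c a.2] with t ht
      simp [ht, smul_comm c (θ t)]
    have e1 : (fun t => deriv θ t • IccExtend h (c • a.1 : C(Icc t₀ tf, Vec n)) t)
        = fun t => c • (deriv θ t • IccExtend h a.1 t) := by
      funext t; simp [IccExtend, smul_comm c (deriv θ t)]
    simp only [Prod.smul_fst, Prod.smul_snd]
    rw [integral_congr_ae e2, e1, integral_smul, integral_smul, ha θ h1 h2 h3, smul_neg]

/-- Pointwise values of a Sobolev function (extended constantly outside `[t₀, t_f]`). -/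
def sobVal {t₀ tf : ℝ} {h : t₀ ≤ tf} {q : ℝ≥0∞} [Fact (1 ≤ q)] {n : ℕ} (x : W1 h q n) :
    ℝ → Vec n :=
  IccExtend h x.1.1

/-- The weak derivative of a Sobolev function. -/
def sobDer {t₀ tf : ℝ} {h : t₀ ≤ tf} {q : ℝ≥0∞} [Fact (1 ≤ q)] {n : ℕ} (x : W1 h q n) :
    ℝ → Vec n :=
  x.1.2

/-! ### The space `𝒢ˢ(I)` of model functions -/

section ModelFunctions

variable {E F : Type*} [NormedAddCommGroup E] [NormedSpace ℝ E]
  [NormedAddCommGroup F] [NormedSpace ℝ F]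

/-- `∑_{k ≤ s} ess sup_t sup_y ‖∂^k g(t, y) / ∂y^k‖`, possibly infinite. -/
def modelENorm (μ : Measure ℝ) (s : ℕ) (g : ℝ → E → F) : ℝ≥0∞ :=
  ∑ k ∈ Finset.range (s + 1), essSup (fun t => ⨆ y, ‖iteratedFDeriv ℝ k (g t) y‖ₑ) μ

lemma modelENorm_add_le {μ : Measure ℝ} {s : ℕ} {g h : ℝ → E → F}
    (hg : ∀ᵐ t ∂μ, ContDiff ℝ s (g t)) (hh : ∀ᵐ t ∂μ, ContDiff ℝ s (h t)) :
    modelENorm μ s (g + h) ≤ modelENorm μ s g + modelENorm μ s h := by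
  unfold modelENorm
  rw [← Finset.sum_add_distrib]
  refine Finset.sum_le_sum fun k hk => ?_
  have hks : ((k : ℕ) : WithTop ℕ∞) ≤ (s : WithTop ℕ∞) := by
    exact_mod_cast Nat.lt_succ_iff.mp (Finset.mem_range.mp hk)
  refine le_trans (essSup_mono_ae ?_) (ENNReal.essSup_add_le _ _)
  filter_upwards [hg, hh] with t h1 h2
  refine iSup_le fun y => ?_
  have : iteratedFDeriv ℝ k ((g + h) t) y
      = iteratedFDeriv ℝ k (g t) y + iteratedFDeriv ℝ k (h t) y :=
    iteratedFDeriv_add_apply (h1.of_le hks).contDiffAt (h2.of_le hks).contDiffAt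
  rw [this]
  have h3 := le_iSup (fun y => ‖iteratedFDeriv ℝ k (g t) y‖ₑ) y
  have h4 := le_iSup (fun y => ‖iteratedFDeriv ℝ k (h t) y‖ₑ) y
  have h5 := enorm_add_le (iteratedFDeriv ℝ k (g t) y) (iteratedFDeriv ℝ k (h t) y)
  exact h5.trans (add_le_add h3 h4)

lemma modelENorm_smul {μ : Measure ℝ} {s : ℕ} {g : ℝ → E → F} (c : ℝ)
    (hg : ∀ᵐ t ∂μ, ContDiff ℝ s (g t)) :
    modelENorm μ s (c • g) = ‖c‖ₑ * modelENorm μ s g := by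
  unfold modelENorm
  rw [Finset.mul_sum]
  refine Finset.sum_congr rfl fun k hk => ?_
  have hks : ((k : ℕ) : WithTop ℕ∞) ≤ (s : WithTop ℕ∞) := by
    exact_mod_cast Nat.lt_succ_iff.mp (Finset.mem_range.mp hk)
  rw [← ENNReal.essSup_const_mul]
  refine essSup_congr_ae ?_
  filter_upwards [hg] with t h1
  rw [ENNReal.mul_iSup]
  refine iSup_congr fun y => ?_
  have : iteratedFDeriv ℝ k ((c • g) t) y = c • iteratedFDeriv ℝ k (g t) y :=
    iteratedFDeriv_const_smul_apply (h1.of_le hks).contDiffAt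
  rw [this, enorm_smul]

lemma modelENorm_zero (μ : Measure ℝ) (s : ℕ) : modelENorm μ s (0 : ℝ → E → F) = 0 := by
  have h := modelENorm_smul (μ := μ) (s := s) (g := (0 : ℝ → E → F)) 0
    (Eventually.of_forall fun t => contDiff_const)
  simpa using h

variable (E F) in
/-- Functions `g : I × E → F` that are `s` times continuously differentiable in `y` for a.a. `t`,
measurable in `t` for each `y`, and of finite norm. Only the values for `t ∈ I` matter. -/
def modelSubmodule (μ : Measure ℝ) (s : ℕ) : Submodule ℝ (ℝ → E → F) where
  carrier := {g | (∀ᵐ t ∂μ, ContDiff ℝ s (g t)) ∧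
    (∀ y, AEStronglyMeasurable (fun t => g t y) μ) ∧ modelENorm μ s g < ⊤}
  zero_mem' := ⟨Eventually.of_forall fun _ => contDiff_const,
    fun _ => aestronglyMeasurable_const, by rw [modelENorm_zero]; exact ENNReal.zero_lt_top⟩
  add_mem' := by
    rintro a b ⟨a1, a2, a3⟩ ⟨b1, b2, b3⟩
    refine ⟨?_, fun y => (a2 y).add (b2 y),
      (modelENorm_add_le a1 b1).trans_lt (ENNReal.add_lt_top.2 ⟨a3, b3⟩)⟩
    filter_upwards [a1, b1] with t h1 h2 using h1.add h2
  smul_mem' := by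
    rintro c a ⟨a1, a2, a3⟩
    refine ⟨?_, fun y => (a2 y).const_smul c, ?_⟩
    · filter_upwards [a1] with t h1 using h1.const_smul c
    · rw [modelENorm_smul c a1]
      exact ENNReal.mul_lt_top enorm_lt_top a3

variable (E F) in
/-- The functions in `modelSubmodule`, as a type carrying the seminorm of `𝒢ˢ`. -/
def ModelFun (μ : Measure ℝ) (s : ℕ) : Type _ := modelSubmodule E F μ s

instance (μ : Measure ℝ) (s : ℕ) : AddCommGroup (ModelFun E F μ s) :=
  inferInstanceAs (AddCommGroup (modelSubmodule E F μ s))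

instance (μ : Measure ℝ) (s : ℕ) : Module ℝ (ModelFun E F μ s) :=
  inferInstanceAs (Module ℝ (modelSubmodule E F μ s))

instance (μ : Measure ℝ) (s : ℕ) : Norm (ModelFun E F μ s) :=
  ⟨fun g => (modelENorm μ s g.1).toReal⟩

lemma modelFun_core (μ : Measure ℝ) (s : ℕ) : SeminormedSpace.Core ℝ (ModelFun E F μ s) where
  norm_nonneg _ := ENNReal.toReal_nonneg
  norm_smul c g := by
    change (modelENorm μ s (c • g.1)).toReal = ‖c‖ * (modelENorm μ s g.1).toReal
    rw [modelENorm_smul c g.2.1, ENNReal.toReal_mul, toReal_enorm]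
  norm_triangle g h := by
    change (modelENorm μ s (g.1 + h.1)).toReal
      ≤ (modelENorm μ s g.1).toReal + (modelENorm μ s h.1).toReal
    rw [← ENNReal.toReal_add g.2.2.2.ne h.2.2.2.ne]
    exact ENNReal.toReal_mono (ENNReal.add_ne_top.2 ⟨g.2.2.2.ne, h.2.2.2.ne⟩)
      (modelENorm_add_le g.2.1 h.2.1)

instance (μ : Measure ℝ) (s : ℕ) : SeminormedAddCommGroup (ModelFun E F μ s) :=
  SeminormedAddCommGroup.ofCore (modelFun_core μ s)

instance (μ : Measure ℝ) (s : ℕ) : NormedSpace ℝ (ModelFun E F μ s) :=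
  ⟨fun c g => ((modelFun_core μ s).norm_smul c g).le⟩

variable (E F) in
/-- The normed space `𝒢ˢ(I)`: functions that agree for a.a. `t` (and all `y`) are identified. -/
abbrev ModelSpace (μ : Measure ℝ) (s : ℕ) : Type _ := SeparationQuotient (ModelFun E F μ s)

/-- A representative `g(t, y)` of an element of `𝒢ˢ(I)`. -/
def ModelSpace.rep {μ : Measure ℝ} {s : ℕ} (g : ModelSpace E F μ s) : ℝ → E → F :=
  (Function.surjInv SeparationQuotient.surjective_mk g : ModelFun E F μ s).1

end ModelFunctions

/-! ### Partial derivatives along a factor of a product space -/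

section Partial

variable {A B W E : Type*}
  [NormedAddCommGroup A] [InnerProductSpace ℝ A] [CompleteSpace A]
  [NormedAddCommGroup B] [InnerProductSpace ℝ B]
  [NormedAddCommGroup W] [NormedSpace ℝ W] [NormedAddCommGroup E] [NormedSpace ℝ E]

/-- The partial Jacobian `h_a(w)`, where `ι : A → W` is the inclusion of the factor `A`. -/
def pJac (ι : A →L[ℝ] W) (h : W → E) (w : W) : A →L[ℝ] E := (fderiv ℝ h w).comp ι

/-- The partial gradient `∇_a h(w)`. -/
def pGrad (ι : A →L[ℝ] W) (h : W → ℝ) (w : W) : A :=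
  (InnerProductSpace.toDual ℝ A).symm (pJac ι h w)

/-- The Hessian block `∇²_{ab} h(w)`, with `∇²_{ab} h(w) v` the derivative of `∇_a h` in the
direction `v` of the factor `B`. -/
def pHess (ι : A →L[ℝ] W) (κ : B →L[ℝ] W) (h : W → ℝ) (w : W) : B →L[ℝ] A :=
  (fderiv ℝ (pGrad ι h) w).comp κ

end Partial

/-! ### The optimal control problem -/

/-- The values `y = (x, u, p)`. -/
abbrev YVal (nx nu np : ℕ) : Type := Vec nx × Vec nu × Vec np

/-- The data of the Bolza problem other than the model function `g`:
minimize `φ(x(t_f), p) + ∫ l(t, y(t), g(t, y(t))) dt` subject to `x' = f(t, y, g(t, y))` and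
`x(t₀) = x₀`. -/
structure OCP (nx nu np ng : ℕ) where
  t₀ : ℝ
  tf : ℝ
  lt : t₀ < tf
  x₀ : Vec nx
  φ : Vec nx × Vec np → ℝ
  l : ℝ → YVal nx nu np × Vec ng → ℝ
  f : ℝ → YVal nx nu np × Vec ng → Vec nx

namespace OCP

variable {nx nu np ng : ℕ}

/-- Inclusion of the state factor into the space of `y = (x, u, p)`. -/
abbrev ιx : Vec nx →L[ℝ] YVal nx nu np := ContinuousLinearMap.inl ℝ _ _

/-- Inclusion of the control factor. -/
abbrev ιu : Vec nu →L[ℝ] YVal nx nu np :=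
  (ContinuousLinearMap.inr ℝ _ _).comp (ContinuousLinearMap.inl ℝ _ _)

/-- Inclusion of the parameter factor. -/
abbrev ιp : Vec np →L[ℝ] YVal nx nu np :=
  (ContinuousLinearMap.inr ℝ _ _).comp (ContinuousLinearMap.inr ℝ _ _)

/-- Inclusion of the factor `y` into the space of pairs `(y, g)`. -/
abbrev ιy : YVal nx nu np →L[ℝ] YVal nx nu np × Vec ng := ContinuousLinearMap.inl ℝ _ _

/-- Inclusion of the factor `g`. -/
abbrev ιg : Vec ng →L[ℝ] YVal nx nu np × Vec ng := ContinuousLinearMap.inr ℝ _ _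

/-- Lebesgue measure on `I = (t₀, t_f)`. -/
abbrev μ (P : OCP nx nu np ng) : Measure ℝ := timeMeasure P.t₀ P.tf

/-- The space `𝒢³(I)` of model functions. -/
abbrev G3 (P : OCP nx nu np ng) : Type := ModelSpace (YVal nx nu np) (Vec ng) P.μ 3

/-- `W^{1,q}(I; ℝ^{n_x})`. -/
abbrev XSpace (P : OCP nx nu np ng) (q : ℝ≥0∞) [Fact (1 ≤ q)] : Type := W1 P.lt.le q nx

/-- `L^q(I; ℝ^{n_u})`. -/
abbrev USpace (P : OCP nx nu np ng) (q : ℝ≥0∞) : Type := Lp (Vec nu) q P.μ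

/-- `𝒴^q = W^{1,q} × L^q × ℝ^{n_p}`, the space of `(x, u, p)`. -/
abbrev YSpace (P : OCP nx nu np ng) (q : ℝ≥0∞) [Fact (1 ≤ q)] : Type :=
  P.XSpace q × P.USpace q × Vec np

/-- `𝒵^q = W^{1,q} × L^q × ℝ^{n_p} × W^{1,q}`, the space of `(x, u, p, λ)`. -/
abbrev ZSpace (P : OCP nx nu np ng) (q : ℝ≥0∞) [Fact (1 ≤ q)] : Type :=
  P.XSpace q × P.USpace q × Vec np × P.XSpace q

/-- Smoothness of `h(t, y, g)` required of the dynamics and of the running cost: measurable in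
`t`, twice continuously differentiable in `(y, g)` for a.a. `t`, with derivatives of order up to 2
that are essentially bounded in `t` at the origin and locally Lipschitz uniformly in a.a. `t`. -/
structure Smooth {W E : Type*} [NormedAddCommGroup W] [NormedSpace ℝ W]
    [NormedAddCommGroup E] [NormedSpace ℝ E] (μ : Measure ℝ) (h : ℝ → W → E) : Prop where
  measurable : ∀ w, AEStronglyMeasurable (fun t => h t w) μ
  contDiff : ∀ᵐ t ∂μ, ContDiff ℝ 2 (h t)
  bounded : ∃ K : ℝ, ∀ s ≤ 2, ∀ᵐ t ∂μ, ‖iteratedFDeriv ℝ s (h t) 0‖ ≤ K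
  lipschitz : ∀ R > 0, ∃ L : ℝ, ∀ s ≤ 2, ∀ᵐ t ∂μ,
    ∀ w₁ ∈ Metric.closedBall (0 : W) R, ∀ w₂ ∈ Metric.closedBall (0 : W) R,
      ‖iteratedFDeriv ℝ s (h t) w₁ - iteratedFDeriv ℝ s (h t) w₂‖ ≤ L * ‖w₁ - w₂‖

section Trajectory

variable (P : OCP nx nu np ng) (z : P.ZSpace ⊤) (g : P.G3)

/-- `y(t) = (x(t), u(t), p)`. -/
def y (t : ℝ) : YVal nx nu np := (sobVal z.1 t, z.2.1 t, z.2.2.1)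

/-- `λ(t)`. -/
def lam (t : ℝ) : Vec nx := sobVal z.2.2.2 t

/-- `(y(t), g(t, y(t)))`. -/
def w (t : ℝ) : YVal nx nu np × Vec ng := (P.y z t, g.rep t (P.y z t))

/-- `(x(t_f), p)`. -/
def endPt : Vec nx × Vec np := (sobVal z.1 P.tf, z.2.2.1)

section Block

variable {m : ℕ} (ι : Vec m →L[ℝ] YVal nx nu np)

/-- `g_a[t]`, the partial Jacobian of a model function along the trajectory. -/
def gJac (g' : P.G3) (t : ℝ) : Vec m →L[ℝ] Vec ng := pJac ι (g'.rep t) (P.y z t)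

/-- `f_a[t] + f_g[t] g_a[t]`; this is `A`, `B`, `C` for `a = x, u, p`. -/
def dynJac (t : ℝ) : Vec m →L[ℝ] Vec nx :=
  pJac (ιy.comp ι) (P.f t) (P.w z g t)
    + (pJac ιg (P.f t) (P.w z g t)).comp (P.gJac z ι g t)

/-- `∇_a l[t] + g_a[t]ᵀ ∇_g l[t]`. -/
def costGrad (t : ℝ) : Vec m :=
  pGrad (ιy.comp ι) (P.l t) (P.w z g t)
    + (P.gJac z ι g t).adjoint (pGrad ιg (P.l t) (P.w z g t))

/-- `(f_a[t] + f_g[t] g_a[t])ᵀ λ(t) + ∇_a l[t] + g_a[t]ᵀ ∇_g l[t]`. -/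
def hamGrad (t : ℝ) : Vec m :=
  (P.dynJac z g ι t).adjoint (P.lam z t) + P.costGrad z g ι t

end Block

/-- The first-order optimality operator `ψ(x, u, p, λ; g)`; its first, third and fifth components
are functions of `t`. -/
def ψ : (ℝ → Vec nx) × Vec nx × (ℝ → Vec nx) × Vec nx × (ℝ → Vec nu) × Vec np :=
  (fun t => P.f t (P.w z g t) - sobDer z.1 t,
   P.x₀ - sobVal z.1 P.t₀,
   fun t => sobDer z.2.2.2 t + P.hamGrad z g ιx t,
   pGrad (ContinuousLinearMap.inl ℝ _ _) P.φ (P.endPt z) - P.lam z P.tf,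
   fun t => P.hamGrad z g ιu t,
   pGrad (ContinuousLinearMap.inr ℝ _ _) P.φ (P.endPt z) + ∫ t, P.hamGrad z g ιp t ∂P.μ)

/-- `ψ(x, u, p, λ; g) = 0` in
`𝒱^∞ = L^∞ × ℝ^{n_x} × L^∞ × ℝ^{n_x} × L^∞ × ℝ^{n_p}`: functions of `t` vanish
almost everywhere on `I`. -/
def SolvesKKT : Prop :=
  (P.ψ z g).1 =ᵐ[P.μ] 0 ∧ (P.ψ z g).2.1 = 0 ∧ (P.ψ z g).2.2.1 =ᵐ[P.μ] 0 ∧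
    (P.ψ z g).2.2.2.1 = 0 ∧ (P.ψ z g).2.2.2.2.1 =ᵐ[P.μ] 0 ∧ (P.ψ z g).2.2.2.2.2 = 0

/-- The Hamiltonian `l(t, y, g) + λ(t)ᵀ f(t, y, g)`, as a function of `(y, g)`. -/
def ham (t : ℝ) (v : YVal nx nu np × Vec ng) : ℝ := P.l t v + inner ℝ (P.lam z t) (P.f t v)

/-- `d[t] = ∇_g l[t] + f_g[t]ᵀ λ(t)`. -/
def d (t : ℝ) : Vec ng :=
  pGrad ιg (P.l t) (P.w z g t) + (pJac ιg (P.f t) (P.w z g t)).adjoint (P.lam z t)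

/-- `H_{ab}[t]`, the Hessian block in `a, b ∈ {x, u, p}` of
`y ↦ l(t, y, g(t, y)) + λ(t)ᵀ f(t, y, g(t, y))`, that is
`∇²_{ab} H + ∇²_{ag} H g_b + (∇²_{bg} H g_a)ᵀ + g_aᵀ ∇²_{gg} H g_b + ∑_k d_k ∇²_{ab} g_k`. -/
def H {m k : ℕ} (ι : Vec m →L[ℝ] YVal nx nu np) (κ : Vec k →L[ℝ] YVal nx nu np) (t : ℝ) :
    Vec k →L[ℝ] Vec m :=
  pHess (ιy.comp ι) (ιy.comp κ) (P.ham z t) (P.w z g t)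
    + (pHess (ιy.comp ι) ιg (P.ham z t) (P.w z g t)).comp (P.gJac z κ g t)
    + ((pHess (ιy.comp κ) ιg (P.ham z t) (P.w z g t)).comp (P.gJac z ι g t)).adjoint
    + (P.gJac z ι g t).adjoint.comp
        ((pHess ιg ιg (P.ham z t) (P.w z g t)).comp (P.gJac z κ g t))
    + pHess ι κ (fun v => inner ℝ (P.d z g t) (g.rep t v)) (P.y z t)

/-- `H_{ag}[t] = ∇²_{ag} H + g_aᵀ ∇²_{gg} H`. -/
def Hg {m : ℕ} (ι : Vec m →L[ℝ] YVal nx nu np) (t : ℝ) : Vec ng →L[ℝ] Vec m :=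
  pHess (ιy.comp ι) ιg (P.ham z t) (P.w z g t)
    + (P.gJac z ι g t).adjoint.comp (pHess ιg ιg (P.ham z t) (P.w z g t))

/-- `H_{a·}[t] (δx, δu, δp)`, a block row of the Hessian of the Hamiltonian. -/
def HRow {m : ℕ} (ι : Vec m →L[ℝ] YVal nx nu np) (t : ℝ) (v : YVal nx nu np) : Vec m :=
  P.H z g ι ιx t v.1 + P.H z g ι ιu t v.2.1 + P.H z g ι ιp t v.2.2

/-- The quadratic form of the Hessian of the Hamiltonian in `(δx, δu, δp)`. -/
def HQuad (t : ℝ) (v : YVal nx nu np) : ℝ :=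
  inner ℝ v.1 (P.HRow z g ιx t v) + inner ℝ v.2.1 (P.HRow z g ιu t v)
    + inner ℝ v.2.2 (P.HRow z g ιp t v)

/-- `∇²_{xx} φ δx + ∇²_{xp} φ δp` at `(x(t_f), p)`. -/
def φRowX (v : Vec nx × Vec np) : Vec nx :=
  pHess (ContinuousLinearMap.inl ℝ _ _) (ContinuousLinearMap.inl ℝ _ _) P.φ (P.endPt z) v.1
    + pHess (ContinuousLinearMap.inl ℝ _ _) (ContinuousLinearMap.inr ℝ _ _) P.φ (P.endPt z) v.2

/-- `∇²_{px} φ δx + ∇²_{pp} φ δp` at `(x(t_f), p)`. -/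
def φRowP (v : Vec nx × Vec np) : Vec np :=
  pHess (ContinuousLinearMap.inr ℝ _ _) (ContinuousLinearMap.inl ℝ _ _) P.φ (P.endPt z) v.1
    + pHess (ContinuousLinearMap.inr ℝ _ _) (ContinuousLinearMap.inr ℝ _ _) P.φ (P.endPt z) v.2

/-- The quadratic form of the Hessian of `φ` at `(x(t_f), p)`. -/
def φQuad (v : Vec nx × Vec np) : ℝ := inner ℝ v.1 (P.φRowX z v) + inner ℝ v.2 (P.φRowP z v)

section Exponent

variable {q : ℝ≥0∞} [Fact (1 ≤ q)]

/-- `δx' = A δx + B δu + C δp + r` a.e. on `I` and `δx(t₀) = r₀`. -/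
def LinDynamics (r : ℝ → Vec nx) (r₀ : Vec nx) (v : P.YSpace q) : Prop :=
  (∀ᵐ t ∂P.μ, sobDer v.1 t = P.dynJac z g ιx t (sobVal v.1 t) + P.dynJac z g ιu t (v.2.1 t)
      + P.dynJac z g ιp t v.2.2 + r t) ∧
    sobVal v.1 P.t₀ = r₀

/-- Cost of the linear-quadratic problem with data `c_x, c_u, σ_f, γ`. -/
def lqCost (cx : ℝ → Vec nx) (cu : ℝ → Vec nu) (σf : Vec nx) (γ : Vec np) (v : P.YSpace q) : ℝ :=
  (∫ t, inner ℝ (cx t) (sobVal v.1 t) + inner ℝ (cu t) (v.2.1 t) ∂P.μ)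
    + (1 / 2) * (∫ t, P.HQuad z g t (sobVal v.1 t, v.2.1 t, v.2.2) ∂P.μ)
    + (inner ℝ σf (sobVal v.1 P.tf) + inner ℝ γ v.2.2)
    + (1 / 2) * P.φQuad z (sobVal v.1 P.tf, v.2.2)

/-- `v = (δx, δu, δp)` solves the linear-quadratic optimal control problem with data
`r, r₀, c_x, c_u, σ_f, γ` in `𝒴^q`: it is feasible and of least cost among feasible points. -/
def SolvesLQ (r : ℝ → Vec nx) (r₀ : Vec nx) (cx : ℝ → Vec nx) (cu : ℝ → Vec nu)
    (σf : Vec nx) (γ : Vec np) (v : P.YSpace q) : Prop :=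
  P.LinDynamics z g r r₀ v ∧
    ∀ v' : P.YSpace q, P.LinDynamics z g r r₀ v' →
      P.lqCost z g cx cu σf γ v ≤ P.lqCost z g cx cu σf γ v'

end Exponent

/-- The second-order sufficient condition at `(z, g)`, with uniformly invertible `H_uu`. -/
structure SSOC : Prop where
  endpoint : ∀ v : Vec nx × Vec np, 0 ≤ P.φQuad z v
  coercive : ∃ ε > 0, ∀ v : P.YSpace 2, P.LinDynamics z g 0 0 v →
    ε * ((∫ t, ‖sobVal v.1 t‖ ^ 2 ∂P.μ) + (∫ t, ‖v.2.1 t‖ ^ 2 ∂P.μ) + ‖v.2.2‖ ^ 2)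
      ≤ ∫ t, P.HQuad z g t (sobVal v.1 t, v.2.1 t, v.2.2) ∂P.μ
  invertible : ∃ M > 0, ∀ᵐ t ∂P.μ, ∃ J : Vec nu →L[ℝ] Vec nu,
    J.comp (P.H z g ιu ιu t) = ContinuousLinearMap.id ℝ _ ∧ (P.H z g ιu ιu t).comp J = ContinuousLinearMap.id ℝ _ ∧ ‖J‖ ≤ M

variable (δg : P.G3)

/-- `δg[t] = δg(t, y(t))`. -/
def δgAt (t : ℝ) : Vec ng := δg.rep t (P.y z t)

/-- `f_g[t] δg[t]`. -/
def sensR (t : ℝ) : Vec nx := pJac ιg (P.f t) (P.w z g t) (P.δgAt z δg t)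

/-- `H_{ag}[t] δg[t] + δg_a[t]ᵀ d[t]`. -/
def sensC {m : ℕ} (ι : Vec m →L[ℝ] YVal nx nu np) (t : ℝ) : Vec m :=
  P.Hg z g ι t (P.δgAt z δg t) + (P.gJac z ι δg t).adjoint (P.d z g t)

/-- The linear sensitivity system for `δz = (δx, δu, δp, δλ)`. -/
structure SolvesSens {q : ℝ≥0∞} [Fact (1 ≤ q)] (δz : P.ZSpace q) : Prop where
  state : ∀ᵐ t ∂P.μ, sobDer δz.1 t = P.dynJac z g ιx t (sobVal δz.1 t)
    + P.dynJac z g ιu t (δz.2.1 t) + P.dynJac z g ιp t δz.2.2.1 + P.sensR z g δg t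
  initial : sobVal δz.1 P.t₀ = 0
  costate : ∀ᵐ t ∂P.μ, sobDer δz.2.2.2 t = -(P.dynJac z g ιx t).adjoint (sobVal δz.2.2.2 t)
    - P.H z g ιx ιx t (sobVal δz.1 t) - P.H z g ιx ιu t (δz.2.1 t) - P.H z g ιx ιp t δz.2.2.1
    - P.sensC z g δg ιx t
  terminal : sobVal δz.2.2.2 P.tf = P.φRowX z (sobVal δz.1 P.tf, δz.2.2.1)
  control : ∀ᵐ t ∂P.μ, P.H z g ιu ιx t (sobVal δz.1 t) + P.H z g ιu ιu t (δz.2.1 t)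
    + P.H z g ιu ιp t δz.2.2.1 + (P.dynJac z g ιu t).adjoint (sobVal δz.2.2.2 t)
    = -P.sensC z g δg ιu t
  parameter : P.φRowP z (sobVal δz.1 P.tf, δz.2.2.1)
    + (∫ t, P.H z g ιp ιx t (sobVal δz.1 t) + P.H z g ιp ιu t (δz.2.1 t)
        + P.H z g ιp ιp t δz.2.2.1 + (P.dynJac z g ιp t).adjoint (sobVal δz.2.2.2 t) ∂P.μ)
    = -∫ t, P.sensC z g δg ιp t ∂P.μ

end Trajectory

end OCP

end

/-!
Write `ψ(z; g) = 0` for the optimality system. Its residual is a map from `𝒵^∞ × 𝒢³` to the Banach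
space `VSpace`, and the theorem is the implicit function theorem for this map, followed by an
identification of the linearized system with the sensitivity system and with the optimality
conditions of a linear-quadratic problem.

*Differentiability.* The residual is built from superposition operators `w ↦ h(·, w(·))` in `L^∞`
and from the evaluation `(w, g) ↦ g(·, w(·))` of a model function along a trajectory. In all cases
the candidate derivative satisfies a quadratic remainder estimate that is uniform on bounded sets,
and this alone makes a map continuously differentiable (`contDiff_one_of_quadratic`). The first
derivatives of `g` along the trajectory occur in the residual; `𝒢³` controls three derivatives so
that `g_y(·, w(·))` still depends continuously differentiably on `(w, g)`
(`ModelSpace.isRealization_fderiv_rep`). The derivative of the residual is computed pointwise in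
`t`: all Hessian blocks `H_{ab}` are blocks of the bilinear form `OCP.hessForm`, and comparing both
sides on test vectors gives the sensitivity system (`OCP.isLinearization_fderiv_residual`).

*Bijectivity of the linearization.* If the linearization in `z` vanishes at `δz`, then integration
by parts against `δλ` shows that the second variation along `I` and the Hessian form of `φ` at
`(δx(t_f), δp)` add up to zero. The latter is nonnegative, so coercivity of the former gives
`δx = 0`, `δu = 0`, `δp = 0`, and backward uniqueness gives `δλ = 0` (`OCP.SolvesSens.eq_zero`).
For surjectivity, `H_{uu}` is inverted pointwise, which turns the
equations on `I` into a linear differential equation for `(δx, δλ)` with essentially bounded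
coefficients; it can be solved in `W^{1,∞}` for arbitrary `δλ(t₀)` and `δp`
(`OCP.exists_initialValue`). The remaining conditions, at `t_f` and for the parameter, are as many
scalar equations as `(δλ(t₀), δp)` has components, so that injectivity implies surjectivity by
counting dimensions (`exists_of_injective_of_initialValue`).

*Implicit function.* `exists_implicit_function` solves the equation by contraction in `z` only and
does not need completeness of `𝒢³`.

*The linear-quadratic problem.* At a solution of the sensitivity system the first variation of the
cost vanishes in all admissible directions (`OCP.SolvesSens.stationary`), and the second variation
is coercive. So the solution is the unique minimizer in `𝒴²`
(`OCP.SolvesSens.solvesLQ`, `OCP.SolvesSens.eq_of_lqCost_le`). Since the sensitivity system has a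
solution in `𝒵^∞`, namely the derivative of the implicit function, the minimizers in `𝒴²` and in
`𝒴^∞` are both equal to it.
-/

noncomputable section

set_option linter.unusedSectionVars false

/-! ### Sobolev functions of one variable -/

/-- Integration by parts for primitives of integrable functions. -/
lemma integral_mul_add_mul_of_primitive {a b : ℝ} (hab : a ≤ b) {f g φ ψ : ℝ → ℝ}
    (hφ : IntervalIntegrable φ volume a b) (hψ : IntervalIntegrable ψ volume a b)
    (hf : ∀ t ∈ Icc a b, f t = f a + ∫ s in a..t, φ s)
    (hg : ∀ t ∈ Icc a b, g t = g a + ∫ s in a..t, ψ s) :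
    ∫ t in a..b, (φ t * g t + f t * ψ t) = f b * g b - f a * g a := by
  have hu : uIcc a b = Icc a b := uIcc_of_le hab
  have hc : ∀ c : ℝ, AbsolutelyContinuousOnInterval (fun _ : ℝ => c) a b := fun c =>
    (LipschitzWith.const c).lipschitzOnWith.absolutelyContinuousOnInterval
  have ac : ∀ (c : ℝ) (χ : ℝ → ℝ), IntervalIntegrable χ volume a b →
      AbsolutelyContinuousOnInterval (fun t => c + ∫ s in a..t, χ s) a b := fun c χ h =>
    (hc c).add (h.absolutelyContinuousOnInterval_intervalIntegral (by simp))
  have key := (ac (f a) φ hφ).integral_deriv_mul_eq_sub (ac (g a) ψ hψ)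
  have hd : ∀ (c : ℝ) (χ : ℝ → ℝ), IntervalIntegrable χ volume a b →
      ∀ᵐ t, t ∈ uIcc a b → deriv (fun t => c + ∫ s in a..t, χ s) t = χ t := by
    intro c χ h
    filter_upwards [h.ae_hasDerivAt_integral] with t ht hm
    exact ((ht hm a (by simp)).const_add c).deriv
  rw [← hf b ⟨hab, le_rfl⟩, ← hg b ⟨hab, le_rfl⟩] at key
  simp only [intervalIntegral.integral_same, add_zero] at key
  rw [← key]
  apply intervalIntegral.integral_congr_ae
  filter_upwards [hd (f a) φ hφ, hd (g a) ψ hψ] with t h1 h2 h3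
  have h4 : t ∈ uIcc a b := uIoc_subset_uIcc h3
  have h5 : t ∈ Icc a b := hu ▸ h4
  rw [h1 h4, h2 h4, ← hf t h5, ← hg t h5]

section W1

variable {n : ℕ} {t₀ tf : ℝ}

lemma integral_timeMeasure {E : Type*} [NormedAddCommGroup E] [NormedSpace ℝ E] (h : t₀ ≤ tf)
    (f : ℝ → E) : ∫ t, f t ∂(timeMeasure t₀ tf) = ∫ t in t₀..tf, f t := by
  rw [intervalIntegral.integral_of_le h, integral_Ioc_eq_integral_Ioo]

lemma intervalIntegrable_of_timeMeasure {E : Type*} [NormedAddCommGroup E] (h : t₀ ≤ tf)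
    {f : ℝ → E} (hf : Integrable f (timeMeasure t₀ tf)) : IntervalIntegrable f volume t₀ tf :=
  (intervalIntegrable_iff_integrableOn_Ioo_of_le h).2 hf

lemma IntervalIntegrable.mono_right {E : Type*} [NormedAddCommGroup E] {f : ℝ → E}
    (hf : IntervalIntegrable f volume t₀ tf) {t : ℝ} (ht : t ∈ Icc t₀ tf) :
    IntervalIntegrable f volume t₀ t :=
  hf.mono_set (by
    rw [uIcc_of_le ht.1, uIcc_of_le (ht.1.trans ht.2)]; exact Icc_subset_Icc le_rfl ht.2)

lemma intervalIntegral_apply {f : ℝ → Vec n} {a b : ℝ} (hf : IntervalIntegrable f volume a b)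
    (i : Fin n) : (∫ t in a..b, f t) i = ∫ t in a..b, f t i :=
  ((EuclideanSpace.proj (𝕜 := ℝ) i).intervalIntegral_comp_comm hf).symm

lemma IntervalIntegrable.vec_apply {f : ℝ → Vec n} {a b : ℝ}
    (hf : IntervalIntegrable f volume a b) (i : Fin n) :
    IntervalIntegrable (fun t => f t i) volume a b :=
  ⟨(EuclideanSpace.proj (𝕜 := ℝ) i).integrable_comp hf.1,
    (EuclideanSpace.proj (𝕜 := ℝ) i).integrable_comp hf.2⟩

lemma primitive_apply {f φ : ℝ → Vec n} (hφ : IntervalIntegrable φ volume t₀ tf)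
    (hf : ∀ t ∈ Icc t₀ tf, f t = f t₀ + ∫ s in t₀..t, φ s) (i : Fin n) :
    ∀ t ∈ Icc t₀ tf, f t i = f t₀ i + ∫ s in t₀..t, φ s i := by
  intro t ht
  rw [hf t ht, PiLp.add_apply, intervalIntegral_apply (hφ.mono_right ht)]

/-- A primitive of an integrable function has that function as its weak derivative. -/
lemma isWeakDeriv_of_primitive (h : t₀ ≤ tf) {x w : ℝ → Vec n}
    (hw : Integrable w (timeMeasure t₀ tf)) (hxc : ContinuousOn x (Icc t₀ tf))
    (hx : ∀ t ∈ Icc t₀ tf, x t = x t₀ + ∫ s in t₀..t, w s) : IsWeakDeriv t₀ tf x w := by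
  intro θ h1 h2 h3
  have hwi := intervalIntegrable_of_timeMeasure h hw
  have hd : Continuous (deriv θ) := h1.continuous_deriv (by simp)
  have hdi : IntervalIntegrable (deriv θ) volume t₀ tf := hd.intervalIntegrable _ _
  have z : ∀ t, t ∉ Ioo t₀ tf → θ t = 0 := fun t ht =>
    image_eq_zero_of_notMem_tsupport fun hh => ht (h3 hh)
  have hθ : ∀ t ∈ Icc t₀ tf, θ t = θ t₀ + ∫ s in t₀..t, deriv θ s := by
    intro t ht
    rw [intervalIntegral.integral_deriv_eq_sub
      (fun s _ => (h1.differentiable (by simp)).differentiableAt) (hd.intervalIntegrable _ _)]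
    ring
  have i1 : IntervalIntegrable (fun t => deriv θ t • x t) volume t₀ tf := by
    apply ContinuousOn.intervalIntegrable
    rw [uIcc_of_le h]
    exact hd.continuousOn.smul hxc
  have i2 : IntervalIntegrable (fun t => θ t • w t) volume t₀ tf :=
    hwi.continuousOn_smul h1.continuous.continuousOn
  rw [integral_timeMeasure h, integral_timeMeasure h, eq_neg_iff_add_eq_zero,
    ← intervalIntegral.integral_add i1 i2]
  ext i
  rw [intervalIntegral_apply (i1.add i2)]
  have := integral_mul_add_mul_of_primitive h hdi (hwi.vec_apply i) hθ (primitive_apply hwi hx i)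
  rw [z t₀ (by simp), z tf (by simp)] at this
  simpa using this

/-- The du Bois-Reymond lemma. -/
lemma eq_of_isWeakDeriv_zero (h : t₀ < tf) {v : ℝ → Vec n} (hv : ContinuousOn v (Icc t₀ tf))
    (hd : IsWeakDeriv t₀ tf v 0) : ∀ t ∈ Icc t₀ tf, v t = v t₀ := by
  -- a bump function of integral one
  obtain ⟨η, η1, η2, η3, η4⟩ : ∃ η : ℝ → ℝ, ContDiff ℝ ((⊤ : ℕ∞) : WithTop ℕ∞) η ∧
      HasCompactSupport η ∧ tsupport η ⊆ Ioo t₀ tf ∧ ∫ t, η t = 1 := by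
    let c : ContDiffBump ((t₀ + tf) / 2) :=
      ⟨(tf - t₀) / 8, (tf - t₀) / 4, by linarith, by linarith⟩
    refine ⟨c.normed volume, c.contDiff_normed, c.hasCompactSupport_normed, ?_, c.integral_normed⟩
    rw [c.tsupport_normed_eq, Real.closedBall_eq_Icc]
    intro t ht
    simp only [c, mem_Icc] at ht
    constructor <;> linarith [ht.1, ht.2]
  have loc : LocallyIntegrableOn v (Ioo t₀ tf) volume :=
    (hv.mono Ioo_subset_Icc_self).locallyIntegrableOn measurableSet_Ioo
  have int : ∀ ζ : ℝ → ℝ, Continuous ζ → Integrable (fun t => ζ t • v t) (timeMeasure t₀ tf) := by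
    intro ζ hζ
    exact ((hζ.continuousOn.smul hv).integrableOn_Icc).mono_set Ioo_subset_Icc_self
  have full : ∀ ζ : ℝ → ℝ, tsupport ζ ⊆ Ioo t₀ tf → ∀ u : ℝ → Vec n,
      ∫ t, ζ t • u t = ∫ t, ζ t • u t ∂(timeMeasure t₀ tf) := by
    intro ζ hζ u
    refine (setIntegral_eq_integral_of_forall_compl_eq_zero fun t ht => ?_).symm
    rw [image_eq_zero_of_notMem_tsupport fun hh => ht (hζ hh), zero_smul]
  set c : Vec n := ∫ t, η t • v t ∂(timeMeasure t₀ tf) with hc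
  have ae : ∀ᵐ t ∂(volume : Measure ℝ), t ∈ Ioo t₀ tf → v t - c = 0 := by
    refine isOpen_Ioo.ae_eq_zero_of_integral_contDiff_smul_eq_zero
      (loc.sub ((locallyIntegrable_const c).locallyIntegrableOn _)) ?_
    intro ζ z1 z2 z3
    set m := ∫ t, ζ t with hm
    -- a test function minus a multiple of the bump has a primitive which is a test function
    let κ : ℝ → ℝ := fun t => ζ t - m * η t
    have κ1 : ContDiff ℝ ((⊤ : ℕ∞) : WithTop ℕ∞) κ := z1.sub (contDiff_const.mul η1)
    have κc : Continuous κ := κ1.continuous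
    have κs : ∀ t, t ∉ tsupport ζ ∪ tsupport η → κ t = 0 := by
      intro t ht
      simp only [mem_union, not_or] at ht
      simp [κ, image_eq_zero_of_notMem_tsupport ht.1, image_eq_zero_of_notMem_tsupport ht.2]
    have hK : IsCompact (tsupport ζ ∪ tsupport η) := z2.isCompact.union η2.isCompact
    have hKs : tsupport ζ ∪ tsupport η ⊆ Ioo t₀ tf := union_subset z3 η3
    obtain ⟨a, b, hab, hKab, hI⟩ : ∃ a b, a ≤ b ∧ tsupport ζ ∪ tsupport η ⊆ Icc a b ∧
        Icc a b ⊆ Ioo t₀ tf := by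
      rcases (tsupport ζ ∪ tsupport η).eq_empty_or_nonempty with he | hne
      · refine ⟨(t₀ + tf) / 2, (t₀ + tf) / 2, le_rfl, by simp [he], ?_⟩
        intro t ht
        simp only [Icc_self, mem_singleton_iff] at ht
        constructor <;> linarith
      · have h1 := hKs (hK.sInf_mem hne)
        have h2 := hKs (hK.sSup_mem hne)
        refine ⟨_, _, csInf_le_csSup hne hK.bddBelow hK.bddAbove,
          fun t ht => ⟨csInf_le hK.bddBelow ht, le_csSup hK.bddAbove ht⟩, fun t ht => ?_⟩
        exact ⟨h1.1.trans_le ht.1, ht.2.trans_lt h2.2⟩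
    have κint : ∫ t, κ t = 0 := by
      have i1 : Integrable ζ := z1.continuous.integrable_of_hasCompactSupport z2
      have i2 : Integrable η := η1.continuous.integrable_of_hasCompactSupport η2
      simp only [κ]
      rw [integral_sub i1 (i2.const_mul m), integral_const_mul, η4]
      simp [hm]
    let θ : ℝ → ℝ := fun t => ∫ s in t₀..t, κ s
    have θd : ∀ t, HasDerivAt θ (κ t) t := fun t =>
      intervalIntegral.integral_hasDerivAt_right (κc.intervalIntegrable _ _)
        (κc.stronglyMeasurableAtFilter _ _) κc.continuousAt
    have θdd : deriv θ = κ := funext fun t => (θd t).deriv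
    have θ1 : ContDiff ℝ ((⊤ : ℕ∞) : WithTop ℕ∞) θ := by
      rw [contDiff_infty_iff_deriv, θdd]
      exact ⟨fun t => (θd t).differentiableAt, κ1⟩
    have κ0 : ∀ t, t ∉ Icc a b → κ t = 0 := fun t ht => κs t fun hh => ht (hKab hh)
    have hta : t₀ < a := (hI ⟨le_rfl, hab⟩).1
    have htb : b < tf := (hI ⟨hab, le_rfl⟩).2
    have θ0 : ∀ t, t ∉ Icc a b → θ t = 0 := by
      intro t ht
      rcases lt_or_ge t a with h1 | h1
      · refine intervalIntegral.integral_zero_ae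
          (Eventually.of_forall fun s hs => κ0 s fun hh => ?_)
        rcases mem_uIoc.1 hs with h2 | h2 <;> linarith [hh.1]
      · have h2 : b < t := by by_contra hh; exact ht ⟨h1, not_lt.1 hh⟩
        have : ∫ s in t₀..t, κ s = ∫ s, κ s := by
          rw [intervalIntegral.integral_of_le (by linarith)]
          refine setIntegral_eq_integral_of_forall_compl_eq_zero fun s hs => κ0 s fun hh => hs ?_
          exact ⟨hta.trans_le hh.1, hh.2.trans h2.le⟩
        simp only [θ]
        rw [this, κint]
    have θs : tsupport θ ⊆ Icc a b :=
      closure_minimal (fun t ht => by by_contra hh; exact ht (θ0 t hh)) isClosed_Icc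
    have θ2 : HasCompactSupport θ := isCompact_Icc.of_isClosed_subset (isClosed_tsupport θ) θs
    have key := hd θ θ1 θ2 (θs.trans hI)
    simp only [Pi.zero_apply, smul_zero, integral_zero, neg_zero, θdd, κ] at key
    simp only [sub_smul, mul_smul] at key
    have i4 : Integrable (fun t => m • η t • v t) (timeMeasure t₀ tf) :=
      (int η η1.continuous).smul m
    rw [integral_sub (int ζ z1.continuous) i4, integral_smul, ← hc] at key
    rw [full ζ z3]
    simp only [smul_sub]
    have i3 : Integrable ζ := z1.continuous.integrable_of_hasCompactSupport z2
    have hm' : ∫ t, ζ t ∂(timeMeasure t₀ tf) = m :=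
      setIntegral_eq_integral_of_forall_compl_eq_zero fun t ht =>
        image_eq_zero_of_notMem_tsupport fun hh => ht (z3 hh)
    rw [integral_sub (int ζ z1.continuous) (i3.integrableOn.smul_const c), integral_smul_const,
      hm', key]
  have eqI : ∀ t ∈ Icc t₀ tf, v t = c := by
    have e1 : EqOn v (fun _ => c) (Ioo t₀ tf) := by
      refine Measure.eqOn_open_of_ae_eq (μ := (volume : Measure ℝ)) ?_ isOpen_Ioo
        (hv.mono Ioo_subset_Icc_self) continuousOn_const
      rw [EventuallyEq, ae_restrict_iff' measurableSet_Ioo]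
      filter_upwards [ae] with t ht hm using sub_eq_zero.1 (ht hm)
    exact e1.of_subset_closure hv continuousOn_const Ioo_subset_Icc_self
      (by rw [closure_Ioo h.ne])
  intro t ht
  rw [eqI t ht, eqI t₀ ⟨le_rfl, h.le⟩]

variable {h : t₀ ≤ tf} {q : ℝ≥0∞} [Fact (1 ≤ q)]

lemma continuous_sobVal (x : W1 h q n) : Continuous (sobVal x) := x.1.1.continuous.Icc_extend'

lemma memLp_sobDer (x : W1 h q n) : MemLp (sobDer x) q (timeMeasure t₀ tf) := Lp.memLp x.1.2

lemma integrable_sobDer (x : W1 h q n) : Integrable (sobDer x) (timeMeasure t₀ tf) :=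
  (memLp_sobDer x).integrable Fact.out

lemma continuousOn_primitive {w : ℝ → Vec n} (hw : Integrable w (timeMeasure t₀ tf))
    (h : t₀ ≤ tf) : ContinuousOn (fun t => ∫ s in t₀..t, w s) (Icc t₀ tf) := by
  have := intervalIntegral.continuousOn_primitive_interval' (a := t₀)
    (intervalIntegrable_of_timeMeasure h hw) (by simp)
  rwa [uIcc_of_le h] at this

/-- A Sobolev function is the primitive of its weak derivative. -/
lemma sobVal_eq (h' : t₀ < tf) (x : W1 h q n) :
    ∀ t ∈ Icc t₀ tf, sobVal x t = sobVal x t₀ + ∫ s in t₀..t, sobDer x s := by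
  have hw := integrable_sobDer x
  have hp := continuousOn_primitive hw h
  have hx := (continuous_sobVal x).continuousOn (s := Icc t₀ tf)
  have := eq_of_isWeakDeriv_zero h' (v := fun t => sobVal x t - ∫ s in t₀..t, sobDer x s)
    (hx.sub hp) (by
      intro θ h1 h2 h3
      have hd : Continuous (deriv θ) := h1.continuous_deriv (by simp)
      have e1 := x.2 θ h1 h2 h3
      have e2 := isWeakDeriv_of_primitive h hw hp (by intro t ht; simp) θ h1 h2 h3
      simp only [smul_sub]
      rw [integral_sub]
      · rw [e2]
        simp only [Pi.zero_apply, smul_zero, integral_zero, neg_zero]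
        exact sub_eq_zero.2 e1
      · exact ((hd.continuousOn.smul hx).integrableOn_Icc).mono_set Ioo_subset_Icc_self
      · exact ((hd.continuousOn.smul hp).integrableOn_Icc).mono_set Ioo_subset_Icc_self)
  intro t ht
  have h3 := this t ht
  simp only [intervalIntegral.integral_same, sub_zero] at h3
  rw [← h3]; abel

/-- The Sobolev function with given initial value and weak derivative. -/
def W1.ofDeriv (h : t₀ ≤ tf) (a : Vec n) (w : Lp (Vec n) q (timeMeasure t₀ tf)) : W1 h q n :=
  ⟨(⟨fun t => a + ∫ s in t₀..t, w s, by
      have := continuousOn_primitive ((Lp.memLp w).integrable Fact.out) h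
      exact continuous_const.add (continuousOn_iff_continuous_domRestrict.1 this)⟩, w), by
    have hw := (Lp.memLp w).integrable (Fact.out : 1 ≤ q)
    have hp := continuousOn_primitive hw h
    have e : ∀ t ∈ Icc t₀ tf, IccExtend h (fun t : Icc t₀ tf => a + ∫ s in t₀..(t : ℝ), w s) t
        = a + ∫ s in t₀..t, w s := fun t ht => IccExtend_of_mem h _ ht
    refine isWeakDeriv_of_primitive h hw ?_ ?_
    · exact (continuousOn_const.add hp).congr e
    · intro t ht
      have h1 := e t ht
      have h2 := e t₀ ⟨le_rfl, h⟩
      simp only [intervalIntegral.integral_same, add_zero] at h2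
      simp only [ContinuousMap.coe_mk]
      rw [h1, h2]⟩

lemma sobVal_ofDeriv (a : Vec n) (w : Lp (Vec n) q (timeMeasure t₀ tf)) {t : ℝ}
    (ht : t ∈ Icc t₀ tf) : sobVal (W1.ofDeriv h a w) t = a + ∫ s in t₀..t, w s :=
  IccExtend_of_mem h _ ht

lemma W1.ext_of_der (h' : t₀ < tf) {x y : W1 h q n} (h0 : sobVal x t₀ = sobVal y t₀)
    (hd : sobDer x =ᵐ[timeMeasure t₀ tf] sobDer y) : x = y := by
  have e2 : x.1.2 = y.1.2 := Lp.ext hd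
  have e1 : x.1.1 = y.1.1 := by
    ext1 t
    have hx := sobVal_eq h' x t t.2
    have hy := sobVal_eq h' y t t.2
    have e3 : sobDer x = sobDer y := by simp only [sobDer]; rw [e2]
    rw [h0, e3, ← hy] at hx
    simpa [sobVal] using hx
  exact Subtype.ext (Prod.ext e1 e2)

/-- Integration by parts for Sobolev functions. -/
lemma integral_inner_sobDer (h' : t₀ < tf) {q₁ q₂ : ℝ≥0∞} [Fact (1 ≤ q₁)] [Fact (1 ≤ q₂)]
    (x : W1 h q₁ n) (y : W1 h q₂ n) :
    ∫ t, (inner ℝ (sobDer x t) (sobVal y t) + inner ℝ (sobVal x t) (sobDer y t))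
        ∂(timeMeasure t₀ tf)
      = inner ℝ (sobVal x tf) (sobVal y tf) - inner ℝ (sobVal x t₀) (sobVal y t₀) := by
  have hx := intervalIntegrable_of_timeMeasure h (integrable_sobDer x)
  have hy := intervalIntegrable_of_timeMeasure h (integrable_sobDer y)
  rw [integral_timeMeasure h]
  simp only [PiLp.inner_apply, RCLike.inner_apply, conj_trivial]
  simp only [← Finset.sum_add_distrib, ← Finset.sum_sub_distrib]
  rw [intervalIntegral.integral_finsetSum]
  · refine Finset.sum_congr rfl fun i _ => ?_
    have := integral_mul_add_mul_of_primitive h (hx.vec_apply i) (hy.vec_apply i)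
      (primitive_apply hx (sobVal_eq h' x) i) (primitive_apply hy (sobVal_eq h' y) i)
    simp only [mul_comm] at this ⊢
    exact this
  · intro i _
    have cx : Continuous fun t => sobVal x t i :=
      (EuclideanSpace.proj (𝕜 := ℝ) i).continuous.comp (continuous_sobVal x)
    have cy : Continuous fun t => sobVal y t i :=
      (EuclideanSpace.proj (𝕜 := ℝ) i).continuous.comp (continuous_sobVal y)
    exact ((hx.vec_apply i).continuousOn_mul cy.continuousOn).add
      ((hy.vec_apply i).mul_continuousOn cx.continuousOn)

end W1

/-! ### Essentially bounded functions -/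

section Linfty

variable {α : Type*} [MeasurableSpace α] {μ : Measure α} {X E F : Type*}
  [NormedAddCommGroup X] [NormedSpace ℝ X]
  [NormedAddCommGroup E] [NormedSpace ℝ E] [NormedAddCommGroup F] [NormedSpace ℝ F]

lemma Lp.ae_norm_le_norm_top (f : Lp E ⊤ μ) : ∀ᵐ t ∂μ, ‖f t‖ ≤ ‖f‖ := by
  have h := (Lp.memLp f).2
  filter_upwards [ae_le_eLpNormEssSup (f := f) (μ := μ)] with t ht
  rw [Lp.norm_def, ← toReal_enorm]
  refine ENNReal.toReal_mono h.ne ?_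
  rwa [eLpNorm_exponent_top]

lemma Lp.norm_top_le {f : Lp E ⊤ μ} {C : ℝ} (hC : 0 ≤ C) (h : ∀ᵐ t ∂μ, ‖f t‖ ≤ C) : ‖f‖ ≤ C := by
  rw [Lp.norm_def]
  refine ENNReal.toReal_le_of_le_ofReal hC ?_
  rw [eLpNorm_exponent_top]
  exact eLpNormEssSup_le_of_ae_bound h

/-- A continuous linear map into `L^∞` from its pointwise values. -/
def linftyMk (φ : X → α → E) (hm : ∀ x, MemLp (φ x) ⊤ μ)
    (ha : ∀ x y, φ (x + y) =ᵐ[μ] fun t => φ x t + φ y t)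
    (hs : ∀ (c : ℝ) x, φ (c • x) =ᵐ[μ] fun t => c • φ x t)
    (C : ℝ) (hC : 0 ≤ C) (hb : ∀ x, ∀ᵐ t ∂μ, ‖φ x t‖ ≤ C * ‖x‖) : X →L[ℝ] Lp E ⊤ μ :=
  LinearMap.mkContinuous
    { toFun := fun x => (hm x).toLp
      map_add' := fun x y => by
        apply Lp.ext
        filter_upwards [(hm (x + y)).coeFn_toLp, (hm x).coeFn_toLp, (hm y).coeFn_toLp, ha x y,
          Lp.coeFn_add (hm x).toLp (hm y).toLp] with t h1 h2 h3 h4 h5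
        rw [h1, h5, Pi.add_apply, h2, h3, h4]
      map_smul' := fun c x => by
        apply Lp.ext
        filter_upwards [(hm (c • x)).coeFn_toLp, (hm x).coeFn_toLp, hs c x,
          Lp.coeFn_smul c (hm x).toLp] with t h1 h2 h4 h5
        rw [h1, RingHom.id_apply, h5, Pi.smul_apply, h2, h4] } C (by
      intro x
      refine Lp.norm_top_le (by positivity) ?_
      filter_upwards [(hm x).coeFn_toLp, hb x] with t h1 h2
      simp only [LinearMap.coe_mk, AddHom.coe_mk]
      rw [h1]; exact h2)

lemma coeFn_linftyMk {φ : X → α → E} {hm : ∀ x, MemLp (φ x) ⊤ μ}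
    {ha : ∀ x y, φ (x + y) =ᵐ[μ] fun t => φ x t + φ y t}
    {hs : ∀ (c : ℝ) x, φ (c • x) =ᵐ[μ] fun t => c • φ x t}
    {C : ℝ} {hC : 0 ≤ C} {hb : ∀ x, ∀ᵐ t ∂μ, ‖φ x t‖ ≤ C * ‖x‖} (x : X) :
    linftyMk φ hm ha hs C hC hb x =ᵐ[μ] φ x := (hm x).coeFn_toLp

/-- The integral over a measurable set as a continuous linear functional on `L^∞` of a finite
measure. -/
def linftyIntegral [IsFiniteMeasure μ] (s : Set α) :
    Lp E ⊤ μ →L[ℝ] E :=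
  LinearMap.mkContinuous
    { toFun := fun f => ∫ t in s, f t ∂μ
      map_add' := fun f g => by
        have hf := ((Lp.memLp f).integrable (by simp)).integrableOn (s := s)
        have hg := ((Lp.memLp g).integrable (by simp)).integrableOn (s := s)
        rw [← integral_add hf hg]
        exact integral_congr_ae (ae_restrict_of_ae (Lp.coeFn_add f g))
      map_smul' := fun c f => by
        rw [RingHom.id_apply, ← integral_smul]
        exact integral_congr_ae (ae_restrict_of_ae (Lp.coeFn_smul c f)) } (μ.real univ) (by
      intro f
      simp only [LinearMap.coe_mk, AddHom.coe_mk]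
      refine (norm_integral_le_of_norm_le_const
        (ae_restrict_of_ae (Lp.ae_norm_le_norm_top f))).trans ?_
      rw [mul_comm]
      gcongr
      · simp only [Measure.real, Measure.restrict_apply_univ]
        exact ENNReal.toReal_mono (measure_ne_top _ _) (measure_mono (subset_univ _)))

@[simp] lemma linftyIntegral_apply [IsFiniteMeasure μ] (s : Set α)
    (f : Lp E ⊤ μ) : linftyIntegral s f = ∫ t in s, f t ∂μ := rfl

end Linfty

/-! ### Continuous linear operations on Sobolev functions -/

namespace W1

variable {n : ℕ} {t₀ tf : ℝ} {h : t₀ ≤ tf} {q : ℝ≥0∞} [Fact (1 ≤ q)]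

/-- Evaluation at a point. -/
def evalL (h : t₀ ≤ tf) (q : ℝ≥0∞) [Fact (1 ≤ q)] (t : ℝ) : W1 h q n →L[ℝ] Vec n :=
  (ContinuousMap.evalCLM ℝ (projIcc t₀ tf h t)).comp
    ((ContinuousLinearMap.fst ℝ _ _).comp (W1 h q n).subtypeL)

/-- The weak derivative. -/
def derL (h : t₀ ≤ tf) (q : ℝ≥0∞) [Fact (1 ≤ q)] :
    W1 h q n →L[ℝ] Lp (Vec n) q (timeMeasure t₀ tf) :=
  (ContinuousLinearMap.snd ℝ _ _).comp (W1 h q n).subtypeL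

lemma norm_sobVal_le (x : W1 h q n) (t : ℝ) : ‖sobVal x t‖ ≤ ‖x‖ :=
  (x.1.1.norm_coe_le_norm _).trans (norm_fst_le x.1)

lemma sobVal_add (x y : W1 h q n) (t : ℝ) : sobVal (x + y) t = sobVal x t + sobVal y t := rfl

lemma sobVal_smul (c : ℝ) (x : W1 h q n) (t : ℝ) : sobVal (c • x) t = c • sobVal x t := rfl

lemma memLp_sobVal (x : W1 h q n) : MemLp (sobVal x) ⊤ (timeMeasure t₀ tf) :=
  memLp_top_of_bound (continuous_sobVal x).aestronglyMeasurable ‖x‖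
    (Eventually.of_forall (norm_sobVal_le x))

/-- The values, as an essentially bounded function. -/
def valL (h : t₀ ≤ tf) (q : ℝ≥0∞) [Fact (1 ≤ q)] :
    W1 h q n →L[ℝ] Lp (Vec n) ⊤ (timeMeasure t₀ tf) :=
  linftyMk (X := W1 h q n) (E := Vec n) (fun x => sobVal x) memLp_sobVal
    (fun x y => Eventually.of_forall fun t => sobVal_add x y t)
    (fun c x => Eventually.of_forall fun t => sobVal_smul c x t)
    1 zero_le_one (fun x => Eventually.of_forall fun t => by
      rw [one_mul]; exact norm_sobVal_le x t)

lemma coeFn_valL (x : W1 h q n) : valL h q x =ᵐ[timeMeasure t₀ tf] sobVal x := coeFn_linftyMk x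

lemma completeSpace_top (h : t₀ < tf) : CompleteSpace (W1 h.le ⊤ n) := by
  have hc : IsClosed ((W1 h.le ⊤ n : Submodule ℝ _) :
      Set (C(Icc t₀ tf, Vec n) × Lp (Vec n) ⊤ (timeMeasure t₀ tf))) := by
    have : ((W1 h.le ⊤ n : Submodule ℝ _) :
        Set (C(Icc t₀ tf, Vec n) × Lp (Vec n) ⊤ (timeMeasure t₀ tf)))
        = ⋂ t : Icc t₀ tf, {v | v.1 t = v.1 ⟨t₀, le_rfl, h.le⟩
            + linftyIntegral (Ioc t₀ t) v.2} := by
      have hint : ∀ (t : Icc t₀ tf) (w : Lp (Vec n) ⊤ (timeMeasure t₀ tf)),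
          linftyIntegral (Ioc t₀ t) w = ∫ s in t₀..(t : ℝ), w s := by
        intro t w
        rw [linftyIntegral_apply, intervalIntegral.integral_of_le t.2.1]
        rw [Measure.restrict_restrict measurableSet_Ioc]
        refine setIntegral_congr_set ?_
        have : (Ioc t₀ (t : ℝ) ∩ Ioo t₀ tf : Set ℝ)
            =ᵐ[volume] (Ioc t₀ (t : ℝ) ∩ Ioc t₀ tf : Set ℝ) :=
          (ae_eq_refl _).inter Ioo_ae_eq_Ioc
        refine this.trans ?_
        rw [inter_eq_left.2 (Ioc_subset_Ioc le_rfl t.2.2)]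
        exact ae_eq_refl _
      ext v
      simp only [SetLike.mem_coe, mem_iInter, mem_ofPred_eq]
      constructor
      · intro hv t
        have := sobVal_eq h (⟨v, hv⟩ : W1 h.le ⊤ n) t t.2
        rw [hint]
        simpa [sobVal, sobDer, projIcc_of_mem h.le t.2] using this
      · intro hv
        refine isWeakDeriv_of_primitive h.le ((Lp.memLp v.2).integrable (by simp))
          (v.1.continuous.Icc_extend').continuousOn ?_
        intro t ht
        have := hv ⟨t, ht⟩
        rw [hint] at this
        rw [IccExtend_of_mem h.le _ ht, IccExtend_of_mem h.le _ (⟨le_rfl, h.le⟩ : t₀ ∈ Icc t₀ tf)]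
        exact this
    rw [this]
    refine isClosed_iInter fun t => isClosed_eq ?_ ?_
    · exact (ContinuousMap.evalCLM ℝ t).continuous.comp continuous_fst
    · exact ((ContinuousMap.evalCLM ℝ _).continuous.comp continuous_fst).add
        ((linftyIntegral _).continuous.comp continuous_snd)
  exact hc.completeSpace_coe

/-- The inclusion `W^{1,q} → W^{1,r}` for `r ≤ q`. -/
def incl (q r : ℝ≥0∞) [Fact (1 ≤ q)] [Fact (1 ≤ r)] (hqr : r ≤ q) (x : W1 h q n) : W1 h r n :=
  ⟨(x.1.1, ((memLp_sobDer x).mono_exponent hqr).toLp), by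
    intro θ h1 h2 h3
    refine (x.2 θ h1 h2 h3).trans ?_
    congr 1
    refine integral_congr_ae ?_
    filter_upwards [((memLp_sobDer x).mono_exponent hqr).coeFn_toLp] with t ht
    rw [ht]; rfl⟩

variable {r : ℝ≥0∞} [Fact (1 ≤ r)]

lemma sobDer_incl (hqr : r ≤ q) (x : W1 h q n) :
    sobDer (incl q r hqr x) =ᵐ[timeMeasure t₀ tf] sobDer x :=
  ((memLp_sobDer x).mono_exponent hqr).coeFn_toLp

end W1

/-! ### Continuous differentiability from quadratic remainder estimates -/

section Quadratic

variable {X V : Type*} [NormedAddCommGroup X] [NormedSpace ℝ X]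
  [NormedAddCommGroup V] [NormedSpace ℝ V]

lemma hasFDerivAt_of_quadratic {Ψ : X → V} {D : X → X →L[ℝ] V}
    (h : ∀ R : ℝ, ∃ C : ℝ, ∀ x y, ‖x‖ ≤ R → ‖y‖ ≤ R →
      ‖Ψ y - Ψ x - D x (y - x)‖ ≤ C * ‖y - x‖ ^ 2) (x : X) : HasFDerivAt Ψ (D x) x := by
  obtain ⟨C, hC⟩ := h (‖x‖ + 1)
  refine HasFDerivAt.of_isLittleO
    (Asymptotics.IsBigO.trans_isLittleO ?_ (Asymptotics.isLittleO_pow_sub_sub x one_lt_two))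
  refine Asymptotics.IsBigO.of_bound C ?_
  filter_upwards [Metric.closedBall_mem_nhds x one_pos] with y hy
  rw [mem_closedBall_iff_norm] at hy
  have hy' : ‖y‖ ≤ ‖x‖ + 1 := by
    have := norm_add_le x (y - x)
    rw [add_sub_cancel] at this
    linarith
  simpa using hC x y (by linarith) hy'

/-- If the remainder of the first-order expansion with candidate derivative `D` is quadratic,
locally uniformly in the base point, then `D` is automatically locally Lipschitz: expanding `Ψ` at
`x` and at `y` towards a common third point and comparing bounds `D x - D y`. -/
lemma contDiff_one_of_quadratic {Ψ : X → V} {D : X → X →L[ℝ] V}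
    (h : ∀ R : ℝ, ∃ C : ℝ, ∀ x y, ‖x‖ ≤ R → ‖y‖ ≤ R →
      ‖Ψ y - Ψ x - D x (y - x)‖ ≤ C * ‖y - x‖ ^ 2) : ContDiff ℝ 1 Ψ := by
  have hd := hasFDerivAt_of_quadratic h
  have hD : fderiv ℝ Ψ = D := funext fun x => (hd x).fderiv
  rw [contDiff_one_iff_fderiv]
  refine ⟨fun x => (hd x).differentiableAt, ?_⟩
  rw [hD, continuous_iff_continuousAt]
  intro x
  obtain ⟨C, hC⟩ := h (‖x‖ + 2)
  have key : ∀ y, ‖y - x‖ ≤ 1 → ‖D y - D x‖ ≤ 6 * C * ‖y - x‖ := by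
    intro y hy
    rcases eq_or_ne y x with rfl | hne
    · simp
    have hδ : 0 < ‖y - x‖ := norm_pos_iff.2 (sub_ne_zero.2 hne)
    set δ := ‖y - x‖ with hδ'
    have hC0 : 0 ≤ C := by
      have h1 := (norm_nonneg _).trans (hC x y (by linarith [norm_nonneg x]) (by
        have := norm_add_le x (y - x); rw [add_sub_cancel] at this; linarith))
      by_contra hneg
      have : C * ‖y - x‖ ^ 2 < 0 := mul_neg_of_neg_of_pos (not_le.1 hneg) (by positivity)
      linarith
    refine ContinuousLinearMap.opNorm_le_of_unit_norm (by positivity) fun v hv => ?_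
    have hk : ‖δ • v‖ = δ := by rw [norm_smul, hv, mul_one, Real.norm_of_nonneg hδ.le]
    set k := δ • v
    have n1 : ‖y‖ ≤ ‖x‖ + 2 := by
      have := norm_add_le x (y - x); rw [add_sub_cancel] at this; linarith
    have n3 : ‖y + k‖ ≤ ‖x‖ + 2 := by
      have h1 := norm_add_le x (y - x); rw [add_sub_cancel] at h1
      have := norm_add_le y k; linarith
    have n4 : ‖y + k - x‖ ≤ 2 * δ := by
      have := norm_add_le (y - x) k
      rw [show y - x + k = y + k - x by abel] at this; linarith
    have a := hC x (y + k) (by linarith) n3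
    have b := hC y (y + k) n1 n3
    have c := hC x y (by linarith) n1
    rw [add_sub_cancel_left, hk] at b
    have a' : ‖Ψ (y + k) - Ψ x - D x (y + k - x)‖ ≤ C * (2 * δ) ^ 2 := a.trans (by gcongr)
    have e : (D y - D x) k = (Ψ (y + k) - Ψ x - D x (y + k - x)) - (Ψ (y + k) - Ψ y - D y k)
        - (Ψ y - Ψ x - D x (y - x)) := by
      rw [show y + k - x = (y - x) + k by abel, map_add, sub_apply]; abel
    have n5 : ‖(D y - D x) k‖ ≤ 6 * C * δ * δ := by
      rw [e]
      have h1 := norm_sub_le ((Ψ (y + k) - Ψ x - D x (y + k - x)) - (Ψ (y + k) - Ψ y - D y k))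
        (Ψ y - Ψ x - D x (y - x))
      have h2 := norm_sub_le (Ψ (y + k) - Ψ x - D x (y + k - x)) (Ψ (y + k) - Ψ y - D y k)
      nlinarith
    have n6 : ‖(D y - D x) k‖ = δ * ‖(D y - D x) v‖ := by
      rw [map_smul, norm_smul, Real.norm_of_nonneg hδ.le]
    rw [n6, mul_comm] at n5
    exact le_of_mul_le_mul_right n5 hδ
  rw [ContinuousAt, tendsto_iff_norm_sub_tendsto_zero]
  have hlim : Tendsto (fun y => 6 * C * ‖y - x‖) (𝓝 x) (𝓝 0) := by
    have : Continuous fun y => 6 * C * ‖y - x‖ := by fun_prop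
    simpa using this.tendsto x
  refine squeeze_zero' (Eventually.of_forall fun _ => norm_nonneg _) ?_ hlim
  filter_upwards [Metric.closedBall_mem_nhds x one_pos] with y hy
  rw [mem_closedBall_iff_norm] at hy
  exact key y hy

lemma norm_sub_sub_fderiv_le {f : X → V} (hf : Differentiable ℝ f) {s : Set X} (hs : Convex ℝ s)
    {L : ℝ} (hL : 0 ≤ L)
    (hlip : ∀ x ∈ s, ∀ y ∈ s, ‖fderiv ℝ f x - fderiv ℝ f y‖ ≤ L * ‖x - y‖) {x y : X} (hx : x ∈ s)
    (hy : y ∈ s) : ‖f y - f x - fderiv ℝ f x (y - x)‖ ≤ L * ‖y - x‖ ^ 2 := by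
  have := (convex_segment x y).norm_image_sub_le_of_norm_hasFDerivWithin_le'
    (f := f) (f' := fun z => fderiv ℝ f z) (φ := fderiv ℝ f x) (C := L * ‖y - x‖)
    (fun z _ => (hf z).hasFDerivAt.hasFDerivWithinAt) (fun z hz => by
      refine (hlip z (hs.segment_subset hx hy hz) x hx).trans ?_
      gcongr
      obtain ⟨a, b, ha, hb, hab, rfl⟩ := hz
      have : a • x + b • y - x = b • (y - x) := by
        rw [smul_sub, show a = 1 - b by linarith, sub_smul, one_smul]; abel
      rw [this, norm_smul, Real.norm_of_nonneg hb]
      exact mul_le_of_le_one_left (norm_nonneg _) (by linarith))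
    (left_mem_segment ℝ x y) (right_mem_segment ℝ x y)
  rw [sq, ← mul_assoc]; exact this

end Quadratic

/-! ### Superposition operators in `L^∞` -/

section Caratheodory

variable {α : Type*} [MeasurableSpace α] {μ : Measure α} {W E : Type*}
  [NormedAddCommGroup W] [NormedSpace ℝ W]
  [NormedAddCommGroup E] [NormedSpace ℝ E]

/-- A Carathéodory function composed with a measurable function is measurable. -/
lemma AEStronglyMeasurable.caratheodory {h : α → W → E}
    (hm : ∀ w, AEStronglyMeasurable (fun t => h t w) μ) (hc : ∀ᵐ t ∂μ, Continuous (h t))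
    {w : α → W} (hw : AEStronglyMeasurable w μ) :
    AEStronglyMeasurable (fun t => h t (w t)) μ := by
  obtain ⟨w', hw', hww⟩ := hw
  have simple : ∀ s : SimpleFunc α W, AEStronglyMeasurable (fun t => h t (s t)) μ := by
    intro s
    have : (fun t => h t (s t))
        = fun t => ∑ c ∈ s.range, (s ⁻¹' {c}).indicator (fun t => h t c) t := by
      funext t
      rw [Finset.sum_eq_single (s t)]
      · simp
      · intro c _ hcs
        exact indicator_of_notMem (fun hh => hcs (by simpa using hh.symm)) _
      · intro hh
        exact absurd (s.mem_range_self t) hh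
    rw [this]
    exact Finset.aestronglyMeasurable_fun_sum _ fun c _ =>
      (hm c).indicator (s.measurableSet_fiber c)
  refine aestronglyMeasurable_of_tendsto_ae atTop (fun n => simple (hw'.approx n)) ?_
  filter_upwards [hc, hww] with t h1 h2
  rw [h2]
  exact (h1.tendsto _).comp (hw'.tendsto_approx t)

variable [FiniteDimensional ℝ W]

/-- Measurability of an operator-valued function on a finite-dimensional space is tested on
vectors. -/
lemma aestronglyMeasurable_clm {T : α → W →L[ℝ] E}
    (h : ∀ v, AEStronglyMeasurable (fun t => T t v) μ) : AEStronglyMeasurable T μ := by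
  let b := Module.finBasis ℝ W
  have : T = fun t => ∑ i, ContinuousLinearMap.smulRightL ℝ W E
      (LinearMap.toContinuousLinearMap (b.coord i)) (T t (b i)) := by
    funext t
    ext v
    have e := congrArg (T t) (b.sum_repr v)
    simp only [map_sum, map_smul] at e
    simpa using e.symm
  rw [this]
  exact Finset.aestronglyMeasurable_fun_sum _ fun i _ =>
    (ContinuousLinearMap.continuous _).comp_aestronglyMeasurable (h (b i))

lemma aestronglyMeasurable_fderiv {h : α → W → E}
    (hm : ∀ w, AEStronglyMeasurable (fun t => h t w) μ) (hc : ∀ᵐ t ∂μ, ContDiff ℝ 1 (h t))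
    (w : W) : AEStronglyMeasurable (fun t => fderiv ℝ (h t) w) μ := by
  refine aestronglyMeasurable_clm fun v => ?_
  refine aestronglyMeasurable_of_tendsto_ae atTop
    (f := fun (n : ℕ) t => (n : ℝ) • (h t (w + (n : ℝ)⁻¹ • v) - h t w))
    (fun n => ((hm _).sub (hm _)).const_smul _) ?_
  filter_upwards [hc] with t ht
  exact ((ht.differentiable one_ne_zero w).hasFDerivAt.lim_real v).comp
    tendsto_natCast_atTop_atTop

/-- The hypotheses under which superposition with `h(t, ·)` is continuously differentiable in
`L^∞`: measurability in `t`, continuous differentiability in `w`, essentially bounded values and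
derivatives at the origin, and derivatives that are Lipschitz on balls uniformly in `t`. -/
structure IsNemytskii (μ : Measure α) (h : α → W → E) : Prop where
  measurable : ∀ w, AEStronglyMeasurable (fun t => h t w) μ
  contDiff : ∀ᵐ t ∂μ, ContDiff ℝ 1 (h t)
  bounded : ∃ K : ℝ, ∀ᵐ t ∂μ, ‖h t 0‖ ≤ K ∧ ‖fderiv ℝ (h t) 0‖ ≤ K
  lipschitz : ∀ R : ℝ, ∃ L : ℝ, 0 ≤ L ∧ ∀ᵐ t ∂μ,
    ∀ w₁ ∈ Metric.closedBall (0 : W) R, ∀ w₂ ∈ Metric.closedBall (0 : W) R,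
      ‖fderiv ℝ (h t) w₁ - fderiv ℝ (h t) w₂‖ ≤ L * ‖w₁ - w₂‖

namespace IsNemytskii

variable {h : α → W → E} (hh : IsNemytskii μ h)
include hh

lemma memLp_fderiv (w : Lp W ⊤ μ) : MemLp (fun t => fderiv ℝ (h t) (w t)) ⊤ μ := by
  obtain ⟨K, hK⟩ := hh.bounded
  obtain ⟨L, hL0, hL⟩ := hh.lipschitz ‖w‖
  refine memLp_top_of_bound (AEStronglyMeasurable.caratheodory
    (aestronglyMeasurable_fderiv hh.measurable hh.contDiff) ?_ (Lp.aestronglyMeasurable w))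
    (K + L * ‖w‖) ?_
  · filter_upwards [hh.contDiff] with t ht using ht.continuous_fderiv one_ne_zero
  · filter_upwards [hK, hL, Lp.ae_norm_le_norm_top w] with t h1 h2 h3
    have h4 := h2 (w t) (by simpa using h3) 0 (by simp)
    have h5 := norm_add_le (fderiv ℝ (h t) 0) (fderiv ℝ (h t) (w t) - fderiv ℝ (h t) 0)
    rw [add_sub_cancel] at h5
    rw [sub_zero] at h4
    have : L * ‖w t‖ ≤ L * ‖w‖ := by gcongr
    linarith [h1.2]

lemma memLp (w : Lp W ⊤ μ) : MemLp (fun t => h t (w t)) ⊤ μ := by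
  obtain ⟨K, hK⟩ := hh.bounded
  obtain ⟨L, hL0, hL⟩ := hh.lipschitz ‖w‖
  refine memLp_top_of_bound (AEStronglyMeasurable.caratheodory hh.measurable ?_
    (Lp.aestronglyMeasurable w)) (K + K * ‖w‖ + L * ‖w‖ ^ 2) ?_
  · filter_upwards [hh.contDiff] with t ht using ht.continuous
  · filter_upwards [hK, hL, Lp.ae_norm_le_norm_top w, hh.contDiff] with t h1 h2 h3 h4
    have h5 := norm_sub_sub_fderiv_le (h4.differentiable one_ne_zero)
      (convex_closedBall (0 : W) ‖w‖) hL0 h2 (x := 0) (y := w t) (by simp) (by simpa using h3)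
    rw [sub_zero] at h5
    have h6 : ‖fderiv ℝ (h t) 0 (w t)‖ ≤ K * ‖w‖ :=
      ((fderiv ℝ (h t) 0).le_opNorm _).trans (mul_le_mul h1.2 h3 (norm_nonneg _)
        ((norm_nonneg _).trans h1.2))
    have h7 : L * ‖w t‖ ^ 2 ≤ L * ‖w‖ ^ 2 := by gcongr
    have h8 : h t (w t) = (h t (w t) - h t 0 - fderiv ℝ (h t) 0 (w t)) + h t 0
      + fderiv ℝ (h t) 0 (w t) := by abel
    rw [h8]
    refine (norm_add_le _ _).trans ?_
    have := norm_add_le (h t (w t) - h t 0 - fderiv ℝ (h t) 0 (w t)) (h t 0)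
    linarith [h1.1]

/-- The superposition operator `w ↦ h(·, w(·))` in `L^∞`. -/
def op (w : Lp W ⊤ μ) : Lp E ⊤ μ := (hh.memLp w).toLp

lemma coeFn_op (w : Lp W ⊤ μ) : hh.op w =ᵐ[μ] fun t => h t (w t) := (hh.memLp w).coeFn_toLp

/-- The derivative of the superposition operator: pointwise application of `h_w(·, w(·))`. -/
def opDeriv (w : Lp W ⊤ μ) : Lp W ⊤ μ →L[ℝ] Lp E ⊤ μ :=
  (ContinuousLinearMap.id ℝ (W →L[ℝ] E)).holderL μ ⊤ ⊤ ⊤ (hh.memLp_fderiv w).toLp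

lemma coeFn_opDeriv (w v : Lp W ⊤ μ) :
    hh.opDeriv w v =ᵐ[μ] fun t => fderiv ℝ (h t) (w t) (v t) := by
  filter_upwards [(ContinuousLinearMap.id ℝ (W →L[ℝ] E)).coeFn_holder (r := ⊤)
    (hh.memLp_fderiv w).toLp v, (hh.memLp_fderiv w).coeFn_toLp] with t h1 h2
  refine h1.trans ?_
  rw [h2]; rfl

lemma quadratic (R : ℝ) : ∃ C : ℝ, ∀ w v : Lp W ⊤ μ, ‖w‖ ≤ R → ‖v‖ ≤ R →
    ‖hh.op v - hh.op w - hh.opDeriv w (v - w)‖ ≤ C * ‖v - w‖ ^ 2 := by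
  obtain ⟨L, hL0, hL⟩ := hh.lipschitz R
  refine ⟨L, fun w v hw hv => Lp.norm_top_le (by positivity) ?_⟩
  filter_upwards [hL, hh.contDiff, hh.coeFn_op v, hh.coeFn_op w, hh.coeFn_opDeriv w (v - w),
    Lp.coeFn_sub (hh.op v - hh.op w) (hh.opDeriv w (v - w)), Lp.coeFn_sub (hh.op v) (hh.op w),
    Lp.coeFn_sub v w, Lp.ae_norm_le_norm_top w, Lp.ae_norm_le_norm_top v,
    Lp.ae_norm_le_norm_top (v - w)] with t h1 h2 h3 h4 h5 h6 h7 h8 h9 h10 h11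
  rw [h6, Pi.sub_apply, h7, Pi.sub_apply, h3, h4, h5]
  rw [h8, Pi.sub_apply] at h11 ⊢
  refine (norm_sub_sub_fderiv_le (h2.differentiable one_ne_zero)
      (convex_closedBall (0 : W) R) hL0 h1 (by simpa using h9.trans hw)
      (by simpa using h10.trans hv)).trans ?_
  gcongr

lemma contDiff_op : ContDiff ℝ 1 hh.op := contDiff_one_of_quadratic hh.quadratic

lemma hasFDerivAt_op (w : Lp W ⊤ μ) : HasFDerivAt hh.op (hh.opDeriv w) w :=
  hasFDerivAt_of_quadratic hh.quadratic w

end IsNemytskii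

end Caratheodory

/-! ### Derivatives of `L^∞`-valued maps, computed pointwise -/

section LinftyDeriv

variable {α : Type*} [MeasurableSpace α] {μ : Measure α} {X W E F G : Type*}
  [NormedAddCommGroup X] [NormedSpace ℝ X] [NormedAddCommGroup W] [NormedSpace ℝ W]
  [NormedAddCommGroup E] [NormedSpace ℝ E] [NormedAddCommGroup F] [NormedSpace ℝ F]
  [NormedAddCommGroup G] [NormedSpace ℝ G]

/-- `Φ : X → L^∞(E)` is differentiable at `x`, with derivative in the direction `δ` given almost
everywhere by `φ δ`. -/
def HasLinftyDerivAt (Φ : X → Lp E ⊤ μ) (φ : X → α → E) (x : X) : Prop :=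
  ∃ D : X →L[ℝ] Lp E ⊤ μ, HasFDerivAt Φ D x ∧ ∀ δ, D δ =ᵐ[μ] φ δ

namespace HasLinftyDerivAt

variable {Φ : X → Lp E ⊤ μ} {φ : X → α → E} {Θ : X → Lp F ⊤ μ} {θ : X → α → F} {x : X}

lemma clm (L : X →L[ℝ] Lp E ⊤ μ) : HasLinftyDerivAt L (fun δ => L δ) x :=
  ⟨L, L.hasFDerivAt, fun _ => ae_eq_refl _⟩

lemma congr_deriv {φ' : X → α → E} (h : HasLinftyDerivAt Φ φ x) (he : ∀ δ, φ δ =ᵐ[μ] φ' δ) :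
    HasLinftyDerivAt Φ φ' x := by
  obtain ⟨D, h1, h2⟩ := h
  exact ⟨D, h1, fun δ => (h2 δ).trans (he δ)⟩

lemma compLp (h : HasLinftyDerivAt Φ φ x) (L : E →L[ℝ] F) :
    HasLinftyDerivAt (fun y => L.compLpL ⊤ μ (Φ y)) (fun δ t => L (φ δ t)) x := by
  obtain ⟨D, h1, h2⟩ := h
  refine ⟨(L.compLpL ⊤ μ).comp D, (L.compLpL ⊤ μ).hasFDerivAt.comp x h1, fun δ => ?_⟩
  filter_upwards [h2 δ, L.coeFn_compLpL (D δ)] with t h3 h4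
  exact h4.trans (by rw [h3])

lemma add {ψ : X → α → E} {Ψ : X → Lp E ⊤ μ} (h : HasLinftyDerivAt Φ φ x)
    (h' : HasLinftyDerivAt Ψ ψ x) :
    HasLinftyDerivAt (fun y => Φ y + Ψ y) (fun δ t => φ δ t + ψ δ t) x := by
  obtain ⟨D, h1, h2⟩ := h
  obtain ⟨D', h1', h2'⟩ := h'
  refine ⟨D + D', h1.add h1', fun δ => ?_⟩
  filter_upwards [h2 δ, h2' δ, Lp.coeFn_add (D δ) (D' δ)] with t h3 h4 h5
  rw [add_apply, h5, Pi.add_apply, h3, h4]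

lemma const_add (h : HasLinftyDerivAt Φ φ x) (c : Lp E ⊤ μ) :
    HasLinftyDerivAt (fun y => c + Φ y) φ x := by
  obtain ⟨D, h1, h2⟩ := h
  exact ⟨D, h1.const_add c, h2⟩

/-- The product rule for pointwise bilinear products. -/
lemma bilin (h : HasLinftyDerivAt Φ φ x) (h' : HasLinftyDerivAt Θ θ x)
    (B : E →L[ℝ] F →L[ℝ] G) :
    HasLinftyDerivAt (fun y => B.holder ⊤ (Φ y) (Θ y))
      (fun δ t => B (φ δ t) (Θ x t) + B (Φ x t) (θ δ t)) x := by
  obtain ⟨D, h1, h2⟩ := h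
  obtain ⟨D', h1', h2'⟩ := h'
  refine ⟨_, (B.holderL μ ⊤ ⊤ ⊤).hasFDerivAt_of_bilinear h1 h1', fun δ => ?_⟩
  have e : ((B.holderL μ ⊤ ⊤ ⊤).precompR X (Φ x) D' + (B.holderL μ ⊤ ⊤ ⊤).precompL X D (Θ x)) δ
      = B.holder ⊤ (Φ x) (D' δ) + B.holder ⊤ (D δ) (Θ x) := rfl
  rw [e]
  filter_upwards [h2 δ, h2' δ, Lp.coeFn_add (B.holder ⊤ (Φ x) (D' δ)) (B.holder ⊤ (D δ) (Θ x)),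
    B.coeFn_holder (r := ⊤) (Φ x) (D' δ), B.coeFn_holder (r := ⊤) (D δ) (Θ x)] with t h3 h4 h5 h6 h7
  rw [h5, Pi.add_apply, h6, h7, h3, h4, add_comm]

lemma nemytskii [FiniteDimensional ℝ E] {h : α → E → F} (hh : IsNemytskii μ h)
    (hΦ : HasLinftyDerivAt Φ φ x) :
    HasLinftyDerivAt (fun y => hh.op (Φ y)) (fun δ t => fderiv ℝ (h t) (Φ x t) (φ δ t)) x := by
  obtain ⟨D, h1, h2⟩ := hΦ
  refine ⟨(hh.opDeriv (Φ x)).comp D, (hh.hasFDerivAt_op (Φ x)).comp x h1, fun δ => ?_⟩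
  filter_upwards [h2 δ, hh.coeFn_opDeriv (Φ x) (D δ)] with t h3 h4
  rw [ContinuousLinearMap.comp_apply, h4, h3]

end HasLinftyDerivAt

lemma ContDiff.compLpL {Φ : X → Lp E ⊤ μ} (h : ContDiff ℝ 1 Φ) (L : E →L[ℝ] F) :
    ContDiff ℝ 1 (fun y => L.compLpL ⊤ μ (Φ y)) := (L.compLpL ⊤ μ).contDiff.comp h

lemma ContDiff.holder_top {Φ : X → Lp E ⊤ μ} {Θ : X → Lp F ⊤ μ} (h : ContDiff ℝ 1 Φ)
    (h' : ContDiff ℝ 1 Θ) (B : E →L[ℝ] F →L[ℝ] G) :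
    ContDiff ℝ 1 (fun y => B.holder ⊤ (Φ y) (Θ y)) :=
  ((B.holderL μ ⊤ ⊤ ⊤).contDiff.comp h).clm_apply h'

end LinftyDeriv

/-! ### The implicit function theorem over an incomplete parameter space -/

section Implicit

variable {Z X V : Type*} [NormedAddCommGroup Z] [NormedSpace ℝ Z] [CompleteSpace Z]
  [NormedAddCommGroup X] [NormedSpace ℝ X] [NormedAddCommGroup V] [NormedSpace ℝ V]

/-- A Lipschitz solution of `Ψ(ζ(g), g) = 0` is differentiable where the derivative of `Ψ` in `z` is
invertible. -/
lemma hasFDerivAt_implicit {Ψ : Z × X → V} {ζ : X → Z} {g₀ : X} {A : Z × X →L[ℝ] V}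
    (hA : HasFDerivAt Ψ A (ζ g₀, g₀)) (e : Z ≃L[ℝ] V)
    (he : A.comp (ContinuousLinearMap.inl ℝ Z X) = e) {C : ℝ}
    (hlip : ∀ᶠ g in 𝓝 g₀, ‖ζ g - ζ g₀‖ ≤ C * ‖g - g₀‖) (hz : ∀ᶠ g in 𝓝 g₀, Ψ (ζ g, g) = 0) :
    HasFDerivAt ζ (-((e.symm : V →L[ℝ] Z).comp (A.comp (ContinuousLinearMap.inr ℝ Z X)))) g₀ := by
  have hcont : Tendsto (fun g => (ζ g, g)) (𝓝 g₀) (𝓝 (ζ g₀, g₀)) := by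
    refine Tendsto.prodMk_nhds ?_ tendsto_id
    rw [tendsto_iff_norm_sub_tendsto_zero]
    have hl : Tendsto (fun g => C * ‖g - g₀‖) (𝓝 g₀) (𝓝 0) := by
      have : Continuous fun g => C * ‖g - g₀‖ := by fun_prop
      simpa using this.tendsto g₀
    exact squeeze_zero' (Eventually.of_forall fun _ => norm_nonneg _) hlip hl
  have h1 := hA.isLittleO.comp_tendsto hcont
  have h2 : (fun g => ((ζ g, g) : Z × X) - (ζ g₀, g₀)) =O[𝓝 g₀] fun g => g - g₀ := by
    refine Asymptotics.IsBigO.of_bound (max C 1) ?_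
    filter_upwards [hlip] with g hg
    rw [Prod.mk_sub_mk, Prod.norm_mk]
    refine max_le (hg.trans ?_) ?_
    · gcongr; exact le_max_left _ _
    · exact le_mul_of_one_le_left (norm_nonneg _) (le_max_right _ _)
  have h3 := ((e.symm : V →L[ℝ] Z).isBigO_comp _ _).trans_isLittleO (h1.trans_isBigO h2)
  refine HasFDerivAt.of_isLittleO ?_
  refine (h3.neg_left).congr' ?_ (EventuallyEq.refl _ _)
  filter_upwards [hz] with g hg
  have hs : A (ζ g - ζ g₀, g - g₀) = e (ζ g - ζ g₀) + A (0, g - g₀) := by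
    rw [← ContinuousLinearEquiv.coe_coe, ← he, ContinuousLinearMap.comp_apply, ← map_add]
    simp
  simp only [Function.comp_apply, hg, hz.self_of_nhds, Prod.mk_sub_mk, hs]
  simp

/-- The implicit function theorem for a continuously differentiable equation `Ψ(z, g) = 0` with
invertible derivative in `z`. Only the space of the unknown `z` has to be complete, since the
solution is the fixed point of a contraction in `z` for each fixed `g`. -/
theorem exists_implicit_function {Ψ : Z × X → V} (hΨ : ContDiff ℝ 1 Ψ) {z₁ : Z} {g₁ : X}
    (h0 : Ψ (z₁, g₁) = 0) (e : Z ≃L[ℝ] V)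
    (he : (fderiv ℝ Ψ (z₁, g₁)).comp (ContinuousLinearMap.inl ℝ Z X) = e) :
    ∃ Ng : Set X, IsOpen Ng ∧ g₁ ∈ Ng ∧ ∃ r > 0, ∃ ζ : X → Z,
      MapsTo ζ Ng (Metric.closedBall z₁ r) ∧ ContDiffOn ℝ 1 ζ Ng ∧ ζ g₁ = z₁ ∧
      (∀ g ∈ Ng, Ψ (ζ g, g) = 0) ∧
      (∀ g ∈ Ng, ∀ z ∈ Metric.closedBall z₁ r, Ψ (z, g) = 0 → z = ζ g) ∧
      HasFDerivAt ζ (-((e.symm : V →L[ℝ] Z).comp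
        ((fderiv ℝ Ψ (z₁, g₁)).comp (ContinuousLinearMap.inr ℝ Z X)))) g₁ := by
  set A := fderiv ℝ Ψ (z₁, g₁) with hA
  set N : ℝ := ‖(e.symm : V →L[ℝ] Z)‖ + 1 with hN
  have hNp : 0 < N := by positivity
  have hsymm : ∀ v, ‖e.symm v‖ ≤ N * ‖v‖ := fun v =>
    ((e.symm : V →L[ℝ] Z).le_opNorm v).trans (by gcongr; linarith)
  have hstrict : HasStrictFDerivAt Ψ A (z₁, g₁) :=
    hΨ.contDiffAt.hasStrictFDerivAt one_ne_zero
  obtain ⟨s, hs, happ⟩ := hstrict.approximates_deriv_on_nhds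
    (c := (1 / (2 * N)).toNNReal)
    (Or.inr (Real.toNNReal_pos.2 (by positivity)))
  have hcd : Continuous (fderiv ℝ Ψ) := hΨ.continuous_fderiv one_ne_zero
  have hinv : ∀ᶠ p in 𝓝 (z₁, g₁),
      ((fderiv ℝ Ψ p).comp (ContinuousLinearMap.inl ℝ Z X)).IsInvertible := by
    have hc : Continuous fun p => (fderiv ℝ Ψ p).comp (ContinuousLinearMap.inl ℝ Z X) :=
      hcd.clm_comp continuous_const
    have h1 := e.nhds
    rw [← he] at h1
    filter_upwards [hc.continuousAt.preimage_mem_nhds h1] with p hp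
    obtain ⟨e', he'⟩ := hp
    exact ⟨e', he'⟩
  obtain ⟨r, hr, hball⟩ := Metric.nhds_basis_closedBall.mem_iff.1 (Filter.inter_mem hs hinv)
  rw [← closedBall_prod_same] at hball
  have est : ∀ z ∈ Metric.closedBall z₁ r, ∀ z' ∈ Metric.closedBall z₁ r,
      ∀ g ∈ Metric.closedBall g₁ r, ∀ g' ∈ Metric.closedBall g₁ r,
      ‖Ψ (z, g) - Ψ (z', g') - A (z - z', g - g')‖ ≤ 1 / (2 * N) * (‖z - z'‖ + ‖g - g'‖) := by
    intro z hz z' hz' g hg g' hg'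
    refine (happ (z, g) (hball ⟨hz, hg⟩).1 (z', g') (hball ⟨hz', hg'⟩).1).trans ?_
    rw [Real.coe_toNNReal _ (by positivity)]
    gcongr
    rw [Prod.mk_sub_mk, Prod.norm_mk]
    exact max_le_add_of_nonneg (norm_nonneg _) (norm_nonneg _)
  have hAe : ∀ z : Z, A (z, 0) = e z := fun z => by
    rw [← ContinuousLinearEquiv.coe_coe, ← he]; simp
  have hAs : ∀ (z : Z) (g : X), A (z, g) = e z + A (0, g) := fun z g => by
    rw [← hAe, ← map_add]; simp
  -- parameters for which the contraction maps the ball into itself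
  set Ng : Set X := Metric.ball g₁ r ∩ {g | N * ‖Ψ (z₁, g)‖ < r / 2} with hNg
  have hNgo : IsOpen Ng := by
    refine Metric.isOpen_ball.inter (isOpen_lt ?_ continuous_const)
    have := hΨ.continuous
    fun_prop
  have hg₁ : g₁ ∈ Ng := ⟨Metric.mem_ball_self hr, by simp [h0, hr]⟩
  have hNgb : ∀ g ∈ Ng, g ∈ Metric.closedBall g₁ r := fun g hg => Metric.ball_subset_closedBall hg.1
  have contr : ∀ g ∈ Ng, ∀ z ∈ Metric.closedBall z₁ r, ∀ z' ∈ Metric.closedBall z₁ r,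
      ‖(z - e.symm (Ψ (z, g))) - (z' - e.symm (Ψ (z', g)))‖ ≤ 1 / 2 * ‖z - z'‖ := by
    intro g hg z hz z' hz'
    have h1 := est z hz z' hz' g (hNgb g hg) g (hNgb g hg)
    rw [sub_self, norm_zero, add_zero, hAe] at h1
    have h2 : (z - e.symm (Ψ (z, g))) - (z' - e.symm (Ψ (z', g)))
        = -e.symm (Ψ (z, g) - Ψ (z', g) - e (z - z')) := by
      simp only [map_sub, ContinuousLinearEquiv.symm_apply_apply]; abel
    rw [h2, norm_neg]
    refine (hsymm _).trans ((mul_le_mul_of_nonneg_left h1 hNp.le).trans_eq ?_)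
    field_simp
  have uniq : ∀ g ∈ Ng, ∀ z ∈ Metric.closedBall z₁ r, ∀ z' ∈ Metric.closedBall z₁ r,
      Ψ (z, g) = 0 → Ψ (z', g) = 0 → z = z' := by
    intro g hg z hz z' hz' h1 h2
    have h3 := contr g hg z hz z' hz'
    rw [h1, h2, map_zero, sub_zero, sub_zero] at h3
    have h4 : ‖z - z'‖ = 0 := by linarith [norm_nonneg (z - z')]
    exact sub_eq_zero.1 (norm_eq_zero.1 h4)
  have exi : ∀ g ∈ Ng, ∃ z ∈ Metric.closedBall z₁ r, Ψ (z, g) = 0 := by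
    intro g hg
    have hmem : z₁ ∈ Metric.closedBall z₁ r := Metric.mem_closedBall_self hr.le
    have hmaps : MapsTo (fun z => z - e.symm (Ψ (z, g))) (Metric.closedBall z₁ r)
        (Metric.closedBall z₁ r) := by
      intro z hz
      have h1 := contr g hg z hz z₁ hmem
      have h2 : ‖e.symm (Ψ (z₁, g))‖ ≤ r / 2 := (hsymm _).trans hg.2.le
      rw [mem_closedBall_iff_norm] at hz ⊢
      have h3 := norm_sub_le ((z - e.symm (Ψ (z, g))) - (z₁ - e.symm (Ψ (z₁, g))))
        (e.symm (Ψ (z₁, g)))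
      rw [show (z - e.symm (Ψ (z, g))) - (z₁ - e.symm (Ψ (z₁, g))) - e.symm (Ψ (z₁, g))
        = z - e.symm (Ψ (z, g)) - z₁ by abel] at h3
      linarith
    have hcon : ContractingWith (1 / 2) (hmaps.restrict _ _ _) := by
      refine ⟨by rw [← NNReal.coe_lt_coe]; norm_num, LipschitzWith.of_dist_le_mul fun x y => ?_⟩
      rw [Subtype.dist_eq, Subtype.dist_eq, dist_eq_norm, dist_eq_norm]
      simpa using contr g hg x x.2 y y.2
    obtain ⟨z, hz, hfix, -⟩ := hcon.exists_fixedPoint' Metric.isClosed_closedBall.isComplete hmaps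
      hmem (edist_ne_top _ _)
    refine ⟨z, hz, ?_⟩
    have h4 : e.symm (Ψ (z, g)) = 0 := by
      have : z - e.symm (Ψ (z, g)) = z := hfix
      simpa using this
    simpa using h4
  choose! ζ hζ hζ0 using exi
  have hζ1 : ζ g₁ = z₁ := uniq g₁ hg₁ _ (hζ g₁ hg₁) _ (Metric.mem_closedBall_self hr.le)
    (hζ0 g₁ hg₁) h0
  have lip : ∀ g ∈ Ng, ∀ g' ∈ Ng, ‖ζ g - ζ g'‖ ≤ (1 + 2 * N * ‖A‖) * ‖g - g'‖ := by
    intro g hg g' hg'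
    have h1 := est _ (hζ g hg) _ (hζ g' hg') g (hNgb g hg) g' (hNgb g' hg')
    rw [hζ0 g hg, hζ0 g' hg', sub_zero, zero_sub, norm_neg, hAs] at h1
    have h2 : ‖A (0, g - g')‖ ≤ ‖A‖ * ‖g - g'‖ := by
      refine (A.le_opNorm _).trans_eq ?_
      simp
    have h3 : ‖ζ g - ζ g'‖ ≤ N * ‖e (ζ g - ζ g')‖ := by
      simpa using hsymm (e (ζ g - ζ g'))
    have h4 := norm_sub_le (e (ζ g - ζ g') + A (0, g - g')) (A (0, g - g'))
    rw [add_sub_cancel_right] at h4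
    have h5 : N * ‖e (ζ g - ζ g')‖ ≤ N * (1 / (2 * N) * (‖ζ g - ζ g'‖ + ‖g - g'‖)
        + ‖A‖ * ‖g - g'‖) := by
      gcongr; linarith
    have h6 : N * (1 / (2 * N) * (‖ζ g - ζ g'‖ + ‖g - g'‖) + ‖A‖ * ‖g - g'‖)
        = 1 / 2 * (‖ζ g - ζ g'‖ + ‖g - g'‖) + N * ‖A‖ * ‖g - g'‖ := by
      field_simp
    nlinarith
  have hder : ∀ g ∈ Ng, ∀ e' : Z ≃L[ℝ] V,
      (fderiv ℝ Ψ (ζ g, g)).comp (ContinuousLinearMap.inl ℝ Z X) = e' →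
      HasFDerivAt ζ (-((e'.symm : V →L[ℝ] Z).comp
        ((fderiv ℝ Ψ (ζ g, g)).comp (ContinuousLinearMap.inr ℝ Z X)))) g := by
    intro g hg e' he'
    refine hasFDerivAt_implicit ((hΨ.differentiable one_ne_zero) _).hasFDerivAt e' he'
      (C := 1 + 2 * N * ‖A‖) ?_ ?_
    · filter_upwards [hNgo.mem_nhds hg] with g' hg' using lip g' hg' g hg
    · filter_upwards [hNgo.mem_nhds hg] with g' hg' using hζ0 g' hg'
  have hinv' : ∀ g ∈ Ng,
      ((fderiv ℝ Ψ (ζ g, g)).comp (ContinuousLinearMap.inl ℝ Z X)).IsInvertible :=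
    fun g hg => (hball ⟨hζ g hg, hNgb g hg⟩).2
  refine ⟨Ng, hNgo, hg₁, r, hr, ζ, hζ, ?_, hζ1, hζ0,
    fun g hg z hz h => uniq g hg z hz _ (hζ g hg) h (hζ0 g hg), ?_⟩
  · have hdiff : DifferentiableOn ℝ ζ Ng := by
      intro g hg
      obtain ⟨e', he'⟩ := hinv' g hg
      exact (hder g hg e' he'.symm).differentiableAt.differentiableWithinAt
    have hfd : ∀ g ∈ Ng, fderiv ℝ ζ g
        = -(((fderiv ℝ Ψ (ζ g, g)).comp (ContinuousLinearMap.inl ℝ Z X)).inverse.comp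
          ((fderiv ℝ Ψ (ζ g, g)).comp (ContinuousLinearMap.inr ℝ Z X))) := by
      intro g hg
      obtain ⟨e', he'⟩ := hinv' g hg
      rw [(hder g hg e' he'.symm).fderiv, ← he', ContinuousLinearMap.inverse_equiv]
    rw [show (1 : WithTop ℕ∞) = 0 + 1 by simp, contDiffOn_succ_iff_fderiv_of_isOpen hNgo]
    refine ⟨hdiff, by simp, ?_⟩
    rw [contDiffOn_zero]
    refine ContinuousOn.congr ?_ hfd
    intro g hg
    have hc : ContinuousWithinAt (fun g => fderiv ℝ Ψ (ζ g, g)) Ng g :=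
      hcd.continuousAt.comp_continuousWithinAt
        ((hdiff.continuousOn g hg).prodMk continuousWithinAt_id)
    have hi : ContinuousAt ContinuousLinearMap.inverse
        ((fderiv ℝ Ψ (ζ g, g)).comp (ContinuousLinearMap.inl ℝ Z X)) := by
      obtain ⟨e', he'⟩ := hinv' g hg
      rw [← he']
      exact (contDiffAt_map_inverse (n := 0) e').continuousAt
    have h8 : ContinuousWithinAt (fun g => ((fderiv ℝ Ψ (ζ g, g)).comp
        (ContinuousLinearMap.inl ℝ Z X)).inverse) Ng g :=
      ContinuousAt.comp_continuousWithinAt (f := fun g => (fderiv ℝ Ψ (ζ g, g)).comp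
        (ContinuousLinearMap.inl ℝ Z X)) hi (hc.clm_comp continuousWithinAt_const)
    exact (h8.clm_comp (hc.clm_comp continuousWithinAt_const)).neg
  · have h7 := hder g₁ hg₁ e
    rw [hζ1] at h7
    exact h7 he

end Implicit

/-! ### Evaluation of model functions along trajectories -/

section Evaluation

variable {α : Type*} [MeasurableSpace α] {μ : Measure α} {𝒢 W F : Type*}
  [NormedAddCommGroup 𝒢] [NormedSpace ℝ 𝒢]
  [NormedAddCommGroup W] [NormedSpace ℝ W] [FiniteDimensional ℝ W]
  [NormedAddCommGroup F] [NormedSpace ℝ F]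

/-- A normed space `𝒢` whose elements are realized, linearly up to null sets of `t`, by functions
`ρ g : α → W → F` with values, derivatives and Lipschitz constants of derivatives bounded by the
norm of `g`. -/
structure IsRealization (μ : Measure α) (ρ : 𝒢 → α → W → F) : Prop where
  measurable : ∀ g w, AEStronglyMeasurable (fun t => ρ g t w) μ
  contDiff : ∀ g, ∀ᵐ t ∂μ, ContDiff ℝ 1 (ρ g t)
  bound : ∀ g, ∀ᵐ t ∂μ, ∀ w, ‖ρ g t w‖ ≤ ‖g‖
  bound_fderiv : ∀ g, ∀ᵐ t ∂μ, ∀ w, ‖fderiv ℝ (ρ g t) w‖ ≤ ‖g‖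
  lipschitz_fderiv : ∀ g, ∀ᵐ t ∂μ, ∀ w v,
    ‖fderiv ℝ (ρ g t) w - fderiv ℝ (ρ g t) v‖ ≤ ‖g‖ * ‖w - v‖
  map_add : ∀ g g', ∀ᵐ t ∂μ, ∀ w, ρ (g + g') t w = ρ g t w + ρ g' t w
  map_smul : ∀ (c : ℝ) g, ∀ᵐ t ∂μ, ∀ w, ρ (c • g) t w = c • ρ g t w

namespace IsRealization

variable {ρ : 𝒢 → α → W → F} (hρ : IsRealization μ ρ)
include hρ

lemma memLp (w : Lp W ⊤ μ) (g : 𝒢) : MemLp (fun t => ρ g t (w t)) ⊤ μ := by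
  refine memLp_top_of_bound (AEStronglyMeasurable.caratheodory (hρ.measurable g) ?_
    (Lp.aestronglyMeasurable w)) ‖g‖ ?_
  · filter_upwards [hρ.contDiff g] with t ht using ht.continuous
  · filter_upwards [hρ.bound g] with t ht using ht _

lemma memLp_fderiv (w : Lp W ⊤ μ) (g : 𝒢) : MemLp (fun t => fderiv ℝ (ρ g t) (w t)) ⊤ μ := by
  refine memLp_top_of_bound (AEStronglyMeasurable.caratheodory
    (aestronglyMeasurable_fderiv (hρ.measurable g) (hρ.contDiff g)) ?_
    (Lp.aestronglyMeasurable w)) ‖g‖ ?_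
  · filter_upwards [hρ.contDiff g] with t ht using ht.continuous_fderiv one_ne_zero
  · filter_upwards [hρ.bound_fderiv g] with t ht using ht _

/-- The map `(w, g) ↦ g(·, w(·))`. -/
def op (x : Lp W ⊤ μ × 𝒢) : Lp F ⊤ μ := (hρ.memLp x.1 x.2).toLp

lemma coeFn_op (x : Lp W ⊤ μ × 𝒢) : hρ.op x =ᵐ[μ] fun t => ρ x.2 t (x.1 t) :=
  (hρ.memLp x.1 x.2).coeFn_toLp

/-- Evaluation along `w`, which is linear in `g`. -/
def evalL (w : Lp W ⊤ μ) : 𝒢 →L[ℝ] Lp F ⊤ μ :=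
  linftyMk (fun g t => ρ g t (w t)) (hρ.memLp w)
    (fun g g' => by filter_upwards [hρ.map_add g g'] with t ht using ht _)
    (fun c g => by filter_upwards [hρ.map_smul c g] with t ht using ht _) 1 zero_le_one
    (fun g => by filter_upwards [hρ.bound g] with t ht using by rw [one_mul]; exact ht _)

lemma coeFn_evalL (w : Lp W ⊤ μ) (g : 𝒢) : hρ.evalL w g =ᵐ[μ] fun t => ρ g t (w t) :=
  (hρ.memLp w g).coeFn_toLp

/-- The derivative of `(w, g) ↦ g(·, w(·))`, namely `(δw, δg) ↦ g_w(·, w) δw + δg(·, w)`. -/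
def opDeriv (x : Lp W ⊤ μ × 𝒢) : Lp W ⊤ μ × 𝒢 →L[ℝ] Lp F ⊤ μ :=
  ((ContinuousLinearMap.id ℝ (W →L[ℝ] F)).holderL μ ⊤ ⊤ ⊤ (hρ.memLp_fderiv x.1 x.2).toLp).coprod
    (hρ.evalL x.1)

lemma coeFn_opDeriv (x δ : Lp W ⊤ μ × 𝒢) :
    hρ.opDeriv x δ =ᵐ[μ] fun t => fderiv ℝ (ρ x.2 t) (x.1 t) (δ.1 t) + ρ δ.2 t (x.1 t) := by
  have e : hρ.opDeriv x δ = (ContinuousLinearMap.id ℝ (W →L[ℝ] F)).holder ⊤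
    (hρ.memLp_fderiv x.1 x.2).toLp δ.1 + hρ.evalL x.1 δ.2 := rfl
  rw [e]
  filter_upwards [(ContinuousLinearMap.id ℝ (W →L[ℝ] F)).coeFn_holder (r := ⊤)
    (hρ.memLp_fderiv x.1 x.2).toLp δ.1, (hρ.memLp_fderiv x.1 x.2).coeFn_toLp,
    Lp.coeFn_add ((ContinuousLinearMap.id ℝ (W →L[ℝ] F)).holder ⊤
    (hρ.memLp_fderiv x.1 x.2).toLp δ.1) (hρ.evalL x.1 δ.2),
    hρ.coeFn_evalL x.1 δ.2] with t h1 h2 h3 h4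
  rw [h3, Pi.add_apply, h1, h2, h4]; rfl

lemma quadratic (R : ℝ) : ∃ C : ℝ, ∀ x y : Lp W ⊤ μ × 𝒢, ‖x‖ ≤ R → ‖y‖ ≤ R →
    ‖hρ.op y - hρ.op x - hρ.opDeriv x (y - x)‖ ≤ C * ‖y - x‖ ^ 2 := by
  refine ⟨R + 1, fun x y hx _ => ?_⟩
  have hR : 0 ≤ R := (norm_nonneg _).trans hx
  refine Lp.norm_top_le (by positivity) ?_
  filter_upwards [hρ.contDiff x.2, hρ.contDiff (y.2 - x.2), hρ.lipschitz_fderiv x.2,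
    hρ.bound_fderiv (y.2 - x.2), hρ.map_add x.2 (y.2 - x.2), hρ.coeFn_op x, hρ.coeFn_op y,
    hρ.coeFn_opDeriv x (y - x), Lp.coeFn_sub (hρ.op y - hρ.op x) (hρ.opDeriv x (y - x)),
    Lp.coeFn_sub (hρ.op y) (hρ.op x), Lp.coeFn_sub y.1 x.1, Lp.ae_norm_le_norm_top (y.1 - x.1)]
    with t h1 h2 h3 h4 h5 h6 h7 h8 h9 h10 h11 h12
  rw [add_sub_cancel] at h5
  rw [h9, Pi.sub_apply, h10, Pi.sub_apply, h6, h7, h8, h5]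
  simp only [Prod.fst_sub, Prod.snd_sub]
  rw [h11, Pi.sub_apply] at h12 ⊢
  have a := norm_sub_sub_fderiv_le (h1.differentiable one_ne_zero) convex_univ (norm_nonneg x.2)
    (fun v _ w _ => h3 v w) (mem_univ (x.1 t)) (mem_univ (y.1 t))
  have b := convex_univ.norm_image_sub_le_of_norm_fderiv_le (𝕜 := ℝ)
    (fun v _ => h2.differentiable one_ne_zero v)
    (fun v _ => h4 v) (mem_univ (x.1 t)) (mem_univ (y.1 t))
  have n1 : ‖y.1 t - x.1 t‖ ≤ ‖y - x‖ := h12.trans (norm_fst_le (y - x))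
  have n2 : ‖y.2 - x.2‖ ≤ ‖y - x‖ := norm_snd_le (y - x)
  have n3 : ‖x.2‖ ≤ R := (norm_snd_le x).trans hx
  have e : ρ x.2 t (y.1 t) + ρ (y.2 - x.2) t (y.1 t) - ρ x.2 t (x.1 t)
      - (fderiv ℝ (ρ x.2 t) (x.1 t) (y.1 t - x.1 t) + ρ (y.2 - x.2) t (x.1 t))
      = (ρ x.2 t (y.1 t) - ρ x.2 t (x.1 t) - fderiv ℝ (ρ x.2 t) (x.1 t) (y.1 t - x.1 t))
        + (ρ (y.2 - x.2) t (y.1 t) - ρ (y.2 - x.2) t (x.1 t)) := by abel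
  rw [e]
  refine (norm_add_le _ _).trans ?_
  have a' : ‖x.2‖ * ‖y.1 t - x.1 t‖ ^ 2 ≤ R * ‖y - x‖ ^ 2 := by gcongr
  have b' : ‖y.2 - x.2‖ * ‖y.1 t - x.1 t‖ ≤ ‖y - x‖ * ‖y - x‖ := by gcongr
  nlinarith

lemma contDiff_op : ContDiff ℝ 1 hρ.op := contDiff_one_of_quadratic hρ.quadratic

lemma contDiff_op_clm {X : Type*} [NormedAddCommGroup X] [NormedSpace ℝ X]
    (L : X →L[ℝ] Lp W ⊤ μ) (M : X →L[ℝ] 𝒢) : ContDiff ℝ 1 (fun y => hρ.op (L y, M y)) :=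
  hρ.contDiff_op.comp (L.prod M).contDiff

lemma hasLinftyDerivAt {X : Type*} [NormedAddCommGroup X] [NormedSpace ℝ X]
    (L : X →L[ℝ] Lp W ⊤ μ) (M : X →L[ℝ] 𝒢) (x : X) :
    HasLinftyDerivAt (fun y => hρ.op (L y, M y))
      (fun δ t => fderiv ℝ (ρ (M x) t) (L x t) (L δ t) + ρ (M δ) t (L x t)) x :=
  ⟨(hρ.opDeriv (L x, M x)).comp (L.prod M),
    HasFDerivAt.comp (g := hρ.op) (f := fun y => (L y, M y)) x
      (hasFDerivAt_of_quadratic hρ.quadratic (L x, M x)) (L.prod M).hasFDerivAt,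
    fun δ => hρ.coeFn_opDeriv (L x, M x) (L δ, M δ)⟩

end IsRealization

end Evaluation

namespace ModelSpace

variable {E F : Type*} [NormedAddCommGroup E] [NormedSpace ℝ E]
  [NormedAddCommGroup F] [NormedSpace ℝ F] {μ : Measure ℝ} {s : ℕ}

/-- The chosen representative as an element of the seminormed space of model functions. -/
abbrev repFun (g : ModelSpace E F μ s) : ModelFun E F μ s :=
  Function.surjInv SeparationQuotient.surjective_mk g

lemma mk_repFun (g : ModelSpace E F μ s) : SeparationQuotient.mk g.repFun = g :=
  Function.surjInv_eq _ g

lemma contDiff_rep (g : ModelSpace E F μ s) : ∀ᵐ t ∂μ, ContDiff ℝ s (g.rep t) := g.repFun.2.1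

lemma measurable_rep (g : ModelSpace E F μ s) (y : E) :
    AEStronglyMeasurable (fun t => g.rep t y) μ := g.repFun.2.2.1 y

lemma _root_.ModelFun.norm_iteratedFDeriv_le (g : ModelFun E F μ s) :
    ∀ᵐ t ∂μ, ∀ k ≤ s, ∀ y, ‖iteratedFDeriv ℝ k (g.1 t) y‖ ≤ ‖g‖ := by
  rw [ae_all_iff]
  intro k
  rw [eventually_imp_distrib_left]
  intro hk
  have hfin := g.2.2.2
  filter_upwards [ENNReal.ae_le_essSup (μ := μ)
    (fun t => ⨆ y, ‖iteratedFDeriv ℝ k (g.1 t) y‖ₑ)] with t ht y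
  have h1 : ‖iteratedFDeriv ℝ k (g.1 t) y‖ₑ ≤ modelENorm μ s g.1 :=
    ((le_iSup (fun y => ‖iteratedFDeriv ℝ k (g.1 t) y‖ₑ) y).trans ht).trans
      (Finset.single_le_sum (f := fun k => essSup (fun t => ⨆ y, ‖iteratedFDeriv ℝ k (g.1 t) y‖ₑ) μ)
        (fun _ _ => zero_le) (Finset.mem_range.2 (Nat.lt_succ_of_le hk)))
  rw [← toReal_enorm]
  exact ENNReal.toReal_mono hfin.ne h1

lemma norm_iteratedFDeriv_rep_le (g : ModelSpace E F μ s) :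
    ∀ᵐ t ∂μ, ∀ k ≤ s, ∀ y, ‖iteratedFDeriv ℝ k (g.rep t) y‖ ≤ ‖g‖ := by
  have h := g.repFun.norm_iteratedFDeriv_le
  have e : ‖g.repFun‖ = ‖g‖ := by
    conv_rhs => rw [← mk_repFun g]
    exact (SeparationQuotient.norm_mk _).symm
  rwa [e] at h

/-- Model functions with the same class agree for a.a. `t` at every `y`. -/
lemma ae_eq_of_mk_eq {a b : ModelFun E F μ s}
    (h : (SeparationQuotient.mk a : ModelSpace E F μ s) = SeparationQuotient.mk b) :
    ∀ᵐ t ∂μ, ∀ y, a.1 t y = b.1 t y := by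
  have h0 : ‖a - b‖ = 0 := by
    have := SeparationQuotient.mk_eq_mk.1 h
    rw [Metric.inseparable_iff, dist_eq_norm] at this
    exact this
  filter_upwards [(a - b).norm_iteratedFDeriv_le] with t ht y
  have h1 := ht 0 (Nat.zero_le _) y
  rw [h0, norm_iteratedFDeriv_zero] at h1
  have h2 : (a - b).1 t y = a.1 t y - b.1 t y := rfl
  rw [h2] at h1
  exact sub_eq_zero.1 (norm_eq_zero.1 (le_antisymm h1 (norm_nonneg _)))

lemma rep_add (g g' : ModelSpace E F μ s) :
    ∀ᵐ t ∂μ, ∀ y, (g + g').rep t y = g.rep t y + g'.rep t y :=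
  ae_eq_of_mk_eq (a := (g + g').repFun) (b := g.repFun + g'.repFun) (by
    rw [mk_repFun, SeparationQuotient.mk_add, mk_repFun, mk_repFun])

lemma rep_smul (c : ℝ) (g : ModelSpace E F μ s) :
    ∀ᵐ t ∂μ, ∀ y, (c • g).rep t y = c • g.rep t y :=
  ae_eq_of_mk_eq (a := (c • g).repFun) (b := c • g.repFun) (by
    rw [mk_repFun, SeparationQuotient.mk_smul, mk_repFun])

lemma norm_fderiv_le_of_iteratedFDeriv {f : E → F} {C : ℝ}
    (h : ∀ y, ‖iteratedFDeriv ℝ 1 f y‖ ≤ C) (y : E) : ‖fderiv ℝ f y‖ ≤ C := by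
  rw [← norm_iteratedFDeriv_one]; exact h y

lemma lipschitz_fderiv_of_iteratedFDeriv {f : E → F} {C : ℝ} (hf : ContDiff ℝ 2 f)
    (h : ∀ y, ‖iteratedFDeriv ℝ 2 f y‖ ≤ C) (y y' : E) :
    ‖fderiv ℝ f y - fderiv ℝ f y'‖ ≤ C * ‖y - y'‖ := by
  have h1 : ContDiff ℝ 1 (fderiv ℝ f) := hf.fderiv_right (by norm_num)
  refine convex_univ.norm_image_sub_le_of_norm_fderiv_le (𝕜 := ℝ) (f := fderiv ℝ f)
    (fun v _ => h1.differentiable one_ne_zero v) (fun v _ => ?_) (mem_univ y') (mem_univ y)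
  rw [← norm_iteratedFDeriv_one, norm_iteratedFDeriv_fderiv]
  exact h v

variable [FiniteDimensional ℝ E]

lemma isRealization_rep (hs : 2 ≤ s) :
    IsRealization μ (fun (g : ModelSpace E F μ s) t y => g.rep t y) where
  measurable g y := g.measurable_rep y
  contDiff g := by
    filter_upwards [g.contDiff_rep] with t ht
    exact ht.of_le (by exact_mod_cast one_le_two.trans hs)
  bound g := by
    filter_upwards [g.norm_iteratedFDeriv_rep_le] with t ht y
    simpa using ht 0 (Nat.zero_le _) y
  bound_fderiv g := by
    filter_upwards [g.norm_iteratedFDeriv_rep_le] with t ht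
    exact norm_fderiv_le_of_iteratedFDeriv (ht 1 (one_le_two.trans hs))
  lipschitz_fderiv g := by
    filter_upwards [g.norm_iteratedFDeriv_rep_le, g.contDiff_rep] with t ht h2
    exact lipschitz_fderiv_of_iteratedFDeriv (h2.of_le (by exact_mod_cast hs)) (ht 2 hs)
  map_add := rep_add
  map_smul := rep_smul

lemma isRealization_fderiv_rep (hs : 3 ≤ s) :
    IsRealization μ (fun (g : ModelSpace E F μ s) t y => fderiv ℝ (g.rep t) y) where
  measurable g y := aestronglyMeasurable_fderiv g.measurable_rep (by
    filter_upwards [g.contDiff_rep] with t ht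
    exact ht.of_le (by exact_mod_cast (by omega : 1 ≤ s))) y
  contDiff g := by
    filter_upwards [g.contDiff_rep] with t ht
    exact ht.fderiv_right (m := 1) (by norm_cast; omega)
  bound g := by
    filter_upwards [g.norm_iteratedFDeriv_rep_le] with t ht
    exact norm_fderiv_le_of_iteratedFDeriv (ht 1 (by omega))
  bound_fderiv g := by
    filter_upwards [g.norm_iteratedFDeriv_rep_le] with t ht
    refine norm_fderiv_le_of_iteratedFDeriv fun y => ?_
    rw [norm_iteratedFDeriv_fderiv]
    exact ht 2 (by omega) y
  lipschitz_fderiv g := by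
    filter_upwards [g.norm_iteratedFDeriv_rep_le, g.contDiff_rep] with t ht h2
    refine lipschitz_fderiv_of_iteratedFDeriv (h2.fderiv_right (by norm_cast)) fun y => ?_
    rw [norm_iteratedFDeriv_fderiv]
    exact ht 3 hs y
  map_add g g' := by
    filter_upwards [rep_add g g', g.contDiff_rep, g'.contDiff_rep] with t ht h1 h2 y
    have e : (g + g').rep t = g.rep t + g'.rep t := funext ht
    have hs' : ((s : ℕ) : WithTop ℕ∞) ≠ 0 := by norm_cast; omega
    rw [e, fderiv_add (h1.differentiable hs' y) (h2.differentiable hs' y)]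
  map_smul c g := by
    filter_upwards [rep_smul c g, g.contDiff_rep] with t ht h1 y
    have e : (c • g).rep t = c • g.rep t := funext ht
    have hs' : ((s : ℕ) : WithTop ℕ∞) ≠ 0 := by norm_cast; omega
    rw [e, fderiv_const_smul (h1.differentiable hs' y)]

end ModelSpace

/-! ### Partial gradients and Hessian blocks -/

section PartialGradient

variable {A B W E : Type*}
  [NormedAddCommGroup A] [InnerProductSpace ℝ A] [CompleteSpace A]
  [NormedAddCommGroup B] [InnerProductSpace ℝ B]
  [NormedAddCommGroup W] [NormedSpace ℝ W] [NormedAddCommGroup E] [NormedSpace ℝ E]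

/-- The linear map taking a functional on `W` to the vector that represents its restriction along
`ι : A → W`. -/
def gradL (ι : A →L[ℝ] W) : (W →L[ℝ] ℝ) →L[ℝ] A :=
  LinearMap.mkContinuous
    { toFun := fun ℓ => (InnerProductSpace.toDual ℝ A).symm (ℓ.comp ι)
      map_add' := fun ℓ ℓ' => by rw [ContinuousLinearMap.add_comp, map_add]
      map_smul' := fun c ℓ => by
        rw [ContinuousLinearMap.smul_comp, LinearIsometryEquiv.map_smulₛₗ]; simp } ‖ι‖ (by
      intro ℓ
      simp only [LinearMap.coe_mk, AddHom.coe_mk, LinearIsometryEquiv.norm_map]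
      rw [mul_comm]
      exact ContinuousLinearMap.opNorm_comp_le _ _)

lemma inner_gradL (ι : A →L[ℝ] W) (ℓ : W →L[ℝ] ℝ) (a : A) : inner ℝ a (gradL ι ℓ) = ℓ (ι a) := by
  rw [real_inner_comm]
  exact InnerProductSpace.toDual_symm_apply

lemma inner_pGrad (ι : A →L[ℝ] W) (h : W → ℝ) (w : W) (a : A) :
    inner ℝ a (pGrad ι h w) = fderiv ℝ h w (ι a) := inner_gradL _ _ _

lemma pJac_apply (ι : A →L[ℝ] W) (h : W → E) (w : W) (a : A) :
    pJac ι h w a = fderiv ℝ h w (ι a) := rfl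

lemma ContDiff.differentiable_fderiv {h : W → E} (hh : ContDiff ℝ 2 h) :
    Differentiable ℝ (fderiv ℝ h) :=
  (hh.fderiv_right (m := 1) (by norm_num)).differentiable one_ne_zero

lemma pHess_apply (ι : A →L[ℝ] W) (κ : B →L[ℝ] W) {h : W → ℝ} (hh : ContDiff ℝ 2 h) (w : W)
    (b : B) : pHess ι κ h w b = gradL ι (fderiv ℝ (fderiv ℝ h) w (κ b)) := by
  have h1 : HasFDerivAt (pGrad ι h) ((gradL ι).comp (fderiv ℝ (fderiv ℝ h) w)) w :=
    (gradL ι).hasFDerivAt.comp w (hh.differentiable_fderiv w).hasFDerivAt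
  rw [pHess, h1.fderiv]; rfl

lemma inner_pHess (ι : A →L[ℝ] W) (κ : B →L[ℝ] W) {h : W → ℝ} (hh : ContDiff ℝ 2 h) (w : W)
    (a : A) (b : B) : inner ℝ a (pHess ι κ h w b) = fderiv ℝ (fderiv ℝ h) w (κ b) (ι a) := by
  rw [pHess_apply ι κ hh, inner_gradL]

lemma ContDiff.fderiv_fderiv_symm {h : W → E} (hh : ContDiff ℝ 2 h) (w v v' : W) :
    fderiv ℝ (fderiv ℝ h) w v v' = fderiv ℝ (fderiv ℝ h) w v' v :=
  (hh.contDiffAt.isSymmSndFDerivAt (by simp)) v v'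

variable {h : W → ℝ} {k : W → B} {b : B}

lemma fderiv_inner_const (hk : ContDiff ℝ 2 k) (v η : W) :
    fderiv ℝ (fun v => inner ℝ b (k v)) v η = inner ℝ b (fderiv ℝ k v η) := by
  have h1 : HasFDerivAt (fun v => inner ℝ b (k v)) ((innerSL ℝ b).comp (fderiv ℝ k v)) v :=
    (innerSL ℝ b).hasFDerivAt.comp v (hk.differentiable (by simp) v).hasFDerivAt
  rw [h1.fderiv]; rfl

lemma fderiv_fderiv_inner_const (hk : ContDiff ℝ 2 k) (v η η' : W) :
    fderiv ℝ (fderiv ℝ (fun v => inner ℝ b (k v))) v η η'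
      = inner ℝ b (fderiv ℝ (fderiv ℝ k) v η η') := by
  have e : fderiv ℝ (fun v => inner ℝ b (k v))
      = fun v => ContinuousLinearMap.compL ℝ W B ℝ (innerSL ℝ b) (fderiv ℝ k v) := by
    funext v
    ext1 η
    exact fderiv_inner_const hk v η
  have h1 : HasFDerivAt (fderiv ℝ (fun v => inner ℝ b (k v)))
      ((ContinuousLinearMap.compL ℝ W B ℝ (innerSL ℝ b)).comp (fderiv ℝ (fderiv ℝ k) v)) v := by
    rw [e]
    exact (ContinuousLinearMap.hasFDerivAt _).comp v (hk.differentiable_fderiv v).hasFDerivAt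
  rw [h1.fderiv]; rfl

lemma contDiff_add_inner (hh : ContDiff ℝ 2 h) (hk : ContDiff ℝ 2 k) :
    ContDiff ℝ 2 (fun v => h v + inner ℝ b (k v)) := hh.add (contDiff_const.inner ℝ hk)

lemma fderiv_add_inner (hh : ContDiff ℝ 2 h) (hk : ContDiff ℝ 2 k) (v η : W) :
    fderiv ℝ (fun v => h v + inner ℝ b (k v)) v η
      = fderiv ℝ h v η + inner ℝ b (fderiv ℝ k v η) := by
  have hk' : ContDiff ℝ 2 (fun v => inner ℝ b (k v)) := contDiff_const.inner ℝ hk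
  rw [fderiv_fun_add (hh.differentiable (by simp) v) (hk'.differentiable (by simp) v), add_apply,
    fderiv_inner_const hk]

lemma fderiv_fderiv_add_inner (hh : ContDiff ℝ 2 h) (hk : ContDiff ℝ 2 k) (v η η' : W) :
    fderiv ℝ (fderiv ℝ (fun v => h v + inner ℝ b (k v))) v η η'
      = fderiv ℝ (fderiv ℝ h) v η η' + inner ℝ b (fderiv ℝ (fderiv ℝ k) v η η') := by
  have hk' : ContDiff ℝ 2 (fun v => inner ℝ b (k v)) := contDiff_const.inner ℝ hk
  have e : fderiv ℝ (fun v => h v + inner ℝ b (k v))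
      = fun v => fderiv ℝ h v + fderiv ℝ (fun v => inner ℝ b (k v)) v := by
    funext v
    exact fderiv_fun_add (hh.differentiable (by simp) v) (hk'.differentiable (by simp) v)
  rw [e, fderiv_fun_add (hh.differentiable_fderiv v) (hk'.differentiable_fderiv v), add_apply,
    add_apply, fderiv_fderiv_inner_const hk]

end PartialGradient

/-! ### The Hessian of the Hamiltonian along a trajectory -/

namespace OCP

variable {nx nu np ng : ℕ} (P : OCP nx nu np ng) (z : P.ZSpace ⊤) (g : P.G3)

/-- The derivative `v ↦ (v, g_y[t] v)` of `y ↦ (y, g(t, y))` along the trajectory. -/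
def graphD (t : ℝ) : YVal nx nu np →L[ℝ] YVal nx nu np × Vec ng :=
  (ContinuousLinearMap.id ℝ _).prod (fderiv ℝ (g.rep t) (P.y z t))

/-- The second derivative of the Hamiltonian in `(y, g)` along the trajectory. -/
def hamD2 (t : ℝ) :
    YVal nx nu np × Vec ng →L[ℝ] YVal nx nu np × Vec ng →L[ℝ] ℝ :=
  fderiv ℝ (fderiv ℝ (P.ham z t)) (P.w z g t)

/-- The second derivative of `y ↦ H(t, y, g(t, y))` along the trajectory, as a bilinear form. -/
def hessForm (t : ℝ) (v v' : YVal nx nu np) : ℝ :=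
  P.hamD2 z g t (P.graphD z g t v) (P.graphD z g t v')
    + inner ℝ (P.d z g t) (fderiv ℝ (fderiv ℝ (g.rep t)) (P.y z t) v v')

/-- The regularity of the data at a single time `t`. -/
structure RegularAt (t : ℝ) : Prop where
  f : ContDiff ℝ 2 (P.f t)
  l : ContDiff ℝ 2 (P.l t)
  g : ContDiff ℝ 2 (g.rep t)

section RegularAt

variable {P z g} {t : ℝ} (h : P.RegularAt g t)
include h

lemma RegularAt.ham (z : P.ZSpace ⊤) : ContDiff ℝ 2 (P.ham z t) := contDiff_add_inner h.l h.f

lemma RegularAt.fderiv_ham (v η : YVal nx nu np × Vec ng) :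
    fderiv ℝ (P.ham z t) v η = fderiv ℝ (P.l t) v η
      + inner ℝ (P.lam z t) (fderiv ℝ (P.f t) v η) := fderiv_add_inner h.l h.f v η

lemma RegularAt.hamD2_apply (η η' : YVal nx nu np × Vec ng) :
    P.hamD2 z g t η η' = fderiv ℝ (fderiv ℝ (P.l t)) (P.w z g t) η η'
      + inner ℝ (P.lam z t) (fderiv ℝ (fderiv ℝ (P.f t)) (P.w z g t) η η') :=
  fderiv_fderiv_add_inner h.l h.f _ η η'

lemma RegularAt.inner_d (η : Vec ng) :
    inner ℝ (P.d z g t) η = fderiv ℝ (P.ham z t) (P.w z g t) (0, η) := by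
  rw [h.fderiv_ham, d, inner_add_left, real_inner_comm, inner_pGrad,
    ContinuousLinearMap.adjoint_inner_left]
  rfl

omit h in
lemma dynJac_apply {m : ℕ} (ι : Vec m →L[ℝ] YVal nx nu np) (a : Vec m) :
    P.dynJac z g ι t a = fderiv ℝ (P.f t) (P.w z g t) (P.graphD z g t (ι a)) := by
  have e : P.graphD z g t (ι a) = ιy (ι a) + ιg (fderiv ℝ (g.rep t) (P.y z t) (ι a)) := by
    simp [graphD]
  rw [e, map_add]; rfl

/-- The chain rule for `y ↦ H(t, y, g(t, y))` along the trajectory. -/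
lemma RegularAt.hamGrad_eq {m : ℕ} (ι : Vec m →L[ℝ] YVal nx nu np) :
    P.hamGrad z g ι t
      = gradL ι ((fderiv ℝ (P.ham z t) (P.w z g t)).comp (P.graphD z g t)) := by
  refine ext_inner_left ℝ fun a => ?_
  have e : P.graphD z g t (ι a) = ιy (ι a) + ιg (fderiv ℝ (g.rep t) (P.y z t) (ι a)) := by
    simp [graphD]
  rw [inner_gradL, ContinuousLinearMap.comp_apply, h.fderiv_ham, hamGrad, inner_add_right,
    ContinuousLinearMap.adjoint_inner_right, dynJac_apply, costGrad, inner_add_right, inner_pGrad,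
    ContinuousLinearMap.adjoint_inner_right, inner_pGrad, add_comm, real_inner_comm]
  congr 1
  rw [e, map_add]; rfl

/-- The block `H_{ab}` is the corresponding block of the Hessian of `y ↦ H(t, y, g(t, y))`. -/
lemma RegularAt.inner_H {m k : ℕ} (ι : Vec m →L[ℝ] YVal nx nu np)
    (κ : Vec k →L[ℝ] YVal nx nu np) (a : Vec m) (b : Vec k) :
    inner ℝ a (P.H z g ι κ t b) = P.hessForm z g t (κ b) (ι a) := by
  have hd : ContDiff ℝ 2 (fun v => inner ℝ (P.d z g t) (g.rep t v)) :=
    contDiff_const.inner ℝ h.g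
  have e : ∀ v, P.graphD z g t v = ιy v + ιg (fderiv ℝ (g.rep t) (P.y z t) v) := by
    simp [graphD]
  have e2 : fderiv ℝ (fderiv ℝ (fun v => inner ℝ (P.d z g t) (g.rep t v))) (P.y z t) (κ b) (ι a)
      = inner ℝ (P.d z g t) (fderiv ℝ (fderiv ℝ (g.rep t)) (P.y z t) (κ b) (ι a)) :=
    fderiv_fderiv_inner_const h.g _ _ _
  have hs := (h.ham z).fderiv_fderiv_symm
  have e4 : ∀ (n : ℕ) (ν : Vec n →L[ℝ] YVal nx nu np) (c : Vec n),
      P.gJac z ν g t c = fderiv ℝ (g.rep t) (P.y z t) (ν c) := fun _ _ _ => rfl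
  simp only [H, add_apply, inner_add_right, ContinuousLinearMap.comp_apply,
    ContinuousLinearMap.adjoint_inner_right]
  rw [inner_pHess _ _ (h.ham z), inner_pHess _ _ (h.ham z), real_inner_comm,
    inner_pHess _ _ (h.ham z), inner_pHess _ _ (h.ham z), inner_pHess _ _ hd, e2, hessForm, hamD2, e, e]
  simp only [map_add, add_apply, e4, ContinuousLinearMap.comp_apply]
  rw [hs _ (ιg (fderiv ℝ (g.rep t) (P.y z t) (ι a)))]
  ring

lemma RegularAt.inner_Hg {m : ℕ} (ι : Vec m →L[ℝ] YVal nx nu np) (a : Vec m) (η : Vec ng) :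
    inner ℝ a (P.Hg z g ι t η) = P.hamD2 z g t (0, η) (P.graphD z g t (ι a)) := by
  have e : ∀ v, P.graphD z g t v = ιy v + ιg (fderiv ℝ (g.rep t) (P.y z t) v) := by
    simp [graphD]
  simp only [Hg, add_apply, inner_add_right, ContinuousLinearMap.comp_apply,
    ContinuousLinearMap.adjoint_inner_right]
  rw [inner_pHess _ _ (h.ham z), inner_pHess _ _ (h.ham z), e, map_add]
  rfl

lemma RegularAt.hessForm_symm (v v' : YVal nx nu np) :
    P.hessForm z g t v v' = P.hessForm z g t v' v := by
  rw [hessForm, hessForm, h.g.fderiv_fderiv_symm, hamD2, (h.ham z).fderiv_fderiv_symm]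

omit h in
lemma hessForm_add_left (v₁ v₂ v' : YVal nx nu np) :
    P.hessForm z g t (v₁ + v₂) v' = P.hessForm z g t v₁ v' + P.hessForm z g t v₂ v' := by
  simp only [hessForm, map_add, add_apply, inner_add_right]; ring

omit h in
lemma hessForm_add_right (v v₁ v₂ : YVal nx nu np) :
    P.hessForm z g t v (v₁ + v₂) = P.hessForm z g t v v₁ + P.hessForm z g t v v₂ := by
  simp only [hessForm, map_add, inner_add_right]; ring

omit h in
lemma eq_ι_add (v : YVal nx nu np) : v = ιx v.1 + ιu v.2.1 + ιp v.2.2 := by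
  simp

lemma RegularAt.inner_HRow {m : ℕ} (ι : Vec m →L[ℝ] YVal nx nu np) (a : Vec m)
    (v : YVal nx nu np) : inner ℝ a (P.HRow z g ι t v) = P.hessForm z g t v (ι a) := by
  rw [HRow, inner_add_right, inner_add_right, h.inner_H, h.inner_H, h.inner_H,
    ← hessForm_add_left, ← hessForm_add_left, ← eq_ι_add]

lemma RegularAt.HQuad_eq (v : YVal nx nu np) : P.HQuad z g t v = P.hessForm z g t v v := by
  rw [HQuad, h.inner_HRow, h.inner_HRow, h.inner_HRow, ← hessForm_add_right,
    ← hessForm_add_right, ← eq_ι_add]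

end RegularAt

end OCP

/-! ### Superposition with the data of the problem -/

section Superposition

variable {W E : Type*} [NormedAddCommGroup W] [NormedSpace ℝ W]
  [NormedAddCommGroup E] [NormedSpace ℝ E]

lemma norm_iteratedFDeriv_succ_sub (n : ℕ) (f : W → E) (x y : W) :
    ‖iteratedFDeriv ℝ (n + 1) f x - iteratedFDeriv ℝ (n + 1) f y‖
      = ‖iteratedFDeriv ℝ n (fderiv ℝ f) x - iteratedFDeriv ℝ n (fderiv ℝ f) y‖ := by
  rw [iteratedFDeriv_succ_eq_comp_right, iteratedFDeriv_succ_eq_comp_right]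
  simp only [Function.comp_apply]
  rw [← LinearIsometryEquiv.map_sub, LinearIsometryEquiv.norm_map]

lemma norm_iteratedFDeriv_zero_sub (f : W → E) (x y : W) :
    ‖iteratedFDeriv ℝ 0 f x - iteratedFDeriv ℝ 0 f y‖ = ‖f x - f y‖ := by
  rw [iteratedFDeriv_zero_eq_comp, Function.comp_apply, Function.comp_apply,
    ← LinearIsometryEquiv.map_sub, LinearIsometryEquiv.norm_map]

variable {μ : Measure ℝ} {h : ℝ → W → E}

lemma OCP.Smooth.lipschitz' (hh : OCP.Smooth μ h) (R : ℝ) : ∃ L : ℝ, 0 ≤ L ∧ ∀ s ≤ 2, ∀ᵐ t ∂μ,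
    ∀ w₁ ∈ Metric.closedBall (0 : W) R, ∀ w₂ ∈ Metric.closedBall (0 : W) R,
      ‖iteratedFDeriv ℝ s (h t) w₁ - iteratedFDeriv ℝ s (h t) w₂‖ ≤ L * ‖w₁ - w₂‖ := by
  obtain ⟨L, hL⟩ := hh.lipschitz (max R 1) (by positivity)
  refine ⟨max L 0, le_max_right _ _, fun s hs => ?_⟩
  filter_upwards [hL s hs] with t ht w₁ h1 w₂ h2
  have hsub := Metric.closedBall_subset_closedBall (x := (0 : W)) (le_max_left R 1)
  refine (ht w₁ (hsub h1) w₂ (hsub h2)).trans ?_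
  gcongr
  exact le_max_left _ _

variable [FiniteDimensional ℝ W]

lemma OCP.Smooth.isNemytskii (hh : OCP.Smooth μ h) : IsNemytskii μ h where
  measurable := hh.measurable
  contDiff := by filter_upwards [hh.contDiff] with t ht using ht.of_le (by norm_num)
  bounded := by
    obtain ⟨K, hK⟩ := hh.bounded
    refine ⟨K, ?_⟩
    filter_upwards [hK 0 (by norm_num), hK 1 (by norm_num)] with t h0 h1
    exact ⟨by simpa using h0, by rwa [norm_iteratedFDeriv_one] at h1⟩
  lipschitz R := by
    obtain ⟨L, hL0, hL⟩ := hh.lipschitz' R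
    refine ⟨L, hL0, ?_⟩
    filter_upwards [hL 1 (by norm_num)] with t ht w₁ h1 w₂ h2
    have := ht w₁ h1 w₂ h2
    rwa [norm_iteratedFDeriv_succ_sub 0, norm_iteratedFDeriv_zero_sub] at this

lemma OCP.Smooth.isNemytskii_fderiv (hh : OCP.Smooth μ h) :
    IsNemytskii μ (fun t => fderiv ℝ (h t)) where
  measurable := aestronglyMeasurable_fderiv hh.measurable (by
    filter_upwards [hh.contDiff] with t ht using ht.of_le (by norm_num))
  contDiff := by filter_upwards [hh.contDiff] with t ht using ht.fderiv_right (by norm_num)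
  bounded := by
    obtain ⟨K, hK⟩ := hh.bounded
    refine ⟨K, ?_⟩
    filter_upwards [hK 1 (by norm_num), hK 2 (by norm_num)] with t h1 h2
    refine ⟨by rwa [norm_iteratedFDeriv_one] at h1, ?_⟩
    rw [← norm_iteratedFDeriv_one, norm_iteratedFDeriv_fderiv]
    exact h2
  lipschitz R := by
    obtain ⟨L, hL0, hL⟩ := hh.lipschitz' R
    refine ⟨L, hL0, ?_⟩
    filter_upwards [hL 2 le_rfl] with t ht w₁ h1 w₂ h2
    have := ht w₁ h1 w₂ h2
    rwa [norm_iteratedFDeriv_succ_sub 1, norm_iteratedFDeriv_succ_sub 0,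
      norm_iteratedFDeriv_zero_sub] at this

end Superposition

section Hamiltonian

variable {μ : Measure ℝ} {X Y W N : Type*}
  [NormedAddCommGroup X] [NormedSpace ℝ X] [NormedAddCommGroup Y] [NormedSpace ℝ Y]
  [NormedAddCommGroup W] [NormedSpace ℝ W] [FiniteDimensional ℝ W]
  [NormedAddCommGroup N] [InnerProductSpace ℝ N]

/-- The pairing of `λ` with a linear map `T`, namely `⟨λ, T ·⟩`. -/
def pairL (W N : Type*) [NormedAddCommGroup W] [NormedSpace ℝ W]
    [NormedAddCommGroup N] [InnerProductSpace ℝ N] : N →L[ℝ] (W →L[ℝ] N) →L[ℝ] W →L[ℝ] ℝ :=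
  (ContinuousLinearMap.compL ℝ W N ℝ).comp (innerSL ℝ)

variable {f : ℝ → W → N} {l : ℝ → W → ℝ} (hf : OCP.Smooth μ f) (hl : OCP.Smooth μ l)

/-- The functional `(Dl + ⟨λ, Df ·⟩) ∘ K` along `w`, as an essentially bounded function. -/
def hamLp (w : Lp W ⊤ μ) (K : Lp (Y →L[ℝ] W) ⊤ μ) (lam : Lp N ⊤ μ) : Lp (Y →L[ℝ] ℝ) ⊤ μ :=
  (ContinuousLinearMap.compL ℝ Y W ℝ).holder ⊤ (hl.isNemytskii_fderiv.op w
    + (pairL W N).holder ⊤ lam (hf.isNemytskii_fderiv.op w)) K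

lemma coeFn_hamLp (w : Lp W ⊤ μ) (K : Lp (Y →L[ℝ] W) ⊤ μ) (lam : Lp N ⊤ μ) :
    hamLp hf hl w K lam =ᵐ[μ] fun t =>
      (fderiv ℝ (l t) (w t) + pairL W N (lam t) (fderiv ℝ (f t) (w t))).comp (K t) := by
  filter_upwards [(ContinuousLinearMap.compL ℝ Y W ℝ).coeFn_holder (r := ⊤)
      (hl.isNemytskii_fderiv.op w + (pairL W N).holder ⊤ lam (hf.isNemytskii_fderiv.op w)) K,
    Lp.coeFn_add (hl.isNemytskii_fderiv.op w)
      ((pairL W N).holder ⊤ lam (hf.isNemytskii_fderiv.op w)),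
    (pairL W N).coeFn_holder (r := ⊤) lam (hf.isNemytskii_fderiv.op w),
    hl.isNemytskii_fderiv.coeFn_op w, hf.isNemytskii_fderiv.coeFn_op w] with t h1 h2 h3 h4 h5
  refine h1.trans ?_
  rw [h2, Pi.add_apply, h3, h4, h5]
  rfl

variable {w : X → Lp W ⊤ μ} {K : X → Lp (Y →L[ℝ] W) ⊤ μ} {lam : X → Lp N ⊤ μ}

lemma contDiff_hamLp (hw : ContDiff ℝ 1 w) (hK : ContDiff ℝ 1 K) (hlam : ContDiff ℝ 1 lam) :
    ContDiff ℝ 1 (fun x => hamLp hf hl (w x) (K x) (lam x)) :=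
  ((hl.isNemytskii_fderiv.contDiff_op.comp hw).add
    (hlam.holder_top (hf.isNemytskii_fderiv.contDiff_op.comp hw) _)).holder_top hK _

lemma hasLinftyDerivAt_hamLp [FiniteDimensional ℝ N] {w' : X → ℝ → W} {K' : X → ℝ → Y →L[ℝ] W}
    {lam' : X → ℝ → N} {x : X} (hw : HasLinftyDerivAt w w' x) (hK : HasLinftyDerivAt K K' x)
    (hlam : HasLinftyDerivAt lam lam' x) :
    HasLinftyDerivAt (fun x => hamLp hf hl (w x) (K x) (lam x)) (fun δ t =>
      (fderiv ℝ (fderiv ℝ (l t)) (w x t) (w' δ t)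
        + pairL W N (lam' δ t) (fderiv ℝ (f t) (w x t))
        + pairL W N (lam x t) (fderiv ℝ (fderiv ℝ (f t)) (w x t) (w' δ t))).comp (K x t)
      + (fderiv ℝ (l t) (w x t)
        + pairL W N (lam x t) (fderiv ℝ (f t) (w x t))).comp (K' δ t)) x := by
  have h1 := (hw.nemytskii hl.isNemytskii_fderiv).add
    (hlam.bilin (hw.nemytskii hf.isNemytskii_fderiv) (pairL W N))
  refine (h1.bilin hK (ContinuousLinearMap.compL ℝ Y W ℝ)).congr_deriv fun δ => ?_
  filter_upwards [Lp.coeFn_add (hl.isNemytskii_fderiv.op (w x))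
      ((pairL W N).holder ⊤ (lam x) (hf.isNemytskii_fderiv.op (w x))),
    (pairL W N).coeFn_holder (r := ⊤) (lam x) (hf.isNemytskii_fderiv.op (w x)),
    hl.isNemytskii_fderiv.coeFn_op (w x), hf.isNemytskii_fderiv.coeFn_op (w x)] with t h2 h3 h4 h5
  rw [h2, Pi.add_apply, h3, h4, h5, add_assoc]
  rfl

end Hamiltonian

/-! ### The derivative of the reduced Hamiltonian along a trajectory -/

section ReducedHamiltonian

variable {μ : Measure ℝ} [IsFiniteMeasure μ] {X Y G N 𝒢 : Type*}
  [NormedAddCommGroup X] [NormedSpace ℝ X]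
  [NormedAddCommGroup Y] [NormedSpace ℝ Y] [FiniteDimensional ℝ Y]
  [NormedAddCommGroup G] [NormedSpace ℝ G] [FiniteDimensional ℝ G]
  [NormedAddCommGroup N] [InnerProductSpace ℝ N] [FiniteDimensional ℝ N]
  [NormedAddCommGroup 𝒢] [NormedSpace ℝ 𝒢] {ρ : 𝒢 → ℝ → Y → G}
  (hρ : IsRealization μ ρ) (hρ' : IsRealization μ (fun g t y => fderiv ℝ (ρ g t) y))

/-- The graph `t ↦ (y(t), g(t, y(t)))` of a model function along `y`. -/
def IsRealization.graphOp (y : Lp Y ⊤ μ) (g : 𝒢) : Lp (Y × G) ⊤ μ :=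
  (ContinuousLinearMap.inl ℝ Y G).compLpL ⊤ μ y
    + (ContinuousLinearMap.inr ℝ Y G).compLpL ⊤ μ (hρ.op (y, g))

/-- The tangent map `t ↦ (id, g_y(t, y(t)))` of the graph of a model function along `y`. -/
def IsRealization.tangentOp (y : Lp Y ⊤ μ) (g : 𝒢) : Lp (Y →L[ℝ] Y × G) ⊤ μ :=
  Lp.const ⊤ μ (ContinuousLinearMap.inl ℝ Y G)
    + (ContinuousLinearMap.compL ℝ Y G (Y × G) (ContinuousLinearMap.inr ℝ Y G)).compLpL ⊤ μ
      (hρ'.op (y, g))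

lemma IsRealization.coeFn_graphOp (y : Lp Y ⊤ μ) (g : 𝒢) :
    hρ.graphOp y g =ᵐ[μ] fun t => (y t, ρ g t (y t)) := by
  filter_upwards [Lp.coeFn_add ((ContinuousLinearMap.inl ℝ Y G).compLpL ⊤ μ y)
      ((ContinuousLinearMap.inr ℝ Y G).compLpL ⊤ μ (hρ.op (y, g))),
    (ContinuousLinearMap.inl ℝ Y G).coeFn_compLpL y,
    (ContinuousLinearMap.inr ℝ Y G).coeFn_compLpL (hρ.op (y, g)), hρ.coeFn_op (y, g)]
    with t h1 h2 h3 h4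
  rw [graphOp, h1, Pi.add_apply, h2, h3, h4]
  simp

lemma IsRealization.coeFn_tangentOp (y : Lp Y ⊤ μ) (g : 𝒢) :
    hρ'.tangentOp y g =ᵐ[μ] fun t =>
      (ContinuousLinearMap.id ℝ Y).prod (fderiv ℝ (ρ g t) (y t)) := by
  filter_upwards [Lp.coeFn_add (Lp.const ⊤ μ (ContinuousLinearMap.inl ℝ Y G))
      ((ContinuousLinearMap.compL ℝ Y G (Y × G) (ContinuousLinearMap.inr ℝ Y G)).compLpL ⊤ μ
      (hρ'.op (y, g))),
    Lp.coeFn_const (p := ⊤) (μ := μ) (ContinuousLinearMap.inl ℝ Y G),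
    (ContinuousLinearMap.compL ℝ Y G (Y × G) (ContinuousLinearMap.inr ℝ Y G)).coeFn_compLpL
      (hρ'.op (y, g)), hρ'.coeFn_op (y, g)] with t h1 h2 h3 h4
  rw [tangentOp, h1, Pi.add_apply, h2, h3, h4]
  ext v <;> simp

lemma IsRealization.contDiff_graphOp (L : X →L[ℝ] Lp Y ⊤ μ) (M : X →L[ℝ] 𝒢) :
    ContDiff ℝ 1 (fun x => hρ.graphOp (L x) (M x)) :=
  (L.contDiff.compLpL _).add ((hρ.contDiff_op_clm L M).compLpL _)

lemma IsRealization.contDiff_tangentOp (L : X →L[ℝ] Lp Y ⊤ μ) (M : X →L[ℝ] 𝒢) :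
    ContDiff ℝ 1 (fun x => hρ'.tangentOp (L x) (M x)) :=
  contDiff_const.add ((hρ'.contDiff_op_clm L M).compLpL _)

lemma IsRealization.hasLinftyDerivAt_graphOp (L : X →L[ℝ] Lp Y ⊤ μ) (M : X →L[ℝ] 𝒢) (x : X) :
    HasLinftyDerivAt (fun x => hρ.graphOp (L x) (M x)) (fun δ t =>
      (L δ t, fderiv ℝ (ρ (M x) t) (L x t) (L δ t) + ρ (M δ) t (L x t))) x := by
  refine (((HasLinftyDerivAt.clm (x := x) L).compLp (ContinuousLinearMap.inl ℝ Y G)).add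
    ((hρ.hasLinftyDerivAt L M x).compLp (ContinuousLinearMap.inr ℝ Y G))).congr_deriv fun δ => ?_
  exact Eventually.of_forall fun t => by simp

lemma IsRealization.hasLinftyDerivAt_tangentOp (L : X →L[ℝ] Lp Y ⊤ μ) (M : X →L[ℝ] 𝒢) (x : X) :
    HasLinftyDerivAt (fun x => hρ'.tangentOp (L x) (M x)) (fun δ t =>
      (ContinuousLinearMap.inr ℝ Y G).comp
        (fderiv ℝ (fderiv ℝ (ρ (M x) t)) (L x t) (L δ t) + fderiv ℝ (ρ (M δ) t) (L x t))) x :=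
  ((hρ'.hasLinftyDerivAt L M x).compLp (ContinuousLinearMap.compL ℝ Y G (Y × G)
    (ContinuousLinearMap.inr ℝ Y G))).const_add _

variable {f : ℝ → Y × G → N} {l : ℝ → Y × G → ℝ} (hf : OCP.Smooth μ f) (hl : OCP.Smooth μ l)

/-- The derivative of `y ↦ l(t, y, g(t, y)) + ⟨λ(t), f(t, y, g(t, y))⟩` along `y(t)`. -/
def reducedHamDeriv (y : Lp Y ⊤ μ) (g : 𝒢) (lam : Lp N ⊤ μ) : Lp (Y →L[ℝ] ℝ) ⊤ μ :=
  hamLp hf hl (hρ.graphOp y g) (hρ'.tangentOp y g) lam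

lemma coeFn_reducedHamDeriv (y : Lp Y ⊤ μ) (g : 𝒢) (lam : Lp N ⊤ μ) :
    reducedHamDeriv hρ hρ' hf hl y g lam =ᵐ[μ] fun t =>
      (fderiv ℝ (l t) (y t, ρ g t (y t))
        + pairL (Y × G) N (lam t) (fderiv ℝ (f t) (y t, ρ g t (y t)))).comp
        ((ContinuousLinearMap.id ℝ Y).prod (fderiv ℝ (ρ g t) (y t))) := by
  filter_upwards [coeFn_hamLp hf hl (hρ.graphOp y g) (hρ'.tangentOp y g) lam,
    hρ.coeFn_graphOp y g, hρ'.coeFn_tangentOp y g] with t h1 h2 h3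
  rw [reducedHamDeriv, h1, h2, h3]

lemma contDiff_reducedHamDeriv (L : X →L[ℝ] Lp Y ⊤ μ) (M : X →L[ℝ] 𝒢) (Λ : X →L[ℝ] Lp N ⊤ μ) :
    ContDiff ℝ 1 (fun x => reducedHamDeriv hρ hρ' hf hl (L x) (M x) (Λ x)) :=
  contDiff_hamLp hf hl (hρ.contDiff_graphOp L M) (hρ'.contDiff_tangentOp L M) Λ.contDiff

lemma hasLinftyDerivAt_reducedHamDeriv (L : X →L[ℝ] Lp Y ⊤ μ) (M : X →L[ℝ] 𝒢)
    (Λ : X →L[ℝ] Lp N ⊤ μ) (x : X) :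
    HasLinftyDerivAt (fun x => reducedHamDeriv hρ hρ' hf hl (L x) (M x) (Λ x)) (fun δ t =>
      (fderiv ℝ (fderiv ℝ (l t)) (L x t, ρ (M x) t (L x t))
          (L δ t, fderiv ℝ (ρ (M x) t) (L x t) (L δ t) + ρ (M δ) t (L x t))
        + pairL (Y × G) N (Λ δ t) (fderiv ℝ (f t) (L x t, ρ (M x) t (L x t)))
        + pairL (Y × G) N (Λ x t) (fderiv ℝ (fderiv ℝ (f t)) (L x t, ρ (M x) t (L x t))
          (L δ t, fderiv ℝ (ρ (M x) t) (L x t) (L δ t) + ρ (M δ) t (L x t)))).comp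
          ((ContinuousLinearMap.id ℝ Y).prod (fderiv ℝ (ρ (M x) t) (L x t)))
      + (fderiv ℝ (l t) (L x t, ρ (M x) t (L x t))
          + pairL (Y × G) N (Λ x t) (fderiv ℝ (f t) (L x t, ρ (M x) t (L x t)))).comp
        ((ContinuousLinearMap.inr ℝ Y G).comp
        (fderiv ℝ (fderiv ℝ (ρ (M x) t)) (L x t) (L δ t) + fderiv ℝ (ρ (M δ) t) (L x t)))) x := by
  refine (hasLinftyDerivAt_hamLp hf hl (hρ.hasLinftyDerivAt_graphOp L M x)
    (hρ'.hasLinftyDerivAt_tangentOp L M x) (HasLinftyDerivAt.clm Λ)).congr_deriv fun δ => ?_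
  filter_upwards [hρ.coeFn_graphOp (L x) (M x), hρ'.coeFn_tangentOp (L x) (M x)] with t h2 h3
  rw [h2, h3]

lemma contDiff_op_graphOp (L : X →L[ℝ] Lp Y ⊤ μ) (M : X →L[ℝ] 𝒢) :
    ContDiff ℝ 1 (fun x => hf.isNemytskii.op (hρ.graphOp (L x) (M x))) :=
  hf.isNemytskii.contDiff_op.comp (hρ.contDiff_graphOp L M)

lemma hasLinftyDerivAt_op_graphOp (L : X →L[ℝ] Lp Y ⊤ μ) (M : X →L[ℝ] 𝒢) (x : X) :
    HasLinftyDerivAt (fun x => hf.isNemytskii.op (hρ.graphOp (L x) (M x))) (fun δ t =>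
      fderiv ℝ (f t) (L x t, ρ (M x) t (L x t))
        (L δ t, fderiv ℝ (ρ (M x) t) (L x t) (L δ t) + ρ (M δ) t (L x t))) x := by
  refine ((hρ.hasLinftyDerivAt_graphOp L M x).nemytskii hf.isNemytskii).congr_deriv fun δ => ?_
  filter_upwards [hρ.coeFn_graphOp (L x) (M x)] with t h2
  rw [h2]

end ReducedHamiltonian

/-! ### Dynamics and Hamiltonian as functions of the unknowns and the model function -/

namespace OCP

variable {nx nu np ng : ℕ} (P : OCP nx nu np ng)

/-- The trajectory `t ↦ (x(t), u(t), p)` as an essentially bounded function. -/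
def trajL : P.ZSpace ⊤ →L[ℝ] Lp (YVal nx nu np) ⊤ P.μ :=
  (ιx.compLpL ⊤ P.μ).comp ((W1.valL P.lt.le ⊤).comp (ContinuousLinearMap.fst ℝ _ _))
    + (ιu.compLpL ⊤ P.μ).comp ((ContinuousLinearMap.fst ℝ _ _).comp (ContinuousLinearMap.snd ℝ _ _))
    + (Lp.constL ⊤ P.μ ℝ).comp (ιp.comp ((ContinuousLinearMap.fst ℝ _ _).comp
        ((ContinuousLinearMap.snd ℝ _ _).comp (ContinuousLinearMap.snd ℝ _ _))))

lemma coeFn_trajL (z : P.ZSpace ⊤) : P.trajL z =ᵐ[P.μ] P.y z := by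
  have e : P.trajL z = ιx.compLpL ⊤ P.μ (W1.valL P.lt.le ⊤ z.1) + ιu.compLpL ⊤ P.μ z.2.1
    + Lp.constL ⊤ P.μ ℝ (ιp z.2.2.1) := rfl
  rw [e]
  filter_upwards [Lp.coeFn_add (ιx.compLpL ⊤ P.μ (W1.valL P.lt.le ⊤ z.1)
      + ιu.compLpL ⊤ P.μ z.2.1 : Lp (YVal nx nu np) ⊤ P.μ) (Lp.constL ⊤ P.μ ℝ (ιp z.2.2.1)),
    Lp.coeFn_add (ιx.compLpL ⊤ P.μ (W1.valL P.lt.le ⊤ z.1))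
      (ιu.compLpL ⊤ P.μ z.2.1 : Lp (YVal nx nu np) ⊤ P.μ),
    (ιx (nx := nx) (nu := nu) (np := np)).coeFn_compLpL (W1.valL P.lt.le ⊤ z.1),
    (ιu (nx := nx) (nu := nu) (np := np)).coeFn_compLpL z.2.1,
    Lp.coeFn_const (p := ⊤) (μ := P.μ) (ιp z.2.2.1 : YVal nx nu np), W1.coeFn_valL z.1]
    with t h1 h2 h3 h4 h5 h6
  rw [Lp.constL_apply] at h1
  rw [Lp.constL_apply, h1, Pi.add_apply, h2, Pi.add_apply, h3, h4, h5, h6]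
  simp [y]

/-- The data `(z, g)` of the optimality system. -/
abbrev ZGSpace : Type := P.ZSpace ⊤ × P.G3

/-- The component `z = (x, u, p, λ)`. -/
def zL : P.ZGSpace →L[ℝ] P.ZSpace ⊤ := ContinuousLinearMap.fst ℝ _ _

/-- The state component. -/
def stateL : P.ZGSpace →L[ℝ] P.XSpace ⊤ := (ContinuousLinearMap.fst ℝ _ _).comp P.zL

/-- The costate component. -/
def costateL : P.ZGSpace →L[ℝ] P.XSpace ⊤ :=
  ((ContinuousLinearMap.snd ℝ _ _).comp ((ContinuousLinearMap.snd ℝ _ _).comp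
    (ContinuousLinearMap.snd ℝ _ _))).comp P.zL

/-- The model function component. -/
def modelL : P.ZGSpace →L[ℝ] P.G3 := ContinuousLinearMap.snd ℝ _ _

/-- The trajectory `(x(t), u(t), p)` as a function of `(z, g)`. -/
def pathL : P.ZGSpace →L[ℝ] Lp (YVal nx nu np) ⊤ P.μ := P.trajL.comp P.zL

/-- The values of the costate as a function of `(z, g)`. -/
def lamL : P.ZGSpace →L[ℝ] Lp (Vec nx) ⊤ P.μ := (W1.valL P.lt.le ⊤).comp P.costateL

/-- The end point `(x(t_f), p)` as a function of `(z, g)`. -/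
def endL : P.ZGSpace →L[ℝ] Vec nx × Vec np :=
  ((W1.evalL P.lt.le ⊤ P.tf).comp P.stateL).prod
    (((ContinuousLinearMap.fst ℝ _ _).comp ((ContinuousLinearMap.snd ℝ _ _).comp
    (ContinuousLinearMap.snd ℝ _ _))).comp P.zL)

lemma coeFn_pathL (x : P.ZGSpace) : P.pathL x =ᵐ[P.μ] P.y x.1 := P.coeFn_trajL x.1

lemma coeFn_lamL (x : P.ZGSpace) : P.lamL x =ᵐ[P.μ] P.lam x.1 := W1.coeFn_valL x.1.2.2.2

lemma ae_regularAt (hf : Smooth P.μ P.f) (hl : Smooth P.μ P.l) (g : P.G3) :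
    ∀ᵐ t ∂P.μ, P.RegularAt g t := by
  filter_upwards [hf.contDiff, hl.contDiff, g.contDiff_rep] with t h1 h2 h3
  exact ⟨h1, h2, h3.of_le (by norm_num)⟩

/-- The realization of `𝒢³` by representatives. -/
lemma isRealization : IsRealization P.μ (fun (g : P.G3) t y => g.rep t y) :=
  ModelSpace.isRealization_rep (by norm_num)

/-- The derivatives in `y` of the elements of `𝒢³` still have two bounded derivatives, which is what
differentiability of `g_y` along the trajectory requires. -/
lemma isRealization_fderiv : IsRealization P.μ (fun (g : P.G3) t y => fderiv ℝ (g.rep t) y) :=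
  ModelSpace.isRealization_fderiv_rep le_rfl

variable {P}
variable (hf : Smooth P.μ P.f) (hl : Smooth P.μ P.l)

/-- `f[·]` as a function of `(z, g)`. -/
def dynOp (x : P.ZGSpace) : Lp (Vec nx) ⊤ P.μ :=
  hf.isNemytskii.op (P.isRealization.graphOp (P.pathL x) (P.modelL x))

/-- The derivative of `y ↦ H(t, y, g(t, y))` along the trajectory as a function of `(z, g)`. -/
def hamOp (x : P.ZGSpace) : Lp (YVal nx nu np →L[ℝ] ℝ) ⊤ P.μ :=
  reducedHamDeriv P.isRealization P.isRealization_fderiv hf hl (P.pathL x) (P.modelL x) (P.lamL x)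

lemma dynOp_eq : dynOp hf = fun x : P.ZGSpace =>
    hf.isNemytskii.op (P.isRealization.graphOp (P.pathL x) (P.modelL x)) := rfl

lemma hamOp_eq : hamOp hf hl = fun x : P.ZGSpace =>
    reducedHamDeriv P.isRealization P.isRealization_fderiv hf hl (P.pathL x) (P.modelL x)
      (P.lamL x) := rfl

lemma contDiff_dynOp : ContDiff ℝ 1 (dynOp hf) := by
  have h := contDiff_op_graphOp (X := P.ZGSpace) P.isRealization hf P.pathL P.modelL
  rw [dynOp_eq]
  -- both sides agree syntactically; unfolding the instances on the function spaces is expensive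
  with_reducible exact h

lemma contDiff_hamOp : ContDiff ℝ 1 (hamOp hf hl) := by
  have h := contDiff_reducedHamDeriv (X := P.ZGSpace) P.isRealization P.isRealization_fderiv hf hl
    P.pathL P.modelL P.lamL
  rw [hamOp_eq]
  with_reducible exact h

lemma coeFn_dynOp (x : P.ZGSpace) : dynOp hf x =ᵐ[P.μ] fun t => P.f t (P.w x.1 x.2 t) := by
  filter_upwards [hf.isNemytskii.coeFn_op (P.isRealization.graphOp (P.pathL x) (P.modelL x)),
    P.isRealization.coeFn_graphOp (P.pathL x) (P.modelL x), P.coeFn_pathL x] with t h1 h2 h3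
  rw [dynOp, h1, h2, h3]
  rfl

lemma coeFn_gradL_hamOp (x : P.ZGSpace) {m : ℕ} (ι : Vec m →L[ℝ] YVal nx nu np) :
    (gradL ι).compLpL ⊤ P.μ (hamOp hf hl x) =ᵐ[P.μ] P.hamGrad x.1 x.2 ι := by
  filter_upwards [(gradL ι).coeFn_compLpL (hamOp hf hl x),
    coeFn_reducedHamDeriv P.isRealization P.isRealization_fderiv hf hl (P.pathL x) (P.modelL x)
      (P.lamL x), P.coeFn_pathL x, P.coeFn_lamL x, P.ae_regularAt hf hl x.2] with t h1 h2 h3 h4 h5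
  rw [h1, h5.hamGrad_eq, hamOp, h2, h3, h4]
  congr 2
  refine ContinuousLinearMap.ext fun η => ?_
  exact (h5.fderiv_ham _ η).symm

/-- The right-hand side of the linearized dynamics is the derivative of `f` applied to the variation
of `(y(t), g(t, y(t)))`. -/
lemma dynJac_add_sensR (z : P.ZSpace ⊤) (g δg : P.G3) (δz : P.ZSpace ⊤) (t : ℝ) :
    P.dynJac z g ιx t (sobVal δz.1 t) + P.dynJac z g ιu t (δz.2.1 t)
      + P.dynJac z g ιp t δz.2.2.1 + P.sensR z g δg t
    = fderiv ℝ (P.f t) (P.w z g t)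
      (P.y δz t, fderiv ℝ (g.rep t) (P.y z t) (P.y δz t) + δg.rep t (P.y z t)) := by
  rw [dynJac_apply, dynJac_apply, dynJac_apply, sensR, pJac_apply, ← map_add, ← map_add,
    ← map_add, ← map_add, ← map_add]
  congr 1
  simp [graphD, y, δgAt]

/-- Identification of the coefficients of the sensitivity system: tested with a vector `a`, the
left-hand side is the variation of `∇_a H` in terms of the coefficients `H_{ab}` and `c_a`, and the
right-hand side is the result of differentiating `(Dl + ⟨λ, Df⟩) ∘ (id, g_y)` by the product
rule. -/
lemma RegularAt.inner_linearization {g : P.G3} {t : ℝ} (h : P.RegularAt g t) (z : P.ZSpace ⊤)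
    (δg : P.G3) (δz : P.ZSpace ⊤) {m : ℕ} (ι : Vec m →L[ℝ] YVal nx nu np) (a : Vec m) :
    inner ℝ a ((P.dynJac z g ι t).adjoint (P.lam δz t) + P.HRow z g ι t (P.y δz t)
        + P.sensC z g δg ι t)
    = fderiv ℝ (fderiv ℝ (P.l t)) (P.w z g t)
        (P.y δz t, fderiv ℝ (g.rep t) (P.y z t) (P.y δz t) + δg.rep t (P.y z t))
        (P.graphD z g t (ι a))
      + inner ℝ (P.lam δz t) (fderiv ℝ (P.f t) (P.w z g t) (P.graphD z g t (ι a)))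
      + inner ℝ (P.lam z t) (fderiv ℝ (fderiv ℝ (P.f t)) (P.w z g t)
        (P.y δz t, fderiv ℝ (g.rep t) (P.y z t) (P.y δz t) + δg.rep t (P.y z t))
        (P.graphD z g t (ι a)))
      + (fderiv ℝ (P.l t) (P.w z g t) (ιg
          (fderiv ℝ (fderiv ℝ (g.rep t)) (P.y z t) (P.y δz t) (ι a)
            + fderiv ℝ (δg.rep t) (P.y z t) (ι a)))
        + inner ℝ (P.lam z t) (fderiv ℝ (P.f t) (P.w z g t) (ιg
          (fderiv ℝ (fderiv ℝ (g.rep t)) (P.y z t) (P.y δz t) (ι a)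
            + fderiv ℝ (δg.rep t) (P.y z t) (ι a))))) := by
  have e : ((P.y δz t, fderiv ℝ (g.rep t) (P.y z t) (P.y δz t) + δg.rep t (P.y z t)) :
      YVal nx nu np × Vec ng) = P.graphD z g t (P.y δz t) + (0, P.δgAt z δg t) := by
    simp [graphD, δgAt]
  have e4 : P.gJac z ι δg t a = fderiv ℝ (δg.rep t) (P.y z t) (ι a) := rfl
  have e5 : ∀ η : Vec ng, ((0, η) : YVal nx nu np × Vec ng) = ιg η := fun η => by simp
  rw [e, inner_add_right, inner_add_right, ContinuousLinearMap.adjoint_inner_right,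
    h.inner_HRow, sensC, inner_add_right, ContinuousLinearMap.adjoint_inner_right,
    h.inner_Hg, hessForm, h.hamD2_apply, h.hamD2_apply, dynJac_apply,
    real_inner_comm (P.d z g t) (P.gJac z ι δg t a), h.inner_d, h.inner_d, h.fderiv_ham,
    h.fderiv_ham, e4]
  simp only [map_add, add_apply, inner_add_right, e5]
  rw [real_inner_comm]
  ring

set_option maxHeartbeats 1000000 in
lemma hasLinftyDerivAt_dynOp (x : P.ZGSpace) :
    HasLinftyDerivAt (dynOp hf) (fun δ t => P.dynJac x.1 x.2 ιx t (sobVal δ.1.1 t)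
      + P.dynJac x.1 x.2 ιu t (δ.1.2.1 t) + P.dynJac x.1 x.2 ιp t δ.1.2.2.1
      + P.sensR x.1 x.2 δ.2 t) x := by
  have h := hasLinftyDerivAt_op_graphOp (X := P.ZGSpace) P.isRealization hf P.pathL P.modelL x
  rw [← dynOp_eq hf] at h
  refine HasLinftyDerivAt.congr_deriv h fun δ => ?_
  filter_upwards [P.coeFn_pathL x, P.coeFn_pathL δ] with t h1 h2
  rw [h1, h2, dynJac_add_sensR]
  rfl

set_option maxHeartbeats 1000000 in
lemma hasLinftyDerivAt_gradL_hamOp (x : P.ZGSpace) {m : ℕ} (ι : Vec m →L[ℝ] YVal nx nu np) :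
    HasLinftyDerivAt (fun x => (gradL ι).compLpL ⊤ P.μ (hamOp hf hl x)) (fun δ t =>
      (P.dynJac x.1 x.2 ι t).adjoint (P.lam δ.1 t) + P.HRow x.1 x.2 ι t (P.y δ.1 t)
        + P.sensC x.1 x.2 δ.2 ι t) x := by
  have h := hasLinftyDerivAt_reducedHamDeriv (X := P.ZGSpace) P.isRealization
    P.isRealization_fderiv hf hl P.pathL P.modelL P.lamL x
  rw [← hamOp_eq] at h
  refine HasLinftyDerivAt.congr_deriv (HasLinftyDerivAt.compLp h (gradL ι)) fun δ => ?_
  filter_upwards [P.coeFn_pathL x, P.coeFn_pathL δ, P.coeFn_lamL x, P.coeFn_lamL δ,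
    P.ae_regularAt hf hl x.2] with t h1 h2 h3 h4 h5
  refine ext_inner_left ℝ fun a => ?_
  rw [h1, h2, h3, h4, inner_gradL, h5.inner_linearization]
  rfl

end OCP

/-! ### The optimality system as a map between Banach spaces -/

section

variable {E F G : Type*} [NormedAddCommGroup E] [NormedSpace ℝ E] [NormedAddCommGroup F]
  [NormedSpace ℝ F] [NormedAddCommGroup G] [NormedSpace ℝ G]

/-- The derivative of `x ↦ gradL ι (Dφ(B x))`. -/
lemma hasFDerivAt_gradL_fderiv {A : Type*} [NormedAddCommGroup A] [InnerProductSpace ℝ A]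
    [CompleteSpace A] {φ : F → ℝ} (hφ : ContDiff ℝ 2 φ) (B : E →L[ℝ] F) (ι : A →L[ℝ] F) (x : E) :
    HasFDerivAt (fun x => gradL ι (fderiv ℝ φ (B x)))
      ((gradL ι).comp ((fderiv ℝ (fderiv ℝ φ) (B x)).comp B)) x :=
  (gradL ι).hasFDerivAt.comp x
    ((hφ.differentiable_fderiv (B x)).hasFDerivAt.comp x B.hasFDerivAt)

lemma contDiff_gradL_fderiv {A : Type*} [NormedAddCommGroup A] [InnerProductSpace ℝ A]
    [CompleteSpace A] {φ : F → ℝ} (hφ : ContDiff ℝ 2 φ) (B : E →L[ℝ] F) (ι : A →L[ℝ] F) :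
    ContDiff ℝ 1 (fun x => gradL ι (fderiv ℝ φ (B x))) :=
  (gradL ι).contDiff.comp ((hφ.fderiv_right (m := 1) (by norm_num)).comp B.contDiff)

variable {V₁ V₂ V₃ V₄ V₅ : Type*} [NormedAddCommGroup V₁] [NormedSpace ℝ V₁]
  [NormedAddCommGroup V₂] [NormedSpace ℝ V₂] [NormedAddCommGroup V₃] [NormedSpace ℝ V₃]
  [NormedAddCommGroup V₄] [NormedSpace ℝ V₄] [NormedAddCommGroup V₅] [NormedSpace ℝ V₅]
  (S : E →L[ℝ] V₁) (I : E →L[ℝ] V₂) (c : V₂)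
  (C : E →L[ℝ] V₃) (T : E →L[ℝ] V₄)

/-- The pattern of the optimality system: nonlinear parts `F₁, …, F₆` and linear parts
`S, I, C, T`. -/
def systemMap (F₁ : E → V₁) (F₃ : E → V₃) (F₄ : E → V₄) (F₅ : E → V₅) (F₆ : E → F)
    (F₆' : E → F) (x : E) : V₁ × V₂ × V₃ × V₄ × V₅ × F :=
  (F₁ x - S x, c - I x, C x + F₃ x, F₄ x - T x, F₅ x, F₆ x + F₆' x)

variable {F₁ : E → V₁} {F₃ : E → V₃} {F₄ : E → V₄} {F₅ : E → V₅} {F₆ F₆' : E → F}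

lemma contDiff_systemMap (h₁ : ContDiff ℝ 1 F₁) (h₃ : ContDiff ℝ 1 F₃) (h₄ : ContDiff ℝ 1 F₄)
    (h₅ : ContDiff ℝ 1 F₅) (h₆ : ContDiff ℝ 1 F₆) (h₆' : ContDiff ℝ 1 F₆') :
    ContDiff ℝ 1 (systemMap S I c C T F₁ F₃ F₄ F₅ F₆ F₆') :=
  (h₁.sub S.contDiff).prodMk ((contDiff_const.sub I.contDiff).prodMk ((C.contDiff.add h₃).prodMk
    ((h₄.sub T.contDiff).prodMk (h₅.prodMk (h₆.add h₆')))))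

lemma fderiv_systemMap {x : E} {D₁ : E →L[ℝ] V₁} {D₃ : E →L[ℝ] V₃} {D₄ : E →L[ℝ] V₄}
    {D₅ : E →L[ℝ] V₅} {D₆ D₆' : E →L[ℝ] F} (h₁ : HasFDerivAt F₁ D₁ x) (h₃ : HasFDerivAt F₃ D₃ x)
    (h₄ : HasFDerivAt F₄ D₄ x) (h₅ : HasFDerivAt F₅ D₅ x) (h₆ : HasFDerivAt F₆ D₆ x)
    (h₆' : HasFDerivAt F₆' D₆' x) (δ : E) :
    fderiv ℝ (systemMap S I c C T F₁ F₃ F₄ F₅ F₆ F₆') x δ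
      = (D₁ δ - S δ, -I δ, C δ + D₃ δ, D₄ δ - T δ, D₅ δ, D₆ δ + D₆' δ) := by
  have h : HasFDerivAt (systemMap S I c C T F₁ F₃ F₄ F₅ F₆ F₆') ((D₁ - S).prod ((-I).prod
      ((C + D₃).prod ((D₄ - T).prod (D₅.prod (D₆ + D₆')))))) x :=
    (h₁.sub S.hasFDerivAt).prodMk ((I.hasFDerivAt.const_sub c).prodMk
      ((C.hasFDerivAt.add h₃).prodMk ((h₄.sub T.hasFDerivAt).prodMk (h₅.prodMk (h₆.add h₆')))))
  rw [h.fderiv]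
  rfl

end

namespace OCP

variable {nx nu np ng : ℕ} (P : OCP nx nu np ng)

/-- The space `𝒱^∞` in which the optimality system takes its values. -/
abbrev VSpace : Type := Lp (Vec nx) ⊤ P.μ × Vec nx × Lp (Vec nx) ⊤ P.μ × Vec nx ×
  Lp (Vec nu) ⊤ P.μ × Vec np

variable {P}

/-- `v` collects the residuals at `δz` of the equations of the sensitivity system for the
perturbation `δg` of the model function, in the order and with the signs of `ψ`. -/
structure IsLinearization (z : P.ZSpace ⊤) (g : P.G3) (δz : P.ZSpace ⊤) (δg : P.G3)
    (v : P.VSpace) : Prop where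
  state : v.1 =ᵐ[P.μ] fun t => P.dynJac z g ιx t (sobVal δz.1 t)
    + P.dynJac z g ιu t (δz.2.1 t) + P.dynJac z g ιp t δz.2.2.1 + P.sensR z g δg t - sobDer δz.1 t
  initial : v.2.1 = -sobVal δz.1 P.t₀
  costate : v.2.2.1 =ᵐ[P.μ] fun t => sobDer δz.2.2.2 t
    + ((P.dynJac z g ιx t).adjoint (P.lam δz t) + P.HRow z g ιx t (P.y δz t)
      + P.sensC z g δg ιx t)
  terminal : v.2.2.2.1 = P.φRowX z (P.endPt δz) - sobVal δz.2.2.2 P.tf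
  control : v.2.2.2.2.1 =ᵐ[P.μ] fun t => (P.dynJac z g ιu t).adjoint (P.lam δz t)
    + P.HRow z g ιu t (P.y δz t) + P.sensC z g δg ιu t
  parameter : v.2.2.2.2.2 = P.φRowP z (P.endPt δz)
    + ∫ t, (P.dynJac z g ιp t).adjoint (P.lam δz t) + P.HRow z g ιp t (P.y δz t)
      + P.sensC z g δg ιp t ∂P.μ

variable (hf : Smooth P.μ P.f) (hl : Smooth P.μ P.l)

/-- `∇_a H` along the trajectory for a factor `a`, as a function of `(z, g)`. -/
def hamGradOp {m : ℕ} (ι : Vec m →L[ℝ] YVal nx nu np) (x : P.ZGSpace) : Lp (Vec m) ⊤ P.μ :=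
  (gradL ι).compLpL ⊤ P.μ (hamOp hf hl x)

lemma contDiff_hamGradOp {m : ℕ} (ι : Vec m →L[ℝ] YVal nx nu np) :
    ContDiff ℝ 1 (hamGradOp hf hl ι) := by
  have h := ContDiff.compLpL (contDiff_hamOp hf hl) (gradL ι)
  have e : hamGradOp hf hl ι = fun x : P.ZGSpace => (gradL ι).compLpL ⊤ P.μ (hamOp hf hl x) := rfl
  rw [e]
  with_reducible exact h

variable (P) in
/-- The derivative of the state. -/
def stateDerL : P.ZGSpace →L[ℝ] Lp (Vec nx) ⊤ P.μ := (W1.derL P.lt.le ⊤).comp P.stateL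

variable (P) in
/-- The initial value of the state. -/
def initialL : P.ZGSpace →L[ℝ] Vec nx := (W1.evalL P.lt.le ⊤ P.t₀).comp P.stateL

variable (P) in
/-- The derivative of the costate. -/
def costateDerL : P.ZGSpace →L[ℝ] Lp (Vec nx) ⊤ P.μ := (W1.derL P.lt.le ⊤).comp P.costateL

variable (P) in
/-- The terminal value of the costate. -/
def terminalL : P.ZGSpace →L[ℝ] Vec nx := (W1.evalL P.lt.le ⊤ P.tf).comp P.costateL

/-- `∫ ∇_p H` along the trajectory, as a function of `(z, g)`. -/
def hamGradInt (x : P.ZGSpace) : Vec np := linftyIntegral univ (hamGradOp hf hl ιp x)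

/-- The partial gradient of `φ` at `(x(t_f), p)`, as a function of `(z, g)`. -/
def endGrad {m : ℕ} (ι : Vec m →L[ℝ] Vec nx × Vec np) (x : P.ZGSpace) : Vec m :=
  gradL ι (fderiv ℝ P.φ (P.endL x))

/-- The residual of the optimality system as a map between Banach spaces. -/
def residual : P.ZGSpace → P.VSpace :=
  systemMap P.stateDerL P.initialL P.x₀ P.costateDerL P.terminalL (dynOp hf) (hamGradOp hf hl ιx)
    (endGrad (ContinuousLinearMap.inl ℝ _ _)) (hamGradOp hf hl ιu)
    (endGrad (ContinuousLinearMap.inr ℝ _ _)) (hamGradInt hf hl)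

lemma residual_eq_zero_iff (x : P.ZGSpace) : residual hf hl x = 0 ↔ P.SolvesKKT x.1 x.2 := by
  have e1 : (residual hf hl x).1 =ᵐ[P.μ] (P.ψ x.1 x.2).1 := by
    filter_upwards [Lp.coeFn_sub (dynOp hf x) (P.stateDerL x),
      coeFn_dynOp hf x] with t h1 h2
    refine h1.trans ?_
    rw [Pi.sub_apply, h2]; rfl
  have e2 : ∀ {m : ℕ} (ι : Vec m →L[ℝ] YVal nx nu np),
      hamGradOp hf hl ι x =ᵐ[P.μ] P.hamGrad x.1 x.2 ι := fun ι => coeFn_gradL_hamOp hf hl x ι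
  have e3 : (residual hf hl x).2.2.1 =ᵐ[P.μ] (P.ψ x.1 x.2).2.2.1 := by
    filter_upwards [Lp.coeFn_add (P.costateDerL x) (hamGradOp hf hl ιx x),
      e2 ιx] with t h1 h2
    refine h1.trans ?_
    rw [Pi.add_apply, h2]; rfl
  have e6 : (residual hf hl x).2.2.2.2.2 = (P.ψ x.1 x.2).2.2.2.2.2 := by
    change _ + ∫ t in univ, hamGradOp hf hl ιp x t ∂P.μ = _ + _
    rw [setIntegral_univ, integral_congr_ae (e2 ιp)]; rfl
  have hz : ∀ {m : ℕ} (a : Lp (Vec m) ⊤ P.μ) {b : ℝ → Vec m}, a =ᵐ[P.μ] b → (a = 0 ↔ b =ᵐ[P.μ] 0) :=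
    fun a b hab => by
      rw [Lp.eq_zero_iff_ae_eq_zero]
      exact ⟨fun h => hab.symm.trans h, fun h => hab.trans h⟩
  rw [SolvesKKT, ← hz _ e1, ← hz _ e3, ← e6,
    ← show _ ↔ (P.ψ x.1 x.2).2.2.2.2.1 =ᵐ[P.μ] 0 from hz _ (e2 ιu)]
  simp only [Prod.ext_iff, Prod.fst_zero, Prod.snd_zero]
  rfl

lemma contDiff_endGrad (hφ : ContDiff ℝ 2 P.φ) {m : ℕ} (ι : Vec m →L[ℝ] Vec nx × Vec np) :
    ContDiff ℝ 1 (endGrad (P := P) ι) := by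
  have h := contDiff_gradL_fderiv (E := P.ZGSpace) hφ P.endL ι
  have e : endGrad (P := P) ι = fun x : P.ZGSpace => gradL ι (fderiv ℝ P.φ (P.endL x)) := rfl
  rw [e]
  with_reducible exact h

lemma hasFDerivAt_endGrad (hφ : ContDiff ℝ 2 P.φ) {m : ℕ} (ι : Vec m →L[ℝ] Vec nx × Vec np)
    (x : P.ZGSpace) : ∃ D : P.ZGSpace →L[ℝ] Vec m, HasFDerivAt (endGrad ι) D x ∧
      ∀ δ : P.ZGSpace, D δ
        = pHess ι (ContinuousLinearMap.inl ℝ _ _) P.φ (P.endPt x.1) (P.endPt δ.1).1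
        + pHess ι (ContinuousLinearMap.inr ℝ _ _) P.φ (P.endPt x.1) (P.endPt δ.1).2 := by
  have h := hasFDerivAt_gradL_fderiv (E := P.ZGSpace) hφ P.endL ι x
  have e : endGrad (P := P) ι = fun x : P.ZGSpace => gradL ι (fderiv ℝ P.φ (P.endL x)) := rfl
  rw [← e] at h
  refine ⟨_, h, fun δ => ?_⟩
  rw [pHess_apply _ _ hφ, pHess_apply _ _ hφ, ← map_add, ← map_add]
  change gradL ι (fderiv ℝ (fderiv ℝ P.φ) (P.endPt x.1) (P.endPt δ.1)) = _
  simp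

lemma contDiff_hamGradInt : ContDiff ℝ 1 (hamGradInt hf hl) := by
  have h := (linftyIntegral (E := Vec np) (μ := P.μ) univ).contDiff.comp
    (contDiff_hamGradOp hf hl ιp)
  have e : hamGradInt hf hl
      = linftyIntegral (E := Vec np) (μ := P.μ) univ ∘ hamGradOp hf hl ιp := rfl
  rw [e]
  with_reducible exact h

lemma hasFDerivAt_hamGradInt {x : P.ZGSpace} {D : P.ZGSpace →L[ℝ] Lp (Vec np) ⊤ P.μ}
    (h : HasFDerivAt (hamGradOp hf hl ιp) D x) :
    HasFDerivAt (hamGradInt hf hl) ((linftyIntegral univ).comp D) x := by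
  have h := (linftyIntegral (E := Vec np) (μ := P.μ) univ).hasFDerivAt.comp x h
  have e : hamGradInt hf hl
      = linftyIntegral (E := Vec np) (μ := P.μ) univ ∘ hamGradOp hf hl ιp := rfl
  rw [e]
  with_reducible exact h

lemma contDiff_residual (hφ : ContDiff ℝ 2 P.φ) : ContDiff ℝ 1 (residual hf hl) := by
  have h := contDiff_systemMap (E := P.ZGSpace) P.stateDerL P.initialL P.x₀ P.costateDerL
    P.terminalL (contDiff_dynOp hf) (contDiff_hamGradOp hf hl ιx)
    (contDiff_endGrad hφ (ContinuousLinearMap.inl ℝ _ _))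
    (contDiff_hamGradOp hf hl ιu) (contDiff_endGrad hφ (ContinuousLinearMap.inr ℝ _ _))
    (contDiff_hamGradInt hf hl)
  rw [residual]
  with_reducible exact h

/-- The derivative of the residual is the residual of the sensitivity system. -/
lemma isLinearization_fderiv_residual (hφ : ContDiff ℝ 2 P.φ) (x δ : P.ZGSpace) :
    IsLinearization x.1 x.2 δ.1 δ.2 (fderiv ℝ (residual hf hl) x δ) := by
  obtain ⟨D₁, h1, h1'⟩ := hasLinftyDerivAt_dynOp hf x
  have hH : ∀ {m : ℕ} (ι : Vec m →L[ℝ] YVal nx nu np), ∃ D : P.ZGSpace →L[ℝ] Lp (Vec m) ⊤ P.μ,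
      HasFDerivAt (hamGradOp hf hl ι) D x ∧ ∀ δ, D δ =ᵐ[P.μ] fun t =>
        (P.dynJac x.1 x.2 ι t).adjoint (P.lam δ.1 t) + P.HRow x.1 x.2 ι t (P.y δ.1 t)
        + P.sensC x.1 x.2 δ.2 ι t := fun ι => hasLinftyDerivAt_gradL_hamOp hf hl x ι
  obtain ⟨D₃, h3, h3'⟩ := hH ιx
  obtain ⟨D₅, h5, h5'⟩ := hH ιu
  obtain ⟨D₆, h6, h6'⟩ := hH ιp
  obtain ⟨E₁, hE₁, hE₁'⟩ := hasFDerivAt_endGrad hφ (ContinuousLinearMap.inl ℝ _ _) x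
  obtain ⟨E₂, hE₂, hE₂'⟩ := hasFDerivAt_endGrad hφ (ContinuousLinearMap.inr ℝ _ _) x
  have h := fderiv_systemMap (E := P.ZGSpace) P.stateDerL P.initialL P.x₀ P.costateDerL
    P.terminalL h1 h3 hE₁ h5 hE₂ (hasFDerivAt_hamGradInt hf hl h6) δ
  rw [← residual] at h
  rw [h]
  refine ⟨?_, rfl, ?_, ?_, h5' δ, ?_⟩
  · filter_upwards [Lp.coeFn_sub (D₁ δ) (P.stateDerL δ), h1' δ] with t a b
    refine a.trans ?_
    rw [Pi.sub_apply, b]; rfl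
  · filter_upwards [Lp.coeFn_add (P.costateDerL δ) (D₃ δ), h3' δ] with t a b
    refine a.trans ?_
    rw [Pi.add_apply, b]; rfl
  · change E₁ δ - _ = _
    rw [hE₁']; rfl
  · change E₂ δ + ∫ t in univ, D₆ δ t ∂P.μ = _
    rw [hE₂', setIntegral_univ, integral_congr_ae (h6' δ)]; rfl

end OCP

/-! ### Coefficients of the linearized system -/

lemma ae_mem_uIoc_of_timeMeasure {t₀ tf : ℝ} {p : ℝ → Prop} (h : ∀ᵐ s ∂(timeMeasure t₀ tf), p s)
    {t : ℝ} (ht : t ∈ Icc t₀ tf) : ∀ᵐ s, s ∈ uIoc t₀ t → p s := by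
  rw [timeMeasure, restrict_Ioo_eq_restrict_Ioc, ae_restrict_iff' measurableSet_Ioc] at h
  filter_upwards [h] with s hs hs'
  rw [uIoc_of_le ht.1] at hs'
  exact hs ⟨hs'.1, hs'.2.trans ht.2⟩

lemma W1.sobVal_ofDeriv_zero {n : ℕ} {t₀ tf : ℝ} {h : t₀ ≤ tf} {q : ℝ≥0∞} [Fact (1 ≤ q)]
    (a : Vec n) {t : ℝ} (ht : t ∈ Icc t₀ tf) :
    sobVal (W1.ofDeriv h a (0 : Lp (Vec n) q (timeMeasure t₀ tf))) t = a := by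
  rw [sobVal_ofDeriv a _ ht, intervalIntegral.integral_zero_ae, add_zero]
  exact ae_mem_uIoc_of_timeMeasure (Lp.coeFn_zero _ _ _) ht

lemma ae_timeMeasure_mem_Icc (t₀ tf : ℝ) : ∀ᵐ t ∂(timeMeasure t₀ tf), t ∈ Icc t₀ tf := by
  filter_upwards [ae_restrict_mem (μ := volume) (measurableSet_Ioo (a := t₀) (b := tf))] with t ht
    using Ioo_subset_Icc_self ht

section

variable {α : Type*} [MeasurableSpace α] {μ : Measure α} {V E : Type*}
  [NormedAddCommGroup V] [NormedSpace ℝ V] [FiniteDimensional ℝ V]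
  [NormedAddCommGroup E] [NormedSpace ℝ E] {p : ℝ≥0∞}

lemma memLp_clm_of_apply {T : α → V →L[ℝ] E} (h : ∀ v, MemLp (fun t => T t v) p μ) :
    MemLp T p μ := by
  let b := Module.finBasis ℝ V
  obtain ⟨C, hC, hb⟩ := b.exists_opNorm_le (F := E)
  have hs : MemLp (fun t => C * ∑ i, ‖T t (b i)‖) p μ :=
    (memLp_finsetSum Finset.univ fun i _ => (h (b i)).norm).const_mul C
  refine hs.mono (aestronglyMeasurable_clm fun v => (h v).1) (Eventually.of_forall fun t => ?_)
  have hM : 0 ≤ ∑ i, ‖T t (b i)‖ := Finset.sum_nonneg fun i _ => norm_nonneg _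
  rw [Real.norm_of_nonneg (by positivity)]
  exact hb hM fun i =>
    Finset.single_le_sum (f := fun i => ‖T t (b i)‖) (fun i _ => norm_nonneg _) (Finset.mem_univ i)

omit [FiniteDimensional ℝ V] in
lemma MeasureTheory.MemLp.clm_apply_of_top {T : α → V →L[ℝ] E} {v : α → V} (hT : MemLp T ⊤ μ)
    (hv : MemLp v p μ) : MemLp (fun t => T t (v t)) p μ :=
  (ContinuousLinearMap.id ℝ (V →L[ℝ] E)).memLp_of_bilin p hT hv

lemma memLp_adjoint {m k : ℕ} {T : α → Vec m →L[ℝ] Vec k} (hT : MemLp T p μ) :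
    MemLp (fun t => (T t).adjoint) p μ :=
  hT.of_le (ContinuousLinearMap.adjoint.continuous.comp_aestronglyMeasurable hT.1)
    (Eventually.of_forall fun _ => (LinearIsometryEquiv.norm_map _ _).le)

lemma integrable_inner_of_top {n : ℕ} [IsFiniteMeasure μ] {v w : α → Vec n} (hv : MemLp v ⊤ μ)
    (hw : Integrable w μ) : Integrable (fun t => inner ℝ (v t) (w t)) μ :=
  memLp_one_iff_integrable.1 ((innerSL ℝ).memLp_of_bilin 1 hv (memLp_one_iff_integrable.2 hw))

lemma integrable_inner_of_two {n : ℕ} {v w : α → Vec n} (hv : MemLp v 2 μ)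
    (hw : MemLp w 2 μ) : Integrable (fun t => inner ℝ (v t) (w t)) μ :=
  memLp_one_iff_integrable.1 ((innerSL ℝ).memLp_of_bilin 1 hv hw)

end

namespace OCP

variable {nx nu np ng : ℕ} {P : OCP nx nu np ng}

lemma ae_rep_zero : ∀ᵐ t ∂P.μ, (0 : P.G3).rep t = 0 := by
  filter_upwards [ModelSpace.rep_smul (0 : ℝ) (0 : P.G3)] with t ht
  funext y
  have h := ht y
  rw [zero_smul, zero_smul] at h
  exact h

lemma ae_sensR_zero (z : P.ZSpace ⊤) (g : P.G3) : ∀ᵐ t ∂P.μ, P.sensR z g 0 t = 0 := by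
  filter_upwards [ae_rep_zero (P := P)] with t ht
  rw [sensR, δgAt, ht, Pi.zero_apply, map_zero]

lemma ae_sensC_zero (z : P.ZSpace ⊤) (g : P.G3) {m : ℕ} (ι : Vec m →L[ℝ] YVal nx nu np) :
    ∀ᵐ t ∂P.μ, P.sensC z g 0 ι t = 0 := by
  filter_upwards [ae_rep_zero (P := P)] with t ht
  have e : P.gJac z ι 0 t = 0 := by
    rw [gJac, ht, pJac, fderiv_zero]; simp
  rw [sensC, e, δgAt, ht, Pi.zero_apply, map_zero]
  simp

lemma RegularAt.H_apply {g : P.G3} {t : ℝ} (h : P.RegularAt g t) (z : P.ZSpace ⊤) {m k : ℕ}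
    (ι : Vec m →L[ℝ] YVal nx nu np) (κ : Vec k →L[ℝ] YVal nx nu np) (b : Vec k) :
    P.H z g ι κ t b = P.HRow z g ι t (κ b) := by
  refine ext_inner_left ℝ fun a => ?_
  rw [h.inner_H, h.inner_HRow]

/-- The coefficients of the linearized system along `(z, g)` are measurable and essentially
bounded. -/
structure BddCoeff (z : P.ZSpace ⊤) (g : P.G3) : Prop where
  regular : ∀ᵐ t ∂P.μ, P.RegularAt g t
  dyn : ∀ {m : ℕ} (ι : Vec m →L[ℝ] YVal nx nu np), MemLp (P.dynJac z g ι) ⊤ P.μ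
  H : ∀ {m k : ℕ} (ι : Vec m →L[ℝ] YVal nx nu np) (κ : Vec k →L[ℝ] YVal nx nu np),
    MemLp (P.H z g ι κ) ⊤ P.μ
  sensC : ∀ δg {m : ℕ} (ι : Vec m →L[ℝ] YVal nx nu np), MemLp (P.sensC z g δg ι) ⊤ P.μ

variable (P) in
/-- The constant variation `c` of the trajectory. -/
def constPath (c : YVal nx nu np) : P.ZGSpace :=
  ((W1.ofDeriv P.lt.le c.1 0, Lp.const ⊤ P.μ c.2.1, c.2.2, 0), 0)

lemma ae_constPath (c : YVal nx nu np) : ∀ᵐ t ∂P.μ, sobVal (P.constPath c).1.1 t = c.1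
    ∧ (P.constPath c).1.2.1 t = c.2.1 := by
  filter_upwards [ae_timeMeasure_mem_Icc P.t₀ P.tf, Lp.coeFn_const (p := ⊤) (μ := P.μ) c.2.1]
    with t h1 h2
  exact ⟨W1.sobVal_ofDeriv_zero _ h1, h2⟩

/-- Boundedness of the coefficients is read off from the fact that the derivatives of the
superposition operators map constant variations to essentially bounded functions. -/
lemma bddCoeff (hf : Smooth P.μ P.f) (hl : Smooth P.μ P.l) (z : P.ZSpace ⊤) (g : P.G3) :
    BddCoeff z g := by
  obtain ⟨D₁, -, h1⟩ := hasLinftyDerivAt_dynOp hf (z, g)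
  have hreg := P.ae_regularAt hf hl g
  have h0 : ∀ᵐ t ∂P.μ, (0 : P.USpace ⊤) t = 0 := Lp.coeFn_zero _ _ _
  refine ⟨hreg, fun ι => memLp_clm_of_apply fun b => ?_, fun ι κ => memLp_clm_of_apply fun b => ?_,
    fun δg m ι => ?_⟩
  · refine (Lp.memLp (D₁ (P.constPath (ι b)))).ae_eq ?_
    filter_upwards [h1 (P.constPath (ι b)), ae_constPath (P := P) (ι b), ae_sensR_zero z g]
      with t a1 a2 a3
    rw [a1]
    have e : (P.constPath (ι b)).2 = 0 := rfl
    have e' : (P.constPath (ι b)).1.2.2.1 = (ι b).2.2 := rfl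
    rw [a2.1, a2.2, e, a3, e', add_zero, dynJac_apply, dynJac_apply, dynJac_apply, dynJac_apply,
      ← map_add, ← map_add, ← map_add, ← map_add, ← eq_ι_add]
  · obtain ⟨D, -, h2⟩ := hasLinftyDerivAt_gradL_hamOp hf hl (z, g) ι
    refine (Lp.memLp (D (P.constPath (κ b)))).ae_eq ?_
    filter_upwards [h2 (P.constPath (κ b)), ae_constPath (P := P) (κ b), ae_sensC_zero z g ι, hreg]
      with t a1 a2 a3 a4
    rw [a1]
    have e : (P.constPath (κ b)).2 = 0 := rfl
    have e' : P.y (P.constPath (κ b)).1 t = κ b := Prod.ext a2.1 (Prod.ext a2.2 rfl)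
    have e'' : P.lam (P.constPath (κ b)).1 t = 0 := rfl
    rw [e, a3, e', e'', map_zero, add_zero, zero_add, a4.H_apply]
  · obtain ⟨D, -, h2⟩ := hasLinftyDerivAt_gradL_hamOp hf hl (z, g) ι
    refine (Lp.memLp (D (0, δg))).ae_eq ?_
    filter_upwards [h2 (0, δg), h0] with t a1 a2
    rw [a1]
    have e : P.lam (0 : P.ZSpace ⊤) t = 0 := rfl
    have e' : P.y (0 : P.ZSpace ⊤) t = 0 := Prod.ext rfl (Prod.ext a2 rfl)
    rw [e, e', HRow]
    simp

end OCP

/-! ### Linear differential equations with essentially bounded coefficients -/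

section LinearODE

variable {E : Type*} [NormedAddCommGroup E] [NormedSpace ℝ E] [CompleteSpace E] {t₀ tf : ℝ}

lemma intervalIntegrable_of_integrable_timeMeasure {w : ℝ → E} (h : t₀ ≤ tf)
    (hw : Integrable w (timeMeasure t₀ tf)) {s t : ℝ} (hs : s ∈ Icc t₀ tf) (ht : t ∈ Icc t₀ tf) :
    IntervalIntegrable w volume s t := by
  refine (intervalIntegrable_of_timeMeasure h hw).mono_set ?_
  rw [uIcc_of_le h]
  exact ordConnected_Icc.uIcc_subset hs ht

variable {A : ℝ → E →L[ℝ] E} {b : ℝ → E}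

lemma integrable_clm_apply_add (h : t₀ ≤ tf) (hA : MemLp A ⊤ (timeMeasure t₀ tf))
    (hb : Integrable b (timeMeasure t₀ tf)) (x : C(Icc t₀ tf, E)) :
    Integrable (fun s => A s (IccExtend h x s) + b s) (timeMeasure t₀ tf) := by
  have hx : MemLp (IccExtend h x) ⊤ (timeMeasure t₀ tf) :=
    memLp_top_of_bound x.continuous.Icc_extend'.aestronglyMeasurable ‖x‖
      (Eventually.of_forall fun t => x.norm_coe_le_norm _)
  exact ((hA.clm_apply_of_top hx).integrable le_top).add hb

/-- The Picard operator of `x' = A x + b`, `x(t₀) = a`. -/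
def picard (h : t₀ ≤ tf) (hA : MemLp A ⊤ (timeMeasure t₀ tf))
    (hb : Integrable b (timeMeasure t₀ tf)) (a : E) (x : C(Icc t₀ tf, E)) : C(Icc t₀ tf, E) where
  toFun t := a + ∫ s in t₀..t, (A s (IccExtend h x s) + b s)
  continuous_toFun := by
    have h1 := intervalIntegral.continuousOn_primitive_interval' (a := t₀)
      (intervalIntegrable_of_integrable_timeMeasure h (integrable_clm_apply_add h hA hb x)
        ⟨le_rfl, h⟩ ⟨h, le_rfl⟩) (by simp)
    rw [uIcc_of_le h] at h1
    exact continuous_const.add (continuousOn_iff_continuous_domRestrict.1 h1)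

/-- Iterates of the Picard operator are Lipschitz with the constants `(K (t - t₀))ⁿ / n!`, so that
some iterate is a contraction on all of `[t₀, t_f]`. -/
lemma norm_picard_iterate_sub_le (h : t₀ ≤ tf) (hA : MemLp A ⊤ (timeMeasure t₀ tf))
    (hb : Integrable b (timeMeasure t₀ tf)) (a : E) {K : ℝ} (hK0 : 0 ≤ K)
    (hK : ∀ᵐ t ∂(timeMeasure t₀ tf), ‖A t‖ ≤ K) (x y : C(Icc t₀ tf, E)) (n : ℕ)
    (t : Icc t₀ tf) :
    ‖((picard h hA hb a)^[n] x) t - ((picard h hA hb a)^[n] y) t‖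
      ≤ (K * (t - t₀)) ^ n / n.factorial * dist x y := by
  induction n generalizing t with
  | zero => simpa [dist_eq_norm] using (x - y).norm_coe_le_norm t
  | succ n ih =>
    rw [Function.iterate_succ_apply', Function.iterate_succ_apply']
    set x' := (picard h hA hb a)^[n] x
    set y' := (picard h hA hb a)^[n] y
    have hi := fun z => intervalIntegrable_of_integrable_timeMeasure h
      (integrable_clm_apply_add h hA hb z) ⟨le_rfl, h⟩ t.2
    have e : picard h hA hb a x' t - picard h hA hb a y' t
        = ∫ s in t₀..t, ((A s (IccExtend h x' s) + b s) - (A s (IccExtend h y' s) + b s)) := by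
      rw [intervalIntegral.integral_sub (hi x') (hi y')]
      simp [picard]
    rw [e]
    have hle : ∀ᵐ s, s ∈ Ioc t₀ (t : ℝ) →
        ‖(A s (IccExtend h x' s) + b s) - (A s (IccExtend h y' s) + b s)‖
          ≤ K * ((K * (s - t₀)) ^ n / n.factorial * dist x y) := by
      have := ae_mem_uIoc_of_timeMeasure hK t.2
      rw [uIoc_of_le t.2.1] at this
      filter_upwards [this] with s hs hs'
      have hsI : s ∈ Icc t₀ tf := ⟨hs'.1.le, hs'.2.trans t.2.2⟩
      have h1 := ih ⟨s, hsI⟩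
      rw [add_sub_add_right_eq_sub, ← map_sub, IccExtend_of_mem h _ hsI, IccExtend_of_mem h _ hsI]
      exact ((A s).le_opNorm _).trans (mul_le_mul (hs hs') h1 (norm_nonneg _) hK0)
    refine (intervalIntegral.norm_integral_le_of_norm_le t.2.1 hle
      (Continuous.intervalIntegrable (by fun_prop) _ _)).trans_eq ?_
    have e2 : (fun s : ℝ => K * ((K * (s - t₀)) ^ n / n.factorial * dist x y))
        = fun s => (K ^ (n + 1) / n.factorial * dist x y) * (s - t₀) ^ n := by
      funext s; rw [mul_pow]; ring
    rw [e2, intervalIntegral.integral_const_mul,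
      intervalIntegral.integral_comp_sub_right (fun s => s ^ n) t₀, integral_pow, sub_self,
      zero_pow (Nat.succ_ne_zero n), Nat.factorial_succ, mul_pow]
    push_cast
    field_simp
    ring

/-- A linear differential equation with essentially bounded coefficients has a Carathéodory
solution with given initial value. -/
lemma exists_linearODE_solution (h : t₀ ≤ tf) (hA : MemLp A ⊤ (timeMeasure t₀ tf))
    (hb : Integrable b (timeMeasure t₀ tf)) (a : E) :
    ∃ x : ℝ → E, Continuous x ∧ ∀ t ∈ Icc t₀ tf, x t = a + ∫ s in t₀..t, (A s (x s) + b s) := by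
  obtain ⟨K, hK0, hK⟩ : ∃ K : ℝ, 0 ≤ K ∧ ∀ᵐ t ∂(timeMeasure t₀ tf), ‖A t‖ ≤ K := by
    refine ⟨‖hA.toLp‖, norm_nonneg _, ?_⟩
    filter_upwards [Lp.ae_norm_le_norm_top hA.toLp, hA.coeFn_toLp] with t h1 h2
    rwa [h2] at h1
  obtain ⟨n, hn⟩ :=
    ((FloorSemiring.tendsto_pow_div_factorial_atTop (K * (tf - t₀))).eventually_lt_const
    (zero_lt_one' ℝ)).exists
  have hd : 0 ≤ K * (tf - t₀) := mul_nonneg hK0 (sub_nonneg.2 h)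
  have hc : ContractingWith ((K * (tf - t₀)) ^ n / n.factorial).toNNReal
      (picard h hA hb a)^[n] := by
    refine ⟨by rw [← NNReal.coe_lt_coe, Real.coe_toNNReal _ (by positivity)]; exact_mod_cast hn,
      LipschitzWith.of_dist_le_mul fun x y => ?_⟩
    rw [Real.coe_toNNReal _ (by positivity), ContinuousMap.dist_le (by positivity)]
    intro t
    rw [dist_eq_norm]
    refine (norm_picard_iterate_sub_le h hA hb a hK0 hK x y n t).trans ?_
    have h1 : 0 ≤ (t : ℝ) - t₀ := sub_nonneg.2 t.2.1
    gcongr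
    exact t.2.2
  have hfix := hc.isFixedPt_fixedPoint_iterate
  set x := ContractingWith.fixedPoint _ hc
  refine ⟨IccExtend h x, x.continuous.Icc_extend', fun t ht => ?_⟩
  have h1 := congrArg (fun z : C(Icc t₀ tf, E) => z ⟨t, ht⟩) hfix
  rw [IccExtend_of_mem h _ ht]
  exact h1.symm

end LinearODE

/-! ### A criterion for surjectivity, and measurable inverses -/

section Surjectivity

variable {Z A F : Type*} [AddCommGroup Z] [Module ℝ Z]
  [AddCommGroup A] [Module ℝ A] [AddCommGroup F] [Module ℝ F] [FiniteDimensional ℝ F]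

/-- If a boundary value problem `(T_A, T_F)` has at most one solution, and the initial value problem
`(T_A, s)` with the same number of side conditions is solvable, then the boundary value problem is
solvable. -/
lemma exists_of_injective_of_initialValue (TA : Z →ₗ[ℝ] A) (TF s : Z →ₗ[ℝ] F)
    (hs : ∀ a f, ∃ z, TA z = a ∧ s z = f) (hinj : ∀ z w, TA z = TA w → TF z = TF w → z = w)
    (a : A) (f : F) : ∃ z, TA z = a ∧ TF z = f := by
  -- on the finite-dimensional kernel of `T_A`, both `s` and `T_F` are maps to `F`
  set N := LinearMap.ker TA
  have hTF : Function.Injective (TF.comp N.subtype) := by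
    intro z w hzw
    refine Subtype.ext (hinj _ _ ?_ hzw)
    exact (LinearMap.mem_ker.1 z.2).trans (LinearMap.mem_ker.1 w.2).symm
  have hsN : Function.Surjective (s.comp N.subtype) := fun f => by
    obtain ⟨z, h1, h2⟩ := hs 0 f
    exact ⟨⟨z, h1⟩, h2⟩
  have : FiniteDimensional ℝ N := FiniteDimensional.of_injective _ hTF
  have hrank : Module.finrank ℝ N = Module.finrank ℝ F :=
    le_antisymm (LinearMap.finrank_le_finrank_of_injective hTF)
      (LinearMap.finrank_le_finrank_of_surjective hsN)
  have hsurj : Function.Surjective (TF.comp N.subtype) :=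
    (LinearMap.injective_iff_surjective_of_finrank_eq_finrank hrank).1 hTF
  obtain ⟨z, h1, -⟩ := hs a 0
  obtain ⟨n, hn⟩ := hsurj (f - TF z)
  refine ⟨z + n, ?_, ?_⟩
  · simp [h1, LinearMap.mem_ker.1 n.2]
  · have : TF (n : Z) = f - TF z := hn
    simp [this]

end Surjectivity

lemma aestronglyMeasurable_ringInverse {α : Type*} [MeasurableSpace α] {μ : Measure α} {V : Type*}
    [NormedAddCommGroup V] [NormedSpace ℝ V] [FiniteDimensional ℝ V] {T : α → V →L[ℝ] V}
    (hT : AEStronglyMeasurable T μ) : AEStronglyMeasurable (fun t => Ring.inverse (T t)) μ := by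
  have : CompleteSpace V := FiniteDimensional.complete ℝ V
  borelize (V →L[ℝ] V)
  have h1 : Measurable (Ring.inverse : (V →L[ℝ] V) → V →L[ℝ] V) := by
    have hu : IsOpen {x : V →L[ℝ] V | IsUnit x} := Units.isOpen
    have hc : ContinuousOn (Ring.inverse : (V →L[ℝ] V) → V →L[ℝ] V) {x | IsUnit x} := by
      rintro _ ⟨x, rfl⟩
      exact (NormedRing.inverse_continuousAt x).continuousWithinAt
    classical
    have e : (Ring.inverse : (V →L[ℝ] V) → V →L[ℝ] V)
        = {x | IsUnit x}.piecewise Ring.inverse (fun _ => 0) := by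
      funext x
      by_cases hx : IsUnit x
      · rw [piecewise_eq_of_mem _ _ _ (show x ∈ {x | IsUnit x} from hx)]
      · rw [piecewise_eq_of_notMem _ _ _ (show x ∉ {x | IsUnit x} from hx),
          Ring.inverse_non_unit x hx]
    rw [e]
    exact hc.measurable_piecewise continuousOn_const hu.measurableSet
  have : FiniteDimensional ℝ (V →L[ℝ] V) := inferInstance
  have : ProperSpace (V →L[ℝ] V) := FiniteDimensional.proper ℝ _
  exact (h1.comp_aemeasurable hT.aemeasurable).aestronglyMeasurable

/-- Pointwise inverses with a uniform bound form an essentially bounded function; measurability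
holds because inversion is continuous on the open set of invertible maps. -/
lemma memLp_ringInverse {α : Type*} [MeasurableSpace α] {μ : Measure α} [IsFiniteMeasure μ]
    {V : Type*} [NormedAddCommGroup V] [NormedSpace ℝ V] [FiniteDimensional ℝ V]
    {T : α → V →L[ℝ] V} (hT : AEStronglyMeasurable T μ) {M : ℝ}
    (h : ∀ᵐ t ∂μ, ∃ J : V →L[ℝ] V, J.comp (T t) = ContinuousLinearMap.id ℝ _ ∧
      (T t).comp J = ContinuousLinearMap.id ℝ _ ∧ ‖J‖ ≤ M) :
    MemLp (fun t => Ring.inverse (T t)) ⊤ μ ∧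
      ∀ᵐ t ∂μ, ∀ v, T t (Ring.inverse (T t) v) = v := by
  have h' : ∀ᵐ t ∂μ, (∀ v, T t (Ring.inverse (T t) v) = v) ∧ ‖Ring.inverse (T t)‖ ≤ M := by
    filter_upwards [h] with t ⟨J, h1, h2, h3⟩
    have e : Ring.inverse (T t) = J := Ring.inverse_unit ⟨T t, J, h2, h1⟩
    rw [e]
    exact ⟨fun v => congrArg (fun S : V →L[ℝ] V => S v) h2, h3⟩
  exact ⟨memLp_top_of_bound (aestronglyMeasurable_ringInverse hT) M (h'.mono fun t ht => ht.2),
    h'.mono fun t ht => ht.1⟩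

/-! ### The linear-quadratic problem -/

namespace OCP

variable {nx nu np ng : ℕ} {P : OCP nx nu np ng}

/-- The values `(δx(t), δu(t), δp)` of a variation of the trajectory. -/
def yq {q : ℝ≥0∞} [Fact (1 ≤ q)] (v : P.YSpace q) (t : ℝ) : YVal nx nu np :=
  (sobVal v.1 t, v.2.1 t, v.2.2)

/-- The part `(δx, δu, δp)` of `(δx, δu, δp, δλ)`. -/
def yPart {q : ℝ≥0∞} [Fact (1 ≤ q)] (δz : P.ZSpace q) : P.YSpace q := (δz.1, δz.2.1, δz.2.2.1)

/-- The values of a variation at the final time. -/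
def endq {q : ℝ≥0∞} [Fact (1 ≤ q)] (v : P.YSpace q) : Vec nx × Vec np := (sobVal v.1 P.tf, v.2.2)

lemma ae_yq_add {q : ℝ≥0∞} [Fact (1 ≤ q)] (v v' : P.YSpace q) :
    ∀ᵐ t ∂P.μ, yq (v + v') t = yq v t + yq v' t := by
  filter_upwards [Lp.coeFn_add v.2.1 v'.2.1] with t ht
  exact Prod.ext rfl (Prod.ext ht rfl)

section EndpointCost

lemma φRow_inner (hφ : ContDiff ℝ 2 P.φ) (z : P.ZSpace ⊤) (v w : Vec nx × Vec np) :
    inner ℝ w.1 (P.φRowX z v) + inner ℝ w.2 (P.φRowP z v)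
      = fderiv ℝ (fderiv ℝ P.φ) (P.endPt z) v w := by
  have e : ∀ v : Vec nx × Vec np,
      v = ContinuousLinearMap.inl ℝ _ _ v.1 + ContinuousLinearMap.inr ℝ _ _ v.2 := by simp
  rw [φRowX, φRowP, inner_add_right, inner_add_right, inner_pHess _ _ hφ, inner_pHess _ _ hφ,
    inner_pHess _ _ hφ, inner_pHess _ _ hφ, ← add_apply, ← add_apply, ← map_add, ← map_add]
  conv_rhs => rw [e v, e w]

lemma φQuad_add (hφ : ContDiff ℝ 2 P.φ) (z : P.ZSpace ⊤) (v w : Vec nx × Vec np) :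
    P.φQuad z (v + w) = P.φQuad z v
      + 2 * (inner ℝ w.1 (P.φRowX z v) + inner ℝ w.2 (P.φRowP z v)) + P.φQuad z w := by
  have h := hφ.fderiv_fderiv_symm (P.endPt z) v w
  simp only [φQuad]
  rw [φRow_inner hφ, φRow_inner hφ, φRow_inner hφ, φRow_inner hφ]
  simp only [map_add, add_apply]
  linarith

end EndpointCost

variable {z : P.ZSpace ⊤} {g : P.G3}

section Integrability

variable {q : ℝ≥0∞} [Fact (1 ≤ q)]

lemma BddCoeff.memLp_HRow (hB : BddCoeff z g) (v : P.YSpace q) {m : ℕ}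
    (ι : Vec m →L[ℝ] YVal nx nu np) : MemLp (fun t => P.HRow z g ι t (yq v t)) q P.μ :=
  (((hB.H ι ιx).clm_apply_of_top ((W1.memLp_sobVal v.1).mono_exponent le_top)).add
    ((hB.H ι ιu).clm_apply_of_top (Lp.memLp v.2.1))).add
    ((hB.H ι ιp).clm_apply_of_top (memLp_const v.2.2))

lemma BddCoeff.memLp_adjoint_dynJac (hB : BddCoeff z g) (lam : P.XSpace q) {m : ℕ}
    (ι : Vec m →L[ℝ] YVal nx nu np) :
    MemLp (fun t => (P.dynJac z g ι t).adjoint (sobVal lam t)) q P.μ :=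
  (memLp_adjoint (hB.dyn ι)).clm_apply_of_top ((W1.memLp_sobVal lam).mono_exponent le_top)

/-- The mixed term of the quadratic form of the linear-quadratic problem. -/
def mixed (z : P.ZSpace ⊤) (g : P.G3) (v h : P.YSpace 2) (t : ℝ) : ℝ :=
  inner ℝ (sobVal h.1 t) (P.HRow z g ιx t (yq v t)) + inner ℝ (h.2.1 t) (P.HRow z g ιu t (yq v t))
    + inner ℝ h.2.2 (P.HRow z g ιp t (yq v t))

lemma integrable_mixed (hB : BddCoeff z g) (v h : P.YSpace 2) :
    Integrable (mixed z g v h) P.μ :=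
  ((integrable_inner_of_top (W1.memLp_sobVal h.1) ((hB.memLp_HRow v ιx).integrable one_le_two)).add
    (integrable_inner_of_two (Lp.memLp h.2.1) (hB.memLp_HRow v ιu))).add
    (integrable_inner_of_top (memLp_const h.2.2) ((hB.memLp_HRow v ιp).integrable one_le_two))

lemma mixed_self (v : P.YSpace 2) : mixed z g v v = fun t => P.HQuad z g t (yq v t) := rfl

lemma ae_HQuad_add (hB : BddCoeff z g) (v h : P.YSpace 2) : ∀ᵐ t ∂P.μ,
    P.HQuad z g t (yq (v + h) t)
      = P.HQuad z g t (yq v t) + 2 * mixed z g v h t + P.HQuad z g t (yq h t) := by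
  filter_upwards [hB.regular, ae_yq_add v h] with t ht e
  have e2 : mixed z g v h t = P.hessForm z g t (yq v t) (yq h t) := by
    rw [mixed, ht.inner_HRow, ht.inner_HRow, ht.inner_HRow, ← hessForm_add_right,
      ← hessForm_add_right]
    exact congrArg _ (eq_ι_add (yq h t)).symm
  have := ht.hessForm_symm (z := z) (yq v t) (yq h t)
  rw [e, ht.HQuad_eq, ht.HQuad_eq, ht.HQuad_eq, e2]
  simp only [hessForm_add_left, hessForm_add_right]
  linarith

lemma integrable_linear (cx : ℝ → Vec nx) (cu : ℝ → Vec nu) (hx : MemLp cx ⊤ P.μ)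
    (hu : MemLp cu ⊤ P.μ) (v : P.YSpace 2) :
    Integrable (fun t => inner ℝ (cx t) (sobVal v.1 t) + inner ℝ (cu t) (v.2.1 t)) P.μ :=
  (integrable_inner_of_top hx ((W1.memLp_sobVal v.1).integrable le_top)).add
    (integrable_inner_of_top hu ((Lp.memLp v.2.1).integrable one_le_two))

end Integrability

/-- Second-order expansion of the cost of the linear-quadratic problem. -/
lemma lqCost_add (hB : BddCoeff z g) (hφ : ContDiff ℝ 2 P.φ) {cx : ℝ → Vec nx} {cu : ℝ → Vec nu}
    (hx : MemLp cx ⊤ P.μ) (hu : MemLp cu ⊤ P.μ) (γ : Vec np) (v h : P.YSpace 2) :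
    P.lqCost z g cx cu 0 γ (v + h) = P.lqCost z g cx cu 0 γ v
      + ((∫ t, inner ℝ (cx t) (sobVal h.1 t) + inner ℝ (cu t) (h.2.1 t) ∂P.μ)
        + (∫ t, mixed z g v h t ∂P.μ) + inner ℝ γ h.2.2
        + (inner ℝ (endq h).1 (P.φRowX z (endq v)) + inner ℝ (endq h).2 (P.φRowP z (endq v))))
      + (1 / 2) * (∫ t, P.HQuad z g t (yq h t) ∂P.μ) + (1 / 2) * P.φQuad z (endq h) := by
  have e1 : ∫ t, inner ℝ (cx t) (sobVal (v + h).1 t) + inner ℝ (cu t) ((v + h).2.1 t) ∂P.μ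
      = (∫ t, inner ℝ (cx t) (sobVal v.1 t) + inner ℝ (cu t) (v.2.1 t) ∂P.μ)
        + ∫ t, inner ℝ (cx t) (sobVal h.1 t) + inner ℝ (cu t) (h.2.1 t) ∂P.μ := by
    rw [← integral_add (integrable_linear cx cu hx hu v) (integrable_linear cx cu hx hu h)]
    refine integral_congr_ae ?_
    filter_upwards [Lp.coeFn_add v.2.1 h.2.1] with t ht
    have a1 : sobVal (v + h).1 t = sobVal v.1 t + sobVal h.1 t := rfl
    have a2 : (v + h).2.1 t = v.2.1 t + h.2.1 t := ht
    rw [a1, a2, inner_add_right, inner_add_right]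
    ring
  have e2 : ∫ t, P.HQuad z g t (yq (v + h) t) ∂P.μ = (∫ t, P.HQuad z g t (yq v t) ∂P.μ)
      + 2 * (∫ t, mixed z g v h t ∂P.μ) + ∫ t, P.HQuad z g t (yq h t) ∂P.μ := by
    have i1 : Integrable (fun t => P.HQuad z g t (yq v t)) P.μ := integrable_mixed hB v v
    have i2 : Integrable (fun t => P.HQuad z g t (yq h t)) P.μ := integrable_mixed hB h h
    have i3 := (integrable_mixed hB v h).const_mul 2
    have i4 : Integrable (fun t => P.HQuad z g t (yq v t) + 2 * mixed z g v h t) P.μ := i1.add i3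
    rw [integral_congr_ae (ae_HQuad_add hB v h), integral_add i4 i2, integral_add i1 i3,
      integral_const_mul]
  have e3 : P.φQuad z (endq (v + h)) = P.φQuad z (endq v)
      + 2 * (inner ℝ (endq h).1 (P.φRowX z (endq v)) + inner ℝ (endq h).2 (P.φRowP z (endq v)))
      + P.φQuad z (endq h) := φQuad_add hφ z (endq v) (endq h)
  have e4 : (v + h).2.2 = v.2.2 + h.2.2 := rfl
  have e5 : ∀ v : P.YSpace 2, P.lqCost z g cx cu 0 γ v
      = (∫ t, inner ℝ (cx t) (sobVal v.1 t) + inner ℝ (cu t) (v.2.1 t) ∂P.μ)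
      + (1 / 2) * (∫ t, P.HQuad z g t (yq v t) ∂P.μ) + inner ℝ γ v.2.2
      + (1 / 2) * P.φQuad z (endq v) := fun v => by
    rw [lqCost, inner_zero_left, zero_add]; rfl
  rw [e5, e5, e1, e2, e3, e4, inner_add_right]
  ring

/-- A solution of the sensitivity system is a stationary point of the linear-quadratic problem:
integration by parts eliminates the costate. -/
lemma SolvesSens.stationary (hB : BddCoeff z g) {δg : P.G3} {δz : P.ZSpace 2}
    (hs : P.SolvesSens z g δg δz) {h : P.YSpace 2} (hh : P.LinDynamics z g 0 0 h) :
    (∫ t, inner ℝ (P.sensC z g δg ιx t) (sobVal h.1 t)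
        + inner ℝ (P.sensC z g δg ιu t) (h.2.1 t) ∂P.μ)
      + (∫ t, mixed z g (yPart δz) h t ∂P.μ)
      + inner ℝ (∫ t, P.sensC z g δg ιp t ∂P.μ) h.2.2
      + (inner ℝ (endq h).1 (P.φRowX z (sobVal δz.1 P.tf, δz.2.2.1))
        + inner ℝ (endq h).2 (P.φRowP z (sobVal δz.1 P.tf, δz.2.2.1))) = 0 := by
  set v : P.YSpace 2 := yPart δz with hv
  set G : ℝ → Vec np := fun t => P.HRow z g ιp t (yq v t)
    + (P.dynJac z g ιp t).adjoint (sobVal δz.2.2.2 t) with hG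
  have iG : Integrable G P.μ := ((hB.memLp_HRow v ιp).integrable one_le_two).add
    ((hB.memLp_adjoint_dynJac δz.2.2.2 ιp).integrable one_le_two)
  have iL := integrable_linear _ _ (hB.sensC δg ιx) (hB.sensC δg ιu) h
  have iM := integrable_mixed hB v h
  have iP : Integrable (fun t => inner ℝ h.2.2 (G t)) P.μ :=
    integrable_inner_of_top (memLp_const h.2.2) iG
  have hparts := integral_inner_sobDer P.lt δz.2.2.2 h.1
  have hpt : ∀ᵐ t ∂P.μ, inner ℝ (sobDer δz.2.2.2 t) (sobVal h.1 t)
      + inner ℝ (sobVal δz.2.2.2 t) (sobDer h.1 t)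
      = inner ℝ h.2.2 (G t) - (inner ℝ (P.sensC z g δg ιx t) (sobVal h.1 t)
        + inner ℝ (P.sensC z g δg ιu t) (h.2.1 t)) - mixed z g v h t := by
    filter_upwards [hs.costate, hs.control, hh.1] with t h1 h2 h3
    have h4 : (P.dynJac z g ιu t).adjoint (sobVal δz.2.2.2 t)
        = -P.sensC z g δg ιu t - P.HRow z g ιu t (yq v t) := by
      rw [← h2]; simp only [HRow, yq, hv, yPart]; abel
    have h5 : sobDer δz.2.2.2 t = -(P.dynJac z g ιx t).adjoint (sobVal δz.2.2.2 t)
        - P.HRow z g ιx t (yq v t) - P.sensC z g δg ιx t := by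
      rw [h1]; simp only [HRow, yq, hv, yPart]; abel
    have h6 : inner ℝ (sobVal δz.2.2.2 t) (P.dynJac z g ιu t (h.2.1 t))
        = inner ℝ (-P.sensC z g δg ιu t - P.HRow z g ιu t (yq v t)) (h.2.1 t) := by
      rw [← h4, ContinuousLinearMap.adjoint_inner_left]
    have h7 : inner ℝ (sobVal δz.2.2.2 t) (P.dynJac z g ιp t h.2.2)
        = inner ℝ h.2.2 ((P.dynJac z g ιp t).adjoint (sobVal δz.2.2.2 t)) := by
      rw [ContinuousLinearMap.adjoint_inner_right, real_inner_comm]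
    have h8 : inner ℝ (sobVal δz.2.2.2 t) (P.dynJac z g ιx t (sobVal h.1 t))
        = inner ℝ ((P.dynJac z g ιx t).adjoint (sobVal δz.2.2.2 t)) (sobVal h.1 t) := by
      rw [ContinuousLinearMap.adjoint_inner_left]
    rw [h5, h3, Pi.zero_apply, add_zero, inner_add_right, inner_add_right, h6, h7, h8, hG, mixed]
    simp only [inner_sub_left, inner_neg_left, inner_add_right]
    rw [real_inner_comm (P.HRow z g ιx t (yq v t)), real_inner_comm (P.HRow z g ιu t (yq v t))]
    ring
  have iS : Integrable (fun t => inner ℝ h.2.2 (G t) - (inner ℝ (P.sensC z g δg ιx t) (sobVal h.1 t)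
      + inner ℝ (P.sensC z g δg ιu t) (h.2.1 t))) P.μ := iP.sub iL
  rw [integral_congr_ae hpt, integral_sub iS iM, integral_sub iP iL,
    integral_inner iG, hh.2, inner_zero_right, sub_zero, hs.terminal] at hparts
  have hpar : ∫ t, G t ∂P.μ = -(∫ t, P.sensC z g δg ιp t ∂P.μ)
      - P.φRowP z (sobVal δz.1 P.tf, δz.2.2.1) := by
    rw [← hs.parameter]
    simp only [hG, HRow, yq, hv, yPart]
    abel
  rw [hpar, inner_sub_right, inner_neg_right] at hparts
  have c1 := real_inner_comm (sobVal h.1 P.tf) (P.φRowX z (sobVal δz.1 P.tf, δz.2.2.1))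
  have c2 := real_inner_comm (∫ t, P.sensC z g δg ιp t ∂P.μ) h.2.2
  simp only [endq]
  linarith

section

variable {q : ℝ≥0∞} [Fact (1 ≤ q)]

lemma LinDynamics.sub {r : ℝ → Vec nx} {r₀ : Vec nx} {v v' : P.YSpace q}
    (h : P.LinDynamics z g r r₀ v) (h' : P.LinDynamics z g r r₀ v') :
    P.LinDynamics z g 0 0 (v - v') := by
  constructor
  · filter_upwards [h.1, h'.1, Lp.coeFn_sub v.1.1.2 v'.1.1.2, Lp.coeFn_sub v.2.1 v'.2.1]
      with t h1 h2 h3 h4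
    have e1 : sobDer (v - v').1 t = sobDer v.1 t - sobDer v'.1 t := h3
    have e2 : (v - v').2.1 t = v.2.1 t - v'.2.1 t := h4
    have e3 : sobVal (v - v').1 t = sobVal v.1 t - sobVal v'.1 t := rfl
    have e4 : (v - v').2.2 = v.2.2 - v'.2.2 := rfl
    rw [e1, e2, e3, e4, h1, h2, map_sub, map_sub, map_sub, Pi.zero_apply]
    abel
  · have e3 : sobVal (v - v').1 P.t₀ = sobVal v.1 P.t₀ - sobVal v'.1 P.t₀ := rfl
    rw [e3, h.2, h'.2, sub_self]

end

lemma SolvesSens.linDynamics {q : ℝ≥0∞} [Fact (1 ≤ q)] {δg : P.G3} {δz : P.ZSpace q}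
    (hs : P.SolvesSens z g δg δz) :
    P.LinDynamics z g (P.sensR z g δg) 0 (yPart δz) :=
  ⟨hs.state, hs.initial⟩

/-- Coercivity makes an admissible variation with nonpositive second variation vanish. -/
lemma SSOC.eq_zero (hS : P.SSOC z g) {h : P.YSpace 2} (hh : P.LinDynamics z g 0 0 h)
    (hq : ∫ t, P.HQuad z g t (yq h t) ∂P.μ ≤ 0) : h = 0 := by
  obtain ⟨ε, hε, hc⟩ := hS.coercive
  have h1 := (hc h hh).trans hq
  have n1 : 0 ≤ ∫ t, ‖sobVal h.1 t‖ ^ 2 ∂P.μ := integral_nonneg fun t => by positivity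
  have n2 : 0 ≤ ∫ t, ‖h.2.1 t‖ ^ 2 ∂P.μ := integral_nonneg fun t => by positivity
  have n3 : 0 ≤ ‖h.2.2‖ ^ 2 := by positivity
  have h2 : (∫ t, ‖sobVal h.1 t‖ ^ 2 ∂P.μ) + (∫ t, ‖h.2.1 t‖ ^ 2 ∂P.μ) + ‖h.2.2‖ ^ 2 ≤ 0 :=
    nonpos_of_mul_nonpos_right h1 hε
  have hzero : ∀ {m : ℕ} {w : ℝ → Vec m}, MemLp w 2 P.μ → ∫ t, ‖w t‖ ^ 2 ∂P.μ = 0 →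
      ∀ᵐ t ∂P.μ, w t = 0 := fun hw h0 => by
    have := (integral_eq_zero_iff_of_nonneg (fun t => by positivity)
      ((memLp_two_iff_integrable_sq_norm hw.1).1 hw)).1 h0
    filter_upwards [this] with t ht
    exact norm_eq_zero.1 (pow_eq_zero_iff two_ne_zero |>.1 ht)
  have zx := hzero ((W1.memLp_sobVal h.1).mono_exponent le_top) (by linarith)
  have zu := hzero (Lp.memLp h.2.1) (by linarith)
  have zp : h.2.2 = 0 := norm_eq_zero.1 (pow_eq_zero_iff two_ne_zero |>.1 (by linarith))
  have hx : h.1 = 0 := by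
    refine W1.ext_of_der P.lt hh.2 ?_
    filter_upwards [hh.1, zx, zu, Lp.coeFn_zero (Vec nx) 2 P.μ] with t a1 a2 a3 a4
    rw [a1, a2, a3, zp, map_zero, map_zero, map_zero, Pi.zero_apply]
    have : sobDer (0 : P.XSpace 2) t = 0 := a4
    rw [this]; simp
  have hu : h.2.1 = 0 := Lp.ext (by
    filter_upwards [zu, Lp.coeFn_zero (Vec nu) 2 P.μ] with t a1 a2
    rw [a1, a2]; rfl)
  exact Prod.ext hx (Prod.ext hu zp)

/-- Compared with a solution of the sensitivity system, the cost of any other admissible point is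
larger by the second variation of the difference. -/
lemma SolvesSens.lqCost_eq (hB : BddCoeff z g) (hφ : ContDiff ℝ 2 P.φ) {δg : P.G3}
    {δz : P.ZSpace 2} (hs : P.SolvesSens z g δg δz) {v' : P.YSpace 2}
    (hv : P.LinDynamics z g (P.sensR z g δg) 0 v') :
    P.lqCost z g (P.sensC z g δg ιx) (P.sensC z g δg ιu) 0 (∫ t, P.sensC z g δg ιp t ∂P.μ) v'
      = P.lqCost z g (P.sensC z g δg ιx) (P.sensC z g δg ιu) 0 (∫ t, P.sensC z g δg ιp t ∂P.μ)
          (yPart δz)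
        + (1 / 2) * (∫ t, P.HQuad z g t (yq (v' - yPart δz) t) ∂P.μ)
        + (1 / 2) * P.φQuad z (endq (v' - yPart δz)) := by
  have hd := hv.sub hs.linDynamics
  have h1 := hs.stationary hB hd
  have h2 := lqCost_add hB hφ (hB.sensC δg ιx) (hB.sensC δg ιu) (∫ t, P.sensC z g δg ιp t ∂P.μ)
    (yPart δz) (v' - yPart δz)
  have e : yPart δz + (v' - yPart δz) = v' :=
    Prod.ext (add_sub_cancel (yPart δz).1 v'.1) (Prod.ext (add_sub_cancel (yPart δz).2.1 v'.2.1)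
      (add_sub_cancel (yPart δz).2.2 v'.2.2))
  rw [e] at h2
  rw [h2]
  simp only [endq, yPart] at h1 ⊢
  linarith

/-- A solution of the sensitivity system in `𝒵²` solves the linear-quadratic problem. -/
lemma SolvesSens.solvesLQ (hB : BddCoeff z g) (hφ : ContDiff ℝ 2 P.φ) (hS : P.SSOC z g)
    {δg : P.G3} {δz : P.ZSpace 2} (hs : P.SolvesSens z g δg δz) :
    P.SolvesLQ z g (P.sensR z g δg) 0 (P.sensC z g δg ιx) (P.sensC z g δg ιu) 0
      (∫ t, P.sensC z g δg ιp t ∂P.μ) (yPart δz) := by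
  refine ⟨hs.linDynamics, fun v' hv => ?_⟩
  rw [hs.lqCost_eq hB hφ hv]
  obtain ⟨ε, hε, hc⟩ := hS.coercive
  have h1 := hc _ (hv.sub hs.linDynamics)
  have h2 := hS.endpoint (endq (v' - yPart δz))
  have n1 : 0 ≤ ∫ t, ‖sobVal (v' - yPart δz).1 t‖ ^ 2 ∂P.μ :=
    integral_nonneg fun t => by positivity
  have n2 : 0 ≤ ∫ t, ‖(v' - yPart δz).2.1 t‖ ^ 2 ∂P.μ :=
    integral_nonneg fun t => by positivity
  have h3 : 0 ≤ ∫ t, P.HQuad z g t (yq (v' - yPart δz) t) ∂P.μ :=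
    (by positivity : (0 : ℝ) ≤ _).trans h1
  linarith

/-- An admissible point that costs no more than a solution of the sensitivity system is equal to
it. -/
lemma SolvesSens.eq_of_lqCost_le (hB : BddCoeff z g) (hφ : ContDiff ℝ 2 P.φ) (hS : P.SSOC z g)
    {δg : P.G3} {δz : P.ZSpace 2} (hs : P.SolvesSens z g δg δz) {v' : P.YSpace 2}
    (hv : P.LinDynamics z g (P.sensR z g δg) 0 v')
    (hle : P.lqCost z g (P.sensC z g δg ιx) (P.sensC z g δg ιu) 0
        (∫ t, P.sensC z g δg ιp t ∂P.μ) v'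
      ≤ P.lqCost z g (P.sensC z g δg ιx) (P.sensC z g δg ιu) 0
        (∫ t, P.sensC z g δg ιp t ∂P.μ) (yPart δz)) :
    v' = yPart δz := by
  rw [hs.lqCost_eq hB hφ hv] at hle
  have h2 := hS.endpoint (endq (v' - yPart δz))
  exact sub_eq_zero.1 (hS.eq_zero (hv.sub hs.linDynamics) (by linarith))

end OCP

/-! ### Unique solvability of the linearized optimality system -/

namespace W1

variable {n : ℕ} {t₀ tf : ℝ} {h : t₀ ≤ tf}

/-- A primitive of an essentially bounded function is a Lipschitz Sobolev function. -/
lemma exists_of_primitive {x w : ℝ → Vec n} (hw : MemLp w ⊤ (timeMeasure t₀ tf))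
    (hx : ∀ t ∈ Icc t₀ tf, x t = x t₀ + ∫ s in t₀..t, w s) :
    ∃ y : W1 h ⊤ n, (∀ t ∈ Icc t₀ tf, sobVal y t = x t) ∧ sobDer y =ᵐ[timeMeasure t₀ tf] w := by
  refine ⟨W1.ofDeriv h (x t₀) hw.toLp, fun t ht => ?_, hw.coeFn_toLp⟩
  rw [sobVal_ofDeriv _ _ ht, hx t ht]
  congr 1
  exact intervalIntegral.integral_congr_ae (ae_mem_uIoc_of_timeMeasure hw.coeFn_toLp ht)

lemma exists_linearODE {A : ℝ → Vec n →L[ℝ] Vec n} {b : ℝ → Vec n}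
    (hA : MemLp A ⊤ (timeMeasure t₀ tf)) (hb : MemLp b ⊤ (timeMeasure t₀ tf)) (a : Vec n) :
    ∃ x : W1 h ⊤ n, sobVal x t₀ = a ∧ ∀ᵐ t ∂(timeMeasure t₀ tf),
      sobDer x t = A t (sobVal x t) + b t := by
  obtain ⟨x, hc, hx⟩ := exists_linearODE_solution h hA (hb.integrable le_top) a
  have h0 : x t₀ = a := by rw [hx t₀ ⟨le_rfl, h⟩]; simp
  have hxm : MemLp x ⊤ (timeMeasure t₀ tf) := by
    obtain ⟨C, hC⟩ :=
      (isCompact_Icc (a := t₀) (b := tf)).exists_bound_of_continuousOn hc.continuousOn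
    refine memLp_top_of_bound hc.aestronglyMeasurable C ?_
    filter_upwards [ae_timeMeasure_mem_Icc t₀ tf] with t ht using hC t ht
  obtain ⟨y, h1, h2⟩ := exists_of_primitive (h := h) ((hA.clm_apply_of_top hxm).add hb)
    (x := x) (fun t ht => by rw [h0]; exact hx t ht)
  refine ⟨y, (h1 t₀ ⟨le_rfl, h⟩).trans h0, ?_⟩
  filter_upwards [h2, ae_timeMeasure_mem_Icc t₀ tf] with t h3 h4
  rw [h3, h1 t h4, Pi.add_apply]

/-- Backward uniqueness for the adjoint equation, by duality with `x' = A x + λ`. -/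
lemma eq_zero_of_adjoint (h' : t₀ < tf) {A : ℝ → Vec n →L[ℝ] Vec n}
    (hA : MemLp A ⊤ (timeMeasure t₀ tf)) {lam : W1 h ⊤ n}
    (hd : ∀ᵐ t ∂(timeMeasure t₀ tf), sobDer lam t = -(A t).adjoint (sobVal lam t))
    (hend : sobVal lam tf = 0) : lam = 0 := by
  obtain ⟨x, hx0, hx⟩ := exists_linearODE (h := h) hA (memLp_sobVal lam) 0
  have hparts := integral_inner_sobDer h' lam x
  have hpt : ∀ᵐ t ∂(timeMeasure t₀ tf), inner ℝ (sobDer lam t) (sobVal x t)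
      + inner ℝ (sobVal lam t) (sobDer x t) = ‖sobVal lam t‖ ^ 2 := by
    filter_upwards [hd, hx] with t h1 h2
    rw [h1, h2, inner_neg_left, ContinuousLinearMap.adjoint_inner_left, inner_add_right,
      real_inner_self_eq_norm_sq]
    ring
  rw [integral_congr_ae hpt, hend, hx0, inner_zero_left, inner_zero_right, sub_zero] at hparts
  have hm : MemLp (sobVal lam) 2 (timeMeasure t₀ tf) := (memLp_sobVal lam).mono_exponent le_top
  have hz := (integral_eq_zero_iff_of_nonneg (fun t => by positivity)
    ((memLp_two_iff_integrable_sq_norm hm.1).1 hm)).1 hparts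
  have hz' : ∀ᵐ t ∂(timeMeasure t₀ tf), sobVal lam t = 0 := by
    filter_upwards [hz] with t ht
    exact norm_eq_zero.1 (pow_eq_zero_iff two_ne_zero |>.1 ht)
  have hder : ∀ᵐ t ∂(timeMeasure t₀ tf), sobDer lam t = 0 := by
    filter_upwards [hz', hd] with t h1 h2
    rw [h2, h1, map_zero, neg_zero]
  refine W1.ext_of_der h' ?_ ?_
  · have := sobVal_eq h' lam tf ⟨h, le_rfl⟩
    rw [intervalIntegral.integral_zero_ae (ae_mem_uIoc_of_timeMeasure hder ⟨h, le_rfl⟩), hend,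
      add_zero] at this
    rw [← this]; rfl
  · filter_upwards [hder, Lp.coeFn_zero (Vec n) ⊤ (timeMeasure t₀ tf)] with t h1 h2
    rw [h1]; exact h2.symm

end W1

namespace OCP

variable {nx nu np ng : ℕ} {P : OCP nx nu np ng} {z : P.ZSpace ⊤} {g : P.G3}

/-- The inclusion `L^∞ ⊂ L²`. -/
def inclU (u : P.USpace ⊤) : P.USpace 2 := ((Lp.memLp u).mono_exponent le_top).toLp

lemma coeFn_inclU (u : P.USpace ⊤) : inclU u =ᵐ[P.μ] u :=
  ((Lp.memLp u).mono_exponent le_top).coeFn_toLp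

/-- The inclusion `𝒴^∞ ⊂ 𝒴²`. -/
def inclY (v : P.YSpace ⊤) : P.YSpace 2 := (W1.incl ⊤ 2 le_top v.1, inclU v.2.1, v.2.2)

/-- The inclusion `𝒵^∞ ⊂ 𝒵²`. -/
def inclZ (δz : P.ZSpace ⊤) : P.ZSpace 2 :=
  (W1.incl ⊤ 2 le_top δz.1, inclU δz.2.1, δz.2.2.1, W1.incl ⊤ 2 le_top δz.2.2.2)

lemma yPart_inclZ (δz : P.ZSpace ⊤) : yPart (inclZ δz) = inclY (yPart δz) := rfl

lemma inclY_injective : Function.Injective (inclY (P := P)) := by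
  intro v w h
  have h1 : W1.incl ⊤ 2 le_top v.1 = W1.incl ⊤ 2 le_top w.1 := congrArg Prod.fst h
  have h2 : inclU v.2.1 = inclU w.2.1 := congrArg (fun y : P.YSpace 2 => y.2.1) h
  have h3 : v.2.2 = w.2.2 := congrArg (fun y : P.YSpace 2 => y.2.2) h
  refine Prod.ext (W1.ext_of_der P.lt ?_ ?_) (Prod.ext (Lp.ext ?_) h3)
  · exact congrArg (fun x : P.XSpace 2 => sobVal x P.t₀) h1
  · exact (W1.sobDer_incl le_top v.1).symm.trans (h1 ▸ W1.sobDer_incl le_top w.1)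
  · exact (coeFn_inclU v.2.1).symm.trans (h2 ▸ coeFn_inclU w.2.1)

lemma ae_yq_inclY (v : P.YSpace ⊤) : ∀ᵐ t ∂P.μ, yq (inclY v) t = yq v t := by
  filter_upwards [coeFn_inclU v.2.1] with t ht
  exact Prod.ext rfl (Prod.ext ht rfl)

lemma linDynamics_inclY {r : ℝ → Vec nx} {r₀ : Vec nx} {v : P.YSpace ⊤} :
    P.LinDynamics z g r r₀ (inclY v) ↔ P.LinDynamics z g r r₀ v := by
  have hd := W1.sobDer_incl (q := ⊤) (r := 2) le_top v.1
  have hu := coeFn_inclU v.2.1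
  constructor
  · rintro ⟨h1, h2⟩
    refine ⟨?_, h2⟩
    filter_upwards [h1, hd, hu] with t a b c
    have a' : sobDer (W1.incl ⊤ 2 le_top v.1) t = P.dynJac z g ιx t (sobVal v.1 t)
      + P.dynJac z g ιu t (inclU v.2.1 t) + P.dynJac z g ιp t v.2.2 + r t := a
    rw [← b, a', c]
  · rintro ⟨h1, h2⟩
    refine ⟨?_, h2⟩
    filter_upwards [h1, hd, hu] with t a b c
    have : sobDer (W1.incl ⊤ 2 le_top v.1) t = P.dynJac z g ιx t (sobVal v.1 t)
      + P.dynJac z g ιu t (inclU v.2.1 t) + P.dynJac z g ιp t v.2.2 + r t := by rw [b, a, c]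
    exact this

lemma lqCost_inclY (cx : ℝ → Vec nx) (cu : ℝ → Vec nu) (σf : Vec nx) (γ : Vec np)
    (v : P.YSpace ⊤) : P.lqCost z g cx cu σf γ (inclY v) = P.lqCost z g cx cu σf γ v := by
  have e1 : ∫ t, inner ℝ (cx t) (sobVal (inclY v).1 t) + inner ℝ (cu t) ((inclY v).2.1 t) ∂P.μ
      = ∫ t, inner ℝ (cx t) (sobVal v.1 t) + inner ℝ (cu t) (v.2.1 t) ∂P.μ := by
    refine integral_congr_ae ?_
    filter_upwards [coeFn_inclU v.2.1] with t ht
    have a1 : sobVal (inclY v).1 t = sobVal v.1 t := rfl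
    have a2 : (inclY v).2.1 t = v.2.1 t := ht
    rw [a1, a2]
  have e2 : ∫ t, P.HQuad z g t (yq (inclY v) t) ∂P.μ = ∫ t, P.HQuad z g t (yq v t) ∂P.μ :=
    integral_congr_ae ((ae_yq_inclY v).mono fun t ht => by dsimp only; rw [ht])
  rw [lqCost, lqCost, e1]
  congr 3
  exact congrArg _ e2

lemma SolvesSens.inclZ {δg : P.G3} {δz : P.ZSpace ⊤} (hs : P.SolvesSens z g δg δz) :
    P.SolvesSens z g δg (inclZ δz) := by
  have hd := W1.sobDer_incl (q := ⊤) (r := 2) le_top δz.1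
  have hd' := W1.sobDer_incl (q := ⊤) (r := 2) le_top δz.2.2.2
  have hu := coeFn_inclU δz.2.1
  refine ⟨?_, hs.initial, ?_, hs.terminal, ?_, ?_⟩
  · filter_upwards [hs.state, hd, hu] with t a b c
    have : sobDer (W1.incl ⊤ 2 le_top δz.1) t = P.dynJac z g ιx t (sobVal δz.1 t)
      + P.dynJac z g ιu t (inclU δz.2.1 t) + P.dynJac z g ιp t δz.2.2.1 + P.sensR z g δg t := by
      rw [b, a, c]
    exact this
  · filter_upwards [hs.costate, hd', hu] with t a b c
    have : sobDer (W1.incl ⊤ 2 le_top δz.2.2.2) t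
      = -(P.dynJac z g ιx t).adjoint (sobVal δz.2.2.2 t)
        - P.H z g ιx ιx t (sobVal δz.1 t) - P.H z g ιx ιu t (inclU δz.2.1 t)
        - P.H z g ιx ιp t δz.2.2.1 - P.sensC z g δg ιx t := by
      rw [b, a, c]
    exact this
  · filter_upwards [hs.control, hu] with t a c
    have : P.H z g ιu ιx t (sobVal δz.1 t) + P.H z g ιu ιu t (inclU δz.2.1 t)
      + P.H z g ιu ιp t δz.2.2.1 + (P.dynJac z g ιu t).adjoint (sobVal δz.2.2.2 t)
      = -P.sensC z g δg ιu t := by rw [c, a]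
    exact this
  · have e : ∫ t, P.H z g ιp ιx t (sobVal δz.1 t) + P.H z g ιp ιu t (inclU δz.2.1 t)
        + P.H z g ιp ιp t δz.2.2.1 + (P.dynJac z g ιp t).adjoint (sobVal δz.2.2.2 t) ∂P.μ
        = ∫ t, P.H z g ιp ιx t (sobVal δz.1 t) + P.H z g ιp ιu t (δz.2.1 t)
        + P.H z g ιp ιp t δz.2.2.1 + (P.dynJac z g ιp t).adjoint (sobVal δz.2.2.2 t) ∂P.μ :=
      integral_congr_ae (hu.mono fun t ht => by dsimp only; rw [ht])
    have := hs.parameter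
    rw [← e] at this
    exact this

/-- The homogeneous sensitivity system has only the trivial solution. -/
lemma SolvesSens.eq_zero (hB : BddCoeff z g) (hS : P.SSOC z g)
    {δz : P.ZSpace ⊤} (hs : P.SolvesSens z g 0 δz) : δz = 0 := by
  have hs2 := hs.inclZ
  have hlin : P.LinDynamics z g 0 0 (yPart (OCP.inclZ δz)) := by
    refine ⟨?_, hs2.linDynamics.2⟩
    filter_upwards [hs2.linDynamics.1, ae_sensR_zero z g] with t a b
    rw [a, b]; rfl
  have hst := hs2.stationary hB hlin
  have z1 : ∫ t, inner ℝ (P.sensC z g 0 ιx t) (sobVal (yPart (OCP.inclZ δz)).1 t)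
      + inner ℝ (P.sensC z g 0 ιu t) ((yPart (OCP.inclZ δz)).2.1 t) ∂P.μ = 0 := by
    refine integral_eq_zero_of_ae ?_
    filter_upwards [ae_sensC_zero z g ιx, ae_sensC_zero z g ιu] with t a b
    rw [a, b, inner_zero_left, inner_zero_left, add_zero]; rfl
  have z2 : ∫ t, P.sensC z g 0 ιp t ∂P.μ = 0 := integral_eq_zero_of_ae (ae_sensC_zero z g ιp)
  have hend := hS.endpoint (endq (yPart (OCP.inclZ δz)))
  rw [z1, z2, inner_zero_left, zero_add, add_zero, mixed_self] at hst
  have hy : yPart (OCP.inclZ δz) = 0 := by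
    refine hS.eq_zero hlin ?_
    have hst' : ∫ t, P.HQuad z g t (yq (yPart (OCP.inclZ δz)) t) ∂P.μ
      + P.φQuad z (endq (yPart (OCP.inclZ δz))) = 0 := hst
    linarith
  have hy' : yPart δz = 0 := by
    refine inclY_injective ?_
    rw [← yPart_inclZ, hy]
    refine (Prod.ext ?_ (Prod.ext ?_ rfl) : (0 : P.YSpace 2) = inclY 0)
    · refine W1.ext_of_der P.lt rfl ?_
      filter_upwards [W1.sobDer_incl (q := ⊤) (r := 2) le_top (0 : P.XSpace ⊤),
        Lp.coeFn_zero (Vec nx) 2 P.μ, Lp.coeFn_zero (Vec nx) ⊤ P.μ] with t a b c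
      refine b.trans (Eq.trans c.symm a.symm)
    · refine Lp.ext ?_
      filter_upwards [coeFn_inclU (0 : P.USpace ⊤),
        Lp.coeFn_zero (Vec nu) 2 P.μ, Lp.coeFn_zero (Vec nu) ⊤ P.μ] with t a b c
      exact b.trans (Eq.trans c.symm a.symm)
  have e1 : δz.1 = 0 := congrArg Prod.fst hy'
  have e2 : δz.2.1 = 0 := congrArg (fun v : P.YSpace ⊤ => v.2.1) hy'
  have e3 : δz.2.2.1 = 0 := congrArg (fun v : P.YSpace ⊤ => v.2.2) hy'
  have e1' : ∀ t, sobVal δz.1 t = 0 := fun t => by rw [e1]; rfl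
  have e4 : δz.2.2.2 = 0 := by
    refine W1.eq_zero_of_adjoint P.lt (hB.dyn ιx) ?_ ?_
    · filter_upwards [hs.costate, ae_sensC_zero z g ιx, Lp.coeFn_zero (Vec nu) ⊤ P.μ] with t a b c
      rw [a, b, e1', e2, e3, c]
      simp
    · rw [hs.terminal, e1', e3, φRowX]
      simp
  exact Prod.ext e1 (Prod.ext e2 (Prod.ext e3 e4))

end OCP

/-! ### The initial value problem of the linearized system -/

namespace OCP

variable {nx nu np ng : ℕ} {P : OCP nx nu np ng} {z : P.ZSpace ⊤} {g : P.G3}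

/-- The initial value problem associated with the linearized optimality system: the control
equation is solved for `δu`, which leaves a linear differential equation for `(δx, δλ)`. -/
lemma exists_initialValue (hB : BddCoeff z g) (hS : P.SSOC z g) (a₁ a₃ : Lp (Vec nx) ⊤ P.μ)
    (a₂ : Vec nx) (a₅ : Lp (Vec nu) ⊤ P.μ) (p : Vec np) (lam₀ : Vec nx) :
    ∃ δz : P.ZSpace ⊤,
      (∀ᵐ t ∂P.μ, sobDer δz.1 t = P.dynJac z g ιx t (sobVal δz.1 t)
        + P.dynJac z g ιu t (δz.2.1 t) + P.dynJac z g ιp t δz.2.2.1 - a₁ t) ∧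
      sobVal δz.1 P.t₀ = a₂ ∧
      (∀ᵐ t ∂P.μ, sobDer δz.2.2.2 t = a₃ t - ((P.dynJac z g ιx t).adjoint (sobVal δz.2.2.2 t)
        + P.HRow z g ιx t (P.y δz t))) ∧
      (∀ᵐ t ∂P.μ, (P.dynJac z g ιu t).adjoint (sobVal δz.2.2.2 t)
        + P.HRow z g ιu t (P.y δz t) = a₅ t) ∧
      sobVal δz.2.2.2 P.t₀ = lam₀ ∧ δz.2.2.1 = p := by
  obtain ⟨M, -, hM⟩ := hS.invertible
  obtain ⟨hJ, hJ'⟩ := memLp_ringInverse (hB.H ιu ιu).1 hM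
  set J : ℝ → Vec nu →L[ℝ] Vec nu := fun t => Ring.inverse (P.H z g ιu ιu t) with hJdef
  -- the control as an affine function of `(δx, δλ)`
  set U : ℝ → Vec nx × Vec nx →L[ℝ] Vec nu := fun t =>
    (J t).comp (-((P.H z g ιu ιx t).comp (ContinuousLinearMap.fst ℝ _ _)
      + ((P.dynJac z g ιu t).adjoint).comp (ContinuousLinearMap.snd ℝ _ _))) with hU
  set u₀ : ℝ → Vec nu := fun t => J t (a₅ t - P.H z g ιu ιp t p) with hu₀
  have mU : ∀ ξ, MemLp (fun t => U t ξ) ⊤ P.μ := fun ξ => hJ.clm_apply_of_top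
    (((hB.H ιu ιx).clm_apply_of_top (memLp_const ξ.1)).add
      ((memLp_adjoint (hB.dyn ιu)).clm_apply_of_top (memLp_const ξ.2))).neg
  have mu₀ : MemLp u₀ ⊤ P.μ := hJ.clm_apply_of_top
    ((Lp.memLp a₅).sub ((hB.H ιu ιp).clm_apply_of_top (memLp_const p)))
  set 𝒜 : ℝ → Vec nx × Vec nx →L[ℝ] Vec nx × Vec nx := fun t =>
    ((P.dynJac z g ιx t).comp (ContinuousLinearMap.fst ℝ _ _) + (P.dynJac z g ιu t).comp (U t)).prod
      (-((P.dynJac z g ιx t).adjoint.comp (ContinuousLinearMap.snd ℝ _ _)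
        + ((P.H z g ιx ιx t).comp (ContinuousLinearMap.fst ℝ _ _)
          + (P.H z g ιx ιu t).comp (U t)))) with h𝒜
  set β : ℝ → Vec nx × Vec nx := fun t =>
    (P.dynJac z g ιu t (u₀ t) + P.dynJac z g ιp t p - a₁ t,
     a₃ t - (P.H z g ιx ιu t (u₀ t) + P.H z g ιx ιp t p)) with hβ
  have m𝒜 : MemLp 𝒜 ⊤ P.μ := memLp_clm_of_apply fun ξ => MemLp.of_fst_snd
    ⟨((hB.dyn ιx).clm_apply_of_top (memLp_const ξ.1)).add ((hB.dyn ιu).clm_apply_of_top (mU ξ)),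
      (((memLp_adjoint (hB.dyn ιx)).clm_apply_of_top (memLp_const ξ.2)).add
        (((hB.H ιx ιx).clm_apply_of_top (memLp_const ξ.1)).add
          ((hB.H ιx ιu).clm_apply_of_top (mU ξ)))).neg⟩
  have mβ : MemLp β ⊤ P.μ := MemLp.of_fst_snd
    ⟨(((hB.dyn ιu).clm_apply_of_top mu₀).add ((hB.dyn ιp).clm_apply_of_top (memLp_const p))).sub
      (Lp.memLp a₁), (Lp.memLp a₃).sub (((hB.H ιx ιu).clm_apply_of_top mu₀).add
        ((hB.H ιx ιp).clm_apply_of_top (memLp_const p)))⟩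
  obtain ⟨ξ, hc, hξ⟩ := exists_linearODE_solution P.lt.le m𝒜 (mβ.integrable le_top) (a₂, lam₀)
  have hξ0 : ξ P.t₀ = (a₂, lam₀) := by rw [hξ P.t₀ ⟨le_rfl, P.lt.le⟩]; simp
  have mξ : MemLp ξ ⊤ P.μ := by
    obtain ⟨C, hC⟩ :=
      (isCompact_Icc (a := P.t₀) (b := P.tf)).exists_bound_of_continuousOn hc.continuousOn
    refine memLp_top_of_bound hc.aestronglyMeasurable C ?_
    filter_upwards [ae_timeMeasure_mem_Icc P.t₀ P.tf] with t ht using hC t ht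
  have mr : MemLp (fun t => 𝒜 t (ξ t) + β t) ⊤ P.μ := (m𝒜.clm_apply_of_top mξ).add mβ
  have hint : ∀ t ∈ Icc P.t₀ P.tf,
      IntervalIntegrable (fun t => 𝒜 t (ξ t) + β t) volume P.t₀ t := fun t ht =>
    intervalIntegrable_of_integrable_timeMeasure P.lt.le (mr.integrable le_top)
      ⟨le_rfl, P.lt.le⟩ ht
  obtain ⟨x, hx, hx'⟩ := W1.exists_of_primitive (h := P.lt.le) (x := fun t => (ξ t).1) mr.fst
    (fun t ht => by
      have h1 := (ContinuousLinearMap.fst ℝ (Vec nx) (Vec nx)).intervalIntegral_comp_comm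
        (hint t ht)
      have h2 := congrArg Prod.fst (hξ t ht)
      rw [hξ0]
      exact h2.trans (congrArg (a₂ + ·) h1.symm))
  obtain ⟨lam, hlam, hlam'⟩ := W1.exists_of_primitive (h := P.lt.le) (x := fun t => (ξ t).2) mr.snd
    (fun t ht => by
      have h1 := (ContinuousLinearMap.snd ℝ (Vec nx) (Vec nx)).intervalIntegral_comp_comm
        (hint t ht)
      have h2 := congrArg Prod.snd (hξ t ht)
      rw [hξ0]
      exact h2.trans (congrArg (lam₀ + ·) h1.symm))
  have mu : MemLp (fun t => U t (ξ t) + u₀ t) ⊤ P.μ :=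
    ((memLp_clm_of_apply mU).clm_apply_of_top mξ).add mu₀
  have hu := mu.coeFn_toLp
  have ht₀ : P.t₀ ∈ Icc P.t₀ P.tf := ⟨le_rfl, P.lt.le⟩
  have hmem := ae_timeMeasure_mem_Icc P.t₀ P.tf
  refine ⟨(x, mu.toLp, p, lam), ?_, ?_, ?_, ?_, ?_, rfl⟩
  · filter_upwards [hx', hmem, hu] with t h1 h2 h3
    have h4 : sobDer x t = P.dynJac z g ιx t (sobVal x t)
        + P.dynJac z g ιu t (mu.toLp _ t) + P.dynJac z g ιp t p - a₁ t := by
      rw [h1, hx t h2, h3, map_add]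
      simp only [h𝒜, hβ, ContinuousLinearMap.prod_apply, add_apply,
        ContinuousLinearMap.comp_apply, ContinuousLinearMap.coe_fst', Prod.fst_add]
      abel
    exact h4
  · exact (hx P.t₀ ht₀).trans (congrArg Prod.fst hξ0)
  · filter_upwards [hlam', hx', hmem, hu] with t h1 _ h2 h3
    have h4 : sobDer lam t = a₃ t - ((P.dynJac z g ιx t).adjoint (sobVal lam t)
        + (P.H z g ιx ιx t (sobVal x t) + P.H z g ιx ιu t (mu.toLp _ t)
          + P.H z g ιx ιp t p)) := by
      rw [h1, hlam t h2, hx t h2, h3, map_add]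
      simp only [h𝒜, hβ, ContinuousLinearMap.prod_apply, add_apply, neg_apply,
        ContinuousLinearMap.comp_apply, ContinuousLinearMap.coe_fst',
        ContinuousLinearMap.coe_snd', Prod.snd_add]
      abel
    exact h4
  · filter_upwards [hmem, hu, hJ'] with t h2 h3 h5
    have h4 : (P.dynJac z g ιu t).adjoint (sobVal lam t)
        + (P.H z g ιu ιx t (sobVal x t) + P.H z g ιu ιu t (mu.toLp _ t)
          + P.H z g ιu ιp t p) = a₅ t := by
      have h6 : U t (ξ t) + u₀ t = J t (a₅ t - P.H z g ιu ιp t p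
          - (P.H z g ιu ιx t (ξ t).1 + (P.dynJac z g ιu t).adjoint (ξ t).2)) := by
        rw [map_sub, hU, hu₀]
        simp only [ContinuousLinearMap.comp_apply, neg_apply, add_apply,
          ContinuousLinearMap.coe_fst', ContinuousLinearMap.coe_snd', map_neg]
        abel
      rw [hlam t h2, hx t h2, h3, h6, h5]
      abel
    exact h4
  · exact (hlam P.t₀ ht₀).trans (congrArg Prod.snd hξ0)

end OCP

/-! ### Implicit solution of the optimality system -/

section FourFactors

variable {A B C E X V : Type*} [NormedAddCommGroup A] [NormedSpace ℝ A]
  [NormedAddCommGroup B] [NormedSpace ℝ B] [NormedAddCommGroup C] [NormedSpace ℝ C]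
  [NormedAddCommGroup E] [NormedSpace ℝ E] [NormedAddCommGroup X] [NormedSpace ℝ X]
  [NormedAddCommGroup V] [NormedSpace ℝ V] [CompleteSpace A] [CompleteSpace B] [CompleteSpace C]
  [CompleteSpace E] [CompleteSpace V]

/-- The implicit function theorem for an equation with four unknowns whose linearization is
bijective, with neighborhoods in each factor; the derivative of the solution is characterized by
the linearized equation. -/
lemma exists_implicit_function_of_bijective {Ψ : (A × B × C × E) × X → V} (hΨ : ContDiff ℝ 1 Ψ)
    {a : A} {b : B} {c : C} {e : E} {g₁ : X} (h0 : Ψ ((a, b, c, e), g₁) = 0)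
    (hbij : Function.Bijective fun z => fderiv ℝ Ψ ((a, b, c, e), g₁) (z, 0)) :
    ∃ Ng : Set X, IsOpen Ng ∧ g₁ ∈ Ng ∧
    ∃ Na ∈ 𝓝 a, ∃ Nb ∈ 𝓝 b, ∃ Nc ∈ 𝓝 c, ∃ Ne ∈ 𝓝 e,
    ∃ (x : X → A) (u : X → B) (p : X → C) (l : X → E),
      MapsTo x Ng Na ∧ MapsTo u Ng Nb ∧ MapsTo p Ng Nc ∧ MapsTo l Ng Ne ∧
      ContDiffOn ℝ 1 x Ng ∧ ContDiffOn ℝ 1 u Ng ∧ ContDiffOn ℝ 1 p Ng ∧ ContDiffOn ℝ 1 l Ng ∧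
      x g₁ = a ∧ u g₁ = b ∧ p g₁ = c ∧ l g₁ = e ∧
      (∀ g ∈ Ng, Ψ ((x g, u g, p g, l g), g) = 0) ∧
      (∀ g ∈ Ng, ∀ x' ∈ Na, ∀ u' ∈ Nb, ∀ p' ∈ Nc, ∀ l' ∈ Ne, Ψ ((x', u', p', l'), g) = 0 →
        x' = x g ∧ u' = u g ∧ p' = p g ∧ l' = l g) ∧
      ∃ D : X →L[ℝ] A × B × C × E, HasFDerivAt (fun g => (x g, u g, p g, l g)) D g₁ ∧
        ∀ δg δz, fderiv ℝ Ψ ((a, b, c, e), g₁) (δz, δg) = 0 ↔ δz = D δg := by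
  set T := fderiv ℝ Ψ ((a, b, c, e), g₁) with hT
  set T₁ := T.comp (ContinuousLinearMap.inl ℝ (A × B × C × E) X) with hT₁
  have hinj : LinearMap.ker (T₁ : (A × B × C × E) →ₗ[ℝ] V) = ⊥ :=
    LinearMap.ker_eq_bot.2 hbij.1
  have hsurj : LinearMap.range (T₁ : (A × B × C × E) →ₗ[ℝ] V) = ⊤ :=
    LinearMap.range_eq_top.2 hbij.2
  let eq := ContinuousLinearEquiv.ofBijective T₁ hinj hsurj
  have heq : T₁ = eq := ContinuousLinearMap.ext fun v => rfl
  obtain ⟨Ng, hNo, hNg, r, hr, ζ, hmaps, hcd, hζ, hsol, huniq, hder⟩ :=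
    exists_implicit_function hΨ h0 eq heq
  have hmem : ∀ w : A × B × C × E, w ∈ Metric.closedBall (a, b, c, e) r ↔
      w.1 ∈ Metric.closedBall a r ∧ w.2.1 ∈ Metric.closedBall b r ∧ w.2.2.1 ∈ Metric.closedBall c r
        ∧ w.2.2.2 ∈ Metric.closedBall e r := fun w => by
    simp only [Metric.mem_closedBall, Prod.dist_eq, sup_le_iff]
  refine ⟨Ng, hNo, hNg, _, Metric.closedBall_mem_nhds a hr, _, Metric.closedBall_mem_nhds b hr, _,
    Metric.closedBall_mem_nhds c hr, _, Metric.closedBall_mem_nhds e hr, fun g => (ζ g).1,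
    fun g => (ζ g).2.1, fun g => (ζ g).2.2.1, fun g => (ζ g).2.2.2,
    fun g hg => ((hmem _).1 (hmaps hg)).1, fun g hg => ((hmem _).1 (hmaps hg)).2.1,
    fun g hg => ((hmem _).1 (hmaps hg)).2.2.1, fun g hg => ((hmem _).1 (hmaps hg)).2.2.2,
    hcd.fst, hcd.snd.fst, hcd.snd.snd.fst, hcd.snd.snd.snd, by simp only [hζ],
    by simp only [hζ], by simp only [hζ], by simp only [hζ], hsol, ?_, _, hder, fun δg δz => ?_⟩
  · intro g hg x' hx u' hu p' hp l' hl h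
    have := huniq g hg (x', u', p', l') ((hmem _).2 ⟨hx, hu, hp, hl⟩) h
    exact ⟨congrArg Prod.fst this, congrArg (fun w => w.2.1) this,
      congrArg (fun w => w.2.2.1) this, congrArg (fun w => w.2.2.2) this⟩
  · have h1 : T (δz, δg) = eq δz + T (0, δg) := by
      have : eq δz = T (δz, 0) := rfl
      rw [this, ← map_add]; simp
    rw [h1, add_eq_zero_iff_eq_neg, ← eq.symm_apply_eq.trans eq_comm, map_neg, eq_comm]
    rfl

end FourFactors

namespace OCP

variable {nx nu np ng : ℕ} {P : OCP nx nu np ng} {z : P.ZSpace ⊤} {g : P.G3}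

/-- A linearization vanishes exactly when the sensitivity system holds. -/
lemma IsLinearization.eq_zero_iff (hB : BddCoeff z g) {δz : P.ZSpace ⊤} {δg : P.G3} {v : P.VSpace}
    (h : IsLinearization z g δz δg v) : v = 0 ↔ P.SolvesSens z g δg δz := by
  have hz : ∀ {m : ℕ} (a : Lp (Vec m) ⊤ P.μ) {b : ℝ → Vec m}, a =ᵐ[P.μ] b →
      (a = 0 ↔ ∀ᵐ t ∂P.μ, b t = 0) := fun a b hab => by
    rw [Lp.eq_zero_iff_ae_eq_zero]
    exact ⟨fun h => hab.symm.trans h, fun h => hab.trans h⟩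
  have hp : v.2.2.2.2.2 = P.φRowP z (P.endPt δz)
      + (∫ t, P.H z g ιp ιx t (sobVal δz.1 t) + P.H z g ιp ιu t (δz.2.1 t)
        + P.H z g ιp ιp t δz.2.2.1 + (P.dynJac z g ιp t).adjoint (sobVal δz.2.2.2 t) ∂P.μ)
      + ∫ t, P.sensC z g δg ιp t ∂P.μ := by
    have i1 : Integrable (fun t => P.H z g ιp ιx t (sobVal δz.1 t) + P.H z g ιp ιu t (δz.2.1 t)
        + P.H z g ιp ιp t δz.2.2.1 + (P.dynJac z g ιp t).adjoint (sobVal δz.2.2.2 t)) P.μ :=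
      ((hB.memLp_HRow (yPart δz) ιp).integrable le_top).add
        ((hB.memLp_adjoint_dynJac δz.2.2.2 ιp).integrable le_top)
    rw [h.parameter, add_assoc, ← integral_add i1 ((hB.sensC δg ιp).integrable le_top)]
    congr 2
    funext t
    simp only [HRow, y, lam]
    abel
  have e : v = 0 ↔ v.1 = 0 ∧ v.2.1 = 0 ∧ v.2.2.1 = 0 ∧ v.2.2.2.1 = 0 ∧ v.2.2.2.2.1 = 0
      ∧ v.2.2.2.2.2 = 0 := by
    simp only [Prod.ext_iff, Prod.fst_zero, Prod.snd_zero]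
  rw [e, hz _ h.state, h.initial, hz _ h.costate, h.terminal, hz _ h.control, hp]
  constructor
  · rintro ⟨h1, h2, h3, h4, h5, h6⟩
    refine ⟨h1.mono fun t ht => (sub_eq_zero.1 ht).symm, neg_eq_zero.1 h2, h3.mono fun t ht => ?_,
      (sub_eq_zero.1 h4).symm, h5.mono fun t ht => ?_, eq_neg_of_add_eq_zero_left h6⟩
    · rw [eq_neg_of_add_eq_zero_left ht]
      simp only [HRow, y, lam]
      abel
    · refine eq_neg_of_add_eq_zero_left (Eq.trans ?_ ht)
      simp only [HRow, y, lam]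
      abel
  · rintro ⟨h1, h2, h3, h4, h5, h6⟩
    refine ⟨h1.mono fun t ht => sub_eq_zero.2 ht.symm, neg_eq_zero.2 h2, h3.mono fun t ht => ?_,
      sub_eq_zero.2 h4.symm, h5.mono fun t ht => ?_, ?_⟩
    · rw [ht]
      simp only [HRow, y, lam]
      abel
    · refine Eq.trans ?_ (add_eq_zero_iff_eq_neg.2 ht)
      simp only [HRow, y, lam]
      abel
    · rw [add_eq_zero_iff_eq_neg]; exact h6

/-- The linearization of the optimality system in `z` is bijective. Injectivity comes from the
second-order condition; it yields surjectivity, since the equations on `I` can be solved with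
prescribed initial values. -/
lemma bijective_of_isLinearization (hB : BddCoeff z g) (hS : P.SSOC z g)
    (T : P.ZSpace ⊤ →ₗ[ℝ] P.VSpace) (hT : ∀ δz, IsLinearization z g δz 0 (T δz)) :
    Function.Bijective T := by
  have hinj : Function.Injective T := by
    rw [injective_iff_map_eq_zero]
    exact fun δz h0 => (((hT δz).eq_zero_iff hB).1 h0).eq_zero hB hS
  refine ⟨hinj, ?_⟩
  let TA : P.ZSpace ⊤ →ₗ[ℝ] Lp (Vec nx) ⊤ P.μ × Vec nx × Lp (Vec nx) ⊤ P.μ × Lp (Vec nu) ⊤ P.μ :=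
    { toFun := fun δz => ((T δz).1, (T δz).2.1, (T δz).2.2.1, (T δz).2.2.2.2.1)
      map_add' := fun a b => by rw [map_add]; rfl
      map_smul' := fun c a => by rw [map_smul]; rfl }
  let TF : P.ZSpace ⊤ →ₗ[ℝ] Vec nx × Vec np :=
    { toFun := fun δz => ((T δz).2.2.2.1, (T δz).2.2.2.2.2)
      map_add' := fun a b => by rw [map_add]; rfl
      map_smul' := fun c a => by rw [map_smul]; rfl }
  let s : P.ZSpace ⊤ →ₗ[ℝ] Vec nx × Vec np :=
    { toFun := fun δz => (sobVal δz.2.2.2 P.t₀, δz.2.2.1)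
      map_add' := fun a b => rfl
      map_smul' := fun c a => rfl }
  have hs : ∀ a f, ∃ δz, TA δz = a ∧ s δz = f := by
    rintro ⟨a₁, a₂, a₃, a₅⟩ ⟨lam₀, p⟩
    obtain ⟨δz, h1, h2, h3, h4, h5, h6⟩ := exists_initialValue hB hS a₁ a₃ (-a₂) a₅ p lam₀
    refine ⟨δz, Prod.ext (Lp.ext ?_) (Prod.ext ?_ (Prod.ext (Lp.ext ?_) (Lp.ext ?_))),
      Prod.ext h5 h6⟩
    · filter_upwards [(hT δz).state, h1, ae_sensR_zero z g] with t k1 k2 k3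
      refine k1.trans ?_
      rw [k2, k3]; abel
    · refine (hT δz).initial.trans ?_
      rw [h2, neg_neg]
    · filter_upwards [(hT δz).costate, h3, ae_sensC_zero z g ιx] with t k1 k2 k3
      refine k1.trans ?_
      rw [k2, k3]
      simp only [lam]
      abel
    · filter_upwards [(hT δz).control, h4, ae_sensC_zero z g ιu] with t k1 k2 k3
      refine k1.trans ?_
      rw [k3, add_zero]
      exact k2
  have hinj' : ∀ a b, TA a = TA b → TF a = TF b → a = b := fun a b h1 h2 =>
    hinj (Prod.ext (congrArg (fun w => w.1) h1) (Prod.ext (congrArg (fun w => w.2.1) h1)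
      (Prod.ext (congrArg (fun w => w.2.2.1) h1) (Prod.ext (congrArg (fun w => w.1) h2)
      (Prod.ext (congrArg (fun w => w.2.2.2) h1) (congrArg (fun w => w.2) h2))))))
  intro v
  obtain ⟨δz, h1, h2⟩ := exists_of_injective_of_initialValue (Z := P.ZSpace ⊤)
    (A := Lp (Vec nx) ⊤ P.μ × Vec nx × Lp (Vec nx) ⊤ P.μ × Lp (Vec nu) ⊤ P.μ)
    (F := Vec nx × Vec np) TA TF s hs hinj'
    (v.1, v.2.1, v.2.2.1, v.2.2.2.2.1) (v.2.2.2.1, v.2.2.2.2.2)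
  exact ⟨δz, Prod.ext (congrArg (fun w => w.1) h1) (Prod.ext (congrArg (fun w => w.2.1) h1)
      (Prod.ext (congrArg (fun w => w.2.2.1) h1) (Prod.ext (congrArg (fun w => w.1) h2)
      (Prod.ext (congrArg (fun w => w.2.2.2) h1) (congrArg (fun w => w.2) h2)))))⟩

end OCP

/-! ### Sensitivities and the linear-quadratic problem -/

namespace OCP

variable {nx nu np ng : ℕ} {P : OCP nx nu np ng} {z : P.ZSpace ⊤} {g : P.G3}

/-- In `𝒴²`, the sensitivity system and the linear-quadratic problem have the same solutions, as
soon as the former has one. -/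
lemma exists_solvesSens_two_iff (hB : BddCoeff z g) (hφ : ContDiff ℝ 2 P.φ) (hS : P.SSOC z g)
    {δg : P.G3} {δz : P.ZSpace 2} (hs : P.SolvesSens z g δg δz) (v : P.YSpace 2) :
    (∃ δl : P.XSpace 2, P.SolvesSens z g δg (v.1, v.2.1, v.2.2, δl)) ↔
      P.SolvesLQ z g (P.sensR z g δg) 0 (P.sensC z g δg ιx) (P.sensC z g δg ιu) 0
        (∫ t, P.sensC z g δg ιp t ∂P.μ) v := by
  refine ⟨fun ⟨δl, h⟩ => h.solvesLQ hB hφ hS, fun h => ⟨δz.2.2.2, ?_⟩⟩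
  have hv : v = yPart δz := hs.eq_of_lqCost_le hB hφ hS h.1 (h.2 _ hs.linDynamics)
  rw [hv]
  exact hs

/-- The analogue of `exists_solvesSens_two_iff` in `𝒴^∞`, by inclusion into `𝒴²`. -/
lemma exists_solvesSens_top_iff (hB : BddCoeff z g) (hφ : ContDiff ℝ 2 P.φ) (hS : P.SSOC z g)
    {δg : P.G3} {δz : P.ZSpace ⊤} (hs : P.SolvesSens z g δg δz) (v : P.YSpace ⊤) :
    (∃ δl : P.XSpace ⊤, P.SolvesSens z g δg (v.1, v.2.1, v.2.2, δl)) ↔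
      P.SolvesLQ z g (P.sensR z g δg) 0 (P.sensC z g δg ιx) (P.sensC z g δg ιu) 0
        (∫ t, P.sensC z g δg ιp t ∂P.μ) v := by
  constructor
  · rintro ⟨δl, h⟩
    obtain ⟨h1, h2⟩ := h.inclZ.solvesLQ hB hφ hS
    refine ⟨linDynamics_inclY.1 h1, fun v' hv' => ?_⟩
    have h3 := h2 _ (linDynamics_inclY.2 hv')
    rw [lqCost_inclY] at h3
    exact (lqCost_inclY _ _ _ _ _).symm.trans_le h3
  · intro h
    refine ⟨δz.2.2.2, ?_⟩
    have hd : P.LinDynamics z g (P.sensR z g δg) 0 (yPart δz) :=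
      linDynamics_inclY.1 hs.inclZ.linDynamics
    have hv : inclY v = yPart (inclZ δz) := hs.inclZ.eq_of_lqCost_le hB hφ hS
      (linDynamics_inclY.2 h.1) (by
        rw [yPart_inclZ, lqCost_inclY, lqCost_inclY]
        exact h.2 _ hd)
    obtain rfl : v = yPart δz := inclY_injective (hv.trans (yPart_inclZ δz))
    exact hs

end OCP

end

theorem mainTheorem1 {nx nu np ng : ℕ} (P : OCP nx nu np ng)
    (hφ : ContDiff ℝ 2 P.φ) (hf : OCP.Smooth P.μ P.f) (hl : OCP.Smooth P.μ P.l)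
    (x₁ : P.XSpace ⊤) (u₁ : P.USpace ⊤) (p₁ : Vec np) (l₁ : P.XSpace ⊤) (g₁ : P.G3)
    (hKKT : P.SolvesKKT (x₁, u₁, p₁, l₁) g₁) (hSSOC : P.SSOC (x₁, u₁, p₁, l₁) g₁) :
    ∃ Ng : Set P.G3, IsOpen Ng ∧ g₁ ∈ Ng ∧
    ∃ Nx ∈ 𝓝 x₁, ∃ Nu ∈ 𝓝 u₁, ∃ Np ∈ 𝓝 p₁, ∃ Nl ∈ 𝓝 l₁,
    ∃ (x : P.G3 → P.XSpace ⊤) (u : P.G3 → P.USpace ⊤) (p : P.G3 → Vec np)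
      (lam : P.G3 → P.XSpace ⊤),
      MapsTo x Ng Nx ∧ MapsTo u Ng Nu ∧ MapsTo p Ng Np ∧ MapsTo lam Ng Nl ∧
      ContDiffOn ℝ 1 x Ng ∧ ContDiffOn ℝ 1 u Ng ∧ ContDiffOn ℝ 1 p Ng ∧ ContDiffOn ℝ 1 lam Ng ∧
      x g₁ = x₁ ∧ u g₁ = u₁ ∧ p g₁ = p₁ ∧ lam g₁ = l₁ ∧
      (∀ g ∈ Ng, P.SolvesKKT (x g, u g, p g, lam g) g) ∧
      (∀ g ∈ Ng, ∀ x' ∈ Nx, ∀ u' ∈ Nu, ∀ p' ∈ Np, ∀ l' ∈ Nl, P.SolvesKKT (x', u', p', l') g →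
        x' = x g ∧ u' = u g ∧ p' = p g ∧ l' = lam g) ∧
      ∃ D : P.G3 →L[ℝ] P.ZSpace ⊤,
        HasFDerivAt (fun g => ((x g, u g, p g, lam g) : P.ZSpace ⊤)) D g₁ ∧
        ∀ δg : P.G3,
          (∀ δz : P.ZSpace ⊤, P.SolvesSens (x₁, u₁, p₁, l₁) g₁ δg δz ↔ δz = D δg) ∧
          (∀ v : P.YSpace ⊤,
            (∃ δl : P.XSpace ⊤,
              P.SolvesSens (x₁, u₁, p₁, l₁) g₁ δg (v.1, v.2.1, v.2.2, δl)) ↔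
            P.SolvesLQ (x₁, u₁, p₁, l₁) g₁ (P.sensR (x₁, u₁, p₁, l₁) g₁ δg) 0
              (P.sensC (x₁, u₁, p₁, l₁) g₁ δg OCP.ιx) (P.sensC (x₁, u₁, p₁, l₁) g₁ δg OCP.ιu)
              0 (∫ t, P.sensC (x₁, u₁, p₁, l₁) g₁ δg OCP.ιp t ∂P.μ) v) ∧
          (∀ v : P.YSpace 2,
            (∃ δl : P.XSpace 2,
              P.SolvesSens (x₁, u₁, p₁, l₁) g₁ δg (v.1, v.2.1, v.2.2, δl)) ↔
            P.SolvesLQ (x₁, u₁, p₁, l₁) g₁ (P.sensR (x₁, u₁, p₁, l₁) g₁ δg) 0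
              (P.sensC (x₁, u₁, p₁, l₁) g₁ δg OCP.ιx) (P.sensC (x₁, u₁, p₁, l₁) g₁ δg OCP.ιu)
              0 (∫ t, P.sensC (x₁, u₁, p₁, l₁) g₁ δg OCP.ιp t ∂P.μ) v) := by

  have := W1.completeSpace_top (n := nx) P.lt
  have hB := OCP.bddCoeff hf hl (x₁, u₁, p₁, l₁) g₁
  have hlin : ∀ δz : P.ZSpace ⊤, ∀ δg : P.G3, OCP.IsLinearization (x₁, u₁, p₁, l₁) g₁ δz δg
      (fderiv ℝ (OCP.residual hf hl) ((x₁, u₁, p₁, l₁), g₁) (δz, δg)) := fun δz δg =>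
    OCP.isLinearization_fderiv_residual hf hl hφ ((x₁, u₁, p₁, l₁), g₁) (δz, δg)
  have hbij : Function.Bijective fun δz : P.ZSpace ⊤ =>
      fderiv ℝ (OCP.residual hf hl) ((x₁, u₁, p₁, l₁), g₁) (δz, 0) :=
    OCP.bijective_of_isLinearization hB hSSOC
      (((fderiv ℝ (OCP.residual hf hl) ((x₁, u₁, p₁, l₁), g₁)).comp
        (ContinuousLinearMap.inl ℝ (P.ZSpace ⊤) P.G3)) : P.ZSpace ⊤ →ₗ[ℝ] P.VSpace)
      fun δz => hlin δz 0
  obtain ⟨Ng, hNo, hNg, Nx, hNx, Nu, hNu, Np, hNp, Nl, hNl, x, u, p, l, mx, mu, mp, ml, cx, cu, cp,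
    cl, ex, eu, ep, el, hsol, huniq, D, hD, hD'⟩ :=
    exists_implicit_function_of_bijective (OCP.contDiff_residual hf hl hφ)
      ((OCP.residual_eq_zero_iff hf hl ((x₁, u₁, p₁, l₁), g₁)).2 hKKT) hbij
  have hsens : ∀ (δg : P.G3) (δz : P.ZSpace ⊤),
      P.SolvesSens (x₁, u₁, p₁, l₁) g₁ δg δz ↔ δz = D δg :=
    fun δg δz => ((hlin δz δg).eq_zero_iff hB).symm.trans (hD' δg δz)
  refine ⟨Ng, hNo, hNg, Nx, hNx, Nu, hNu, Np, hNp, Nl, hNl, x, u, p, l, mx, mu, mp, ml, cx, cu, cp,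
    cl, ex, eu, ep, el,
    fun g hg => (OCP.residual_eq_zero_iff hf hl ((x g, u g, p g, l g), g)).1 (hsol g hg),
    fun g hg x' hx' u' hu' p' hp' l' hl' h => huniq g hg x' hx' u' hu' p' hp' l' hl'
      ((OCP.residual_eq_zero_iff hf hl ((x', u', p', l'), g)).2 h), D, hD, fun δg => ?_⟩
  -- the derivative itself is the solution with which other admissible points are compared
  have hs : P.SolvesSens (x₁, u₁, p₁, l₁) g₁ δg (D δg) := (hsens δg _).2 rfl
  exact ⟨hsens δg, fun v => OCP.exists_solvesSens_top_iff hB hφ hSSOC hs v,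
    fun v => OCP.exists_solvesSens_two_iff hB hφ hSSOC hs.inclZ v⟩
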